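/- Let $M$ be a smooth supermanifold of dimension $p|q$ with an atlas for which all Berezinians of the changes of coordinates are positive. For $w\in\mathbb R$, a density of weight $w$ on $M$ is given in local coordinates $x^a$ (even and odd, of parity $\tilde a$) by $\psi(x)(Dx)^w$, where $Dx'=J\,Dx$ with $J=\mathrm{Ber}(\partial x'/\partial x)$; let $\mathfrak V(M)$ be the supercommutative algebra of finite formal sums $\boldsymbol\psi=\sum_w\psi_w(x)(Dx)^w$ of densities of all real weights. An odd long bracket (of weight $0$) on $M$ is an odd symmetric bi-derivation of $\mathfrak V(M)$, $$\{\boldsymbol\psi;\boldsymbol\chi\}=(-1)^{\tilde\psi\tilde\chi}\{\boldsymbol\chi;\boldsymbol\psi\},\qquad \{\boldsymbol\psi;\boldsymbol\chi\boldsymbol\varphi\}=\{\boldsymbol\psi;\boldsymbol\chi\}\boldsymbol\varphi+(-1)^{(\tilde\psi+1)\tilde\chi}\boldsymbol\chi\{\boldsymbol\psi;\boldsymbol\varphi\},$$ which is given in local coordinates by $$\{\psi(Dx)^{u};\chi(Dx)^{v}\}=\Bigl(S^{ab}\,\partial_b\psi\,\partial_a\chi\,(-1)^{\tilde a\tilde\psi}+\gamma^a\bigl(v\,\partial_a\psi\,\chi+(-1)^{\tilde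 a\tilde\psi}u\,\psi\,\partial_a\chi\bigr)+uv\,\theta\,\psi\chi\Bigr)(Dx)^{u+v}$$ with superfunctions $S^{ab}=(-1)^{\tilde a\tilde b}S^{ba}$, $\gamma^a$, $\theta$ of parities $\tilde a+\tilde b+1$, $\tilde a+1$, $1$. It satisfies the Jacobi identity if $$(-1)^{\tilde\psi\tilde\varphi}\{\{\boldsymbol\psi;\boldsymbol\chi\};\boldsymbol\varphi\}+(-1)^{\tilde\varphi\tilde\chi}\{\{\boldsymbol\varphi;\boldsymbol\psi\};\boldsymbol\chi\}+(-1)^{\tilde\chi\tilde\psi}\{\{\boldsymbol\chi;\boldsymbol\varphi\};\boldsymbol\psi\}=0 .$$ The canonical pencil of the bracket is the odd linear operator $\Delta$ on $\mathfrak V(M)$, of weight $0$, such that $$\{\boldsymbol\psi;\boldsymbol\chi\}=\Delta(\boldsymbol\psi\boldsymbol\chi)-(\Delta\boldsymbol\psi)\boldsymbol\chi-(-1)^{\tilde\psi}\boldsymbol\psi\,\Delta\boldsymbol\chi,\qquad \Delta^*=\Delta,\qquad \Delta(1)=0 ;$$ here the formal adjoint of an operator $D$ of parity $\varepsilon$ is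 defined by $\langle D\boldsymbol\psi,\boldsymbol\chi\rangle=(-1)^{\varepsilon\tilde\psi}\langle\boldsymbol\psi,D^*\boldsymbol\chi\rangle$, where $\langle\boldsymbol\psi,\boldsymbol\chi\rangle$ is the Berezin integral over $M$ of the component of weight $1$ of $\boldsymbol\psi\boldsymbol\chi$ and $\boldsymbol\chi$ is compactly supported in a coordinate chart. Write $\Delta_w$ for the restriction of $\Delta$ to the densities of weight $w$. **Theorem.** Let $\Delta$ be the canonical pencil of an odd long bracket on $M$ that satisfies the Jacobi identity. Then there is an even vector field $X$ on $M$, which is Poisson, i.e. $X\{f,g\}=\{Xf,g\}+\{f,Xg\}$ for the bracket of functions $f,g$ (densities of weight $0$), such that for every $w\in\mathbb R$ $$\Delta_w^2=\mathcal L_X,\qquad \mathcal L_X\bigl(\psi(Dx)^w\bigr)=\Bigl(X^a\partial_a\psi+w\sum_a(-1)^{\tilde a}\,\partial_aX^a\;\psi\Bigr)(Dx)^w,$$ the Lie derivative on $w$-densities along $X$. In particular $\Delta^2$ is a derivation of $\mathfrak V(M)$, and it is divergence-free: $(\Delta^2)^*=-\Delta^2$. -/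

import Mathlib

open CategoryTheory TopologicalSpace Opposite Set
open scoped ContDiff

universe u

noncomputable section

namespace SuperGeom

/-! ### Grassmann algebras -/

/-- The Grassmann algebra with `q` generators. -/
abbrev Gr (q : ℕ) : Type := ExteriorAlgebra ℝ (Fin q → ℝ)

/-- The generator `ξ^m`. -/
def xi {q : ℕ} (m : Fin q) : Gr q := ExteriorAlgebra.ι ℝ (Pi.single m (1 : ℝ))

/-- The monomial basis `ξ^I`, for `I` a subset of `{1, …, q}`. -/
def grBasis (q : ℕ) : Module.Basis (Finset (Fin q)) ℝ (Gr q) :=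
  (Pi.basisFun ℝ (Fin q)).ExteriorAlgebra

/-- The elements of parity `ε` of the Grassmann algebra. -/
abbrev grPart (q : ℕ) (ε : ZMod 2) : Submodule ℝ (Gr q) :=
  CliffordAlgebra.evenOdd (0 : QuadraticForm ℝ (Fin q → ℝ)) ε

/-- The even part of the Grassmann algebra. -/
abbrev GrEven (q : ℕ) : Subalgebra ℝ (Gr q) :=
  CliffordAlgebra.even (0 : QuadraticForm ℝ (Fin q → ℝ))

/-- The body (the coefficient of `1`). -/
abbrev body {q : ℕ} : Gr q →ₐ[ℝ] ℝ := ExteriorAlgebra.algebraMapInv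

theorem iota_mul_iota_commute {q : ℕ} (m₁ m₂ : Fin q → ℝ) (x : Gr q) :
    Commute (ExteriorAlgebra.ι ℝ m₁ * ExteriorAlgebra.ι ℝ m₂) x := by
  have anti : ∀ a b : Fin q → ℝ, ExteriorAlgebra.ι ℝ a * ExteriorAlgebra.ι ℝ b
      = - (ExteriorAlgebra.ι ℝ b * ExteriorAlgebra.ι ℝ a) := fun a b =>
    eq_neg_of_add_eq_zero_left (ExteriorAlgebra.ι_add_mul_swap a b)
  induction x using ExteriorAlgebra.induction with
  | algebraMap r => exact (Algebra.commutes r _).symm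
  | ι v =>
    change _ * _ = _ * _
    rw [mul_assoc, anti m₂ v, mul_neg, ← mul_assoc, anti m₁ v, neg_mul, neg_neg, mul_assoc]
  | mul a b ha hb => exact ha.mul_right hb
  | add a b ha hb => exact ha.add_right hb

theorem even_commute {q : ℕ} {a : Gr q} (ha : a ∈ grPart q 0) (x : Gr q) : Commute a x := by
  induction a, ha using CliffordAlgebra.even_induction with
  | algebraMap r => exact Algebra.commutes r x
  | add a b _ _ iha ihb => exact iha.add_left ihb
  | ι_mul_ι_mul m₁ m₂ a _ ih => exact (iota_mul_iota_commute m₁ m₂ x).mul_left ih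

instance instCommRingGrEven (q : ℕ) : CommRing (GrEven q) :=
  { (inferInstance : Ring (GrEven q)) with
    mul_comm := fun a b => Subtype.ext (even_commute a.2 b.1) }

/-- The projection of the Grassmann algebra onto its even part. -/
def evenPart {q : ℕ} (x : Gr q) : GrEven q :=
  ⟨(DirectSum.decompose (grPart q) x 0 : grPart q 0), (DirectSum.decompose (grPart q) x 0).2⟩

/-- `(-1)^ε`. -/
def sgn (ε : ZMod 2) : ℝ := if ε = 0 then 1 else -1

/-- The real power `a ^ w` of an even element with positive body `b`: with `a = b (1 + n)`,
`n` nilpotent, it is `b ^ w` times the (terminating) binomial series of `(1 + n) ^ w`. -/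
def grPow {q : ℕ} (a : Gr q) (w : ℝ) : Gr q :=
  (body a ^ w) • ∑ᶠ k : ℕ, Ring.choose w k • ((body a)⁻¹ • a - 1) ^ k

theorem isNilpotent_sub_body {q : ℕ} (x : Gr q) (hx : x ∈ grPart q 0) :
    IsNilpotent (x - algebraMap ℝ (Gr q) (body x)) := by
  induction x, hx using CliffordAlgebra.even_induction with
  | algebraMap r =>
    have : body (algebraMap ℝ (Gr q) r) = r := by rw [AlgHom.commutes]; rfl
    change IsNilpotent (algebraMap ℝ (Gr q) r - algebraMap ℝ (Gr q) (body (algebraMap ℝ (Gr q) r)))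
    rw [this, sub_self]
    exact IsNilpotent.zero
  | add a b ha hb iha ihb =>
    have hc : Commute (a - algebraMap ℝ (Gr q) (body a)) (b - algebraMap ℝ (Gr q) (body b)) :=
      (even_commute ha _).sub_left (Algebra.commutes _ _)
    have := hc.isNilpotent_add iha ihb
    rwa [← add_sub_add_comm, ← map_add, ← map_add] at this
  | ι_mul_ι_mul m₁ m₂ a ha ih =>
    change IsNilpotent ((ExteriorAlgebra.ι ℝ m₁ * ExteriorAlgebra.ι ℝ m₂ * a : Gr q) -
      algebraMap ℝ (Gr q) (body (ExteriorAlgebra.ι ℝ m₁ * ExteriorAlgebra.ι ℝ m₂ * a : Gr q)))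
    have h0 : body (ExteriorAlgebra.ι ℝ m₁ * ExteriorAlgebra.ι ℝ m₂ * a : Gr q) = 0 := by
      rw [map_mul, map_mul]
      simp [body, ExteriorAlgebra.algebraMapInv]
    rw [h0, map_zero, sub_zero]
    refine (iota_mul_iota_commute m₁ m₂ a).isNilpotent_mul_right ⟨2, ?_⟩
    rw [pow_two, mul_assoc, ← (iota_mul_iota_commute m₁ m₂ (ExteriorAlgebra.ι ℝ m₂)).eq,
      mul_assoc, ExteriorAlgebra.ι_sq_zero, mul_zero, mul_zero]

theorem isNilpotent_normalized {q : ℕ} {a : Gr q} (ha : a ∈ grPart q 0) (hb : body a ≠ 0) :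
    IsNilpotent ((body a)⁻¹ • a - 1) := by
  have h := (isNilpotent_sub_body a ha).smul ((body a)⁻¹)
  rwa [smul_sub, Algebra.algebraMap_eq_smul_one, smul_smul, inv_mul_cancel₀ hb, one_smul] at h

theorem finsum_choose_eq {q : ℕ} {n : Gr q} {N : ℕ} (hn : n ^ N = 0) (w : ℝ) :
    ∑ᶠ k : ℕ, Ring.choose w k • n ^ k = ∑ k ∈ Finset.range N, Ring.choose w k • n ^ k := by
  refine finsum_eq_sum_of_support_subset _ fun k hk => ?_
  by_contra h
  refine hk ?_
  have hNk : N ≤ k := by simpa using h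
  change Ring.choose w k • n ^ k = 0
  rw [pow_eq_zero_of_le hNk hn, smul_zero]

theorem finsum_choose_add {q : ℕ} {n : Gr q} (hn : IsNilpotent n) (u v : ℝ) :
    ∑ᶠ k : ℕ, Ring.choose (u + v) k • n ^ k =
      (∑ᶠ k : ℕ, Ring.choose u k • n ^ k) * ∑ᶠ k : ℕ, Ring.choose v k • n ^ k := by
  obtain ⟨N, hN⟩ := hn
  simp only [finsum_choose_eq hN]
  let P : ℝ → Polynomial ℝ := fun w =>
    ∑ k ∈ Finset.range N, Polynomial.monomial k (Ring.choose w k)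
  have hP : ∀ w, Polynomial.aeval n (P w) = ∑ k ∈ Finset.range N, Ring.choose w k • n ^ k := by
    intro w
    simp only [P, map_sum, Polynomial.aeval_monomial, Algebra.smul_def]
  have hc : ∀ w d, d < N → (P w).coeff d = Ring.choose w d := by
    intro w d hd
    simp [P, Polynomial.coeff_monomial, hd]
  have hdvd : (Polynomial.X : Polynomial ℝ) ^ N ∣ P (u + v) - P u * P v := by
    rw [Polynomial.X_pow_dvd_iff]
    intro d hd
    rw [Polynomial.coeff_sub, Polynomial.coeff_mul, hc _ _ hd, Ring.add_choose_eq d (Commute.all u v),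
      sub_eq_zero]
    refine Finset.sum_congr rfl fun ij hij => ?_
    have := Finset.HasAntidiagonal.mem_antidiagonal.mp hij
    rw [hc _ _ (by omega), hc _ _ (by omega)]
  obtain ⟨R, hR⟩ := hdvd
  have := congrArg (Polynomial.aeval n) hR
  rw [map_sub, map_mul, map_mul, map_pow, Polynomial.aeval_X, hN, zero_mul, sub_eq_zero] at this
  rw [← hP, ← hP, ← hP, this]

theorem grPow_add {q : ℕ} {a : Gr q} (ha : a ∈ grPart q 0) (hb : 0 < body a) (u v : ℝ) :
    grPow a (u + v) = grPow a u * grPow a v := by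
  rw [grPow, finsum_choose_add (isNilpotent_normalized ha hb.ne'), Real.rpow_add hb, grPow, grPow,
    smul_mul_smul_comm]

theorem grPow_zero {q : ℕ} (a : Gr q) :
    grPow a 0 = 1 := by
  rw [grPow, finsum_eq_single _ 0]
  · simp
  · intro k hk
    rw [Ring.choose_zero_pos _ (Nat.pos_of_ne_zero hk), zero_smul]

theorem grPow_commute {q : ℕ} {a : Gr q} (ha : a ∈ grPart q 0) (hb : 0 < body a) (w : ℝ)
    (x : Gr q) : Commute (grPow a w) x := by
  obtain ⟨N, hN⟩ := isNilpotent_normalized ha hb.ne'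
  rw [grPow, finsum_choose_eq hN]
  refine Commute.smul_left (Finset.sum_induction _ (fun y => Commute y x)
    (fun _ _ h h' => h.add_left h') (Commute.zero_left x) fun k _ => Commute.smul_left
      (Commute.pow_left ?_ k) _) _
  exact ((even_commute ha x).smul_left _).sub_left (Commute.one_left x)

/-! ### Superfunctions on open subsets of `ℝ^p` -/

/-- Extension by zero of a function given on an open set. -/
def zeroExt {p q : ℕ} {V : Opens (Fin p → ℝ)} (f : V → Gr q) (y : Fin p → ℝ) : Gr q :=
  open Classical in if h : y ∈ V then f ⟨y, h⟩ else 0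

/-- The coefficient `f_I` of `f = ∑ f_I ξ^I` at `y`. -/
def coeffAt {p q : ℕ} {V : Opens (Fin p → ℝ)} (f : V → Gr q) (I : Finset (Fin q))
    (y : Fin p → ℝ) : ℝ :=
  (grBasis q).repr (zeroExt f y) I

/-- The algebra `C^∞(V) ⊗ Λ(ξ^1, …, ξ^q)`, as a subalgebra: the functions `f = ∑ f_I ξ^I` on `V` with values in
the Grassmann algebra whose coefficients `f_I` are smooth. -/
def superFunSubalgebra {p : ℕ} (q : ℕ) (V : Opens (Fin p → ℝ)) : Subalgebra ℝ (V → Gr q) where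
  carrier := {f | ∀ I, ContDiffOn ℝ ∞ (coeffAt f I) V}
  mul_mem' := by
    intro f g hf hg I
    have h : ∀ y ∈ (V : Set (Fin p → ℝ)), coeffAt (f * g) I y =
        ∑ J, ∑ K, coeffAt f J y * coeffAt g K y * (grBasis q).repr (grBasis q J * grBasis q K) I := by
      intro y hy
      have hy' : y ∈ V := hy
      simp only [coeffAt, zeroExt, dif_pos hy', Pi.mul_apply]
      conv_lhs => rw [← (grBasis q).sum_repr (f ⟨y, hy'⟩), ← (grBasis q).sum_repr (g ⟨y, hy'⟩)]
      simp only [Finset.sum_mul_sum, map_sum, smul_mul_smul_comm, map_smul, Finsupp.coe_finsetSum,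
        Finset.sum_apply, Finsupp.smul_apply, smul_eq_mul]
    refine ContDiffOn.congr ?_ h
    refine ContDiffOn.sum fun J _ => ContDiffOn.sum fun K _ => ?_
    exact ((hf J).mul (hg K)).mul contDiffOn_const
  add_mem' := by
    intro f g hf hg I
    refine ((hf I).add (hg I)).congr fun y hy => ?_
    have hy' : y ∈ V := hy
    simp [coeffAt, zeroExt, dif_pos hy']
  algebraMap_mem' := by
    intro r I
    refine (contDiffOn_const (c := (grBasis q).repr (algebraMap ℝ (Gr q) r) I)).congr fun y hy => ?_
    have hy' : y ∈ V := hy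
    simp only [coeffAt, zeroExt, dif_pos hy']
    rfl

/-- The algebra `C^∞(V) ⊗ Λ(ξ^1, …, ξ^q)` of superfunctions on `V`. -/
def SuperFun {p : ℕ} (q : ℕ) (V : Opens (Fin p → ℝ)) : Type := superFunSubalgebra q V

instance {p q : ℕ} (V : Opens (Fin p → ℝ)) : Ring (SuperFun q V) :=
  inferInstanceAs (Ring (superFunSubalgebra q V))

instance {p q : ℕ} (V : Opens (Fin p → ℝ)) : Algebra ℝ (SuperFun q V) :=
  inferInstanceAs (Algebra ℝ (superFunSubalgebra q V))

namespace SuperFun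

variable {p q : ℕ} {V : Opens (Fin p → ℝ)}

/-- The underlying function `V → Λ(ξ^1, …, ξ^q)` of a superfunction. -/
def fn (f : SuperFun q V) : V → Gr q := Subtype.val (p := (· ∈ superFunSubalgebra q V)) f

/-- The superfunction with a given underlying function. -/
def mk (f : V → Gr q) (hf : ∀ I, ContDiffOn ℝ ∞ (coeffAt f I) V) : SuperFun q V :=
  (⟨f, hf⟩ : superFunSubalgebra q V)

theorem contDiffOn (f : SuperFun q V) (I : Finset (Fin q)) : ContDiffOn ℝ ∞ (coeffAt f.fn I) V :=
  f.2 I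

@[ext] theorem ext {f g : SuperFun q V} (h : ∀ y, f.fn y = g.fn y) : f = g :=
  Subtype.ext (funext h)

@[simp] theorem fn_mk (f : V → Gr q) (hf) : (mk f hf).fn = f := rfl
@[simp] theorem fn_zero : (0 : SuperFun q V).fn = 0 := rfl
@[simp] theorem fn_one : (1 : SuperFun q V).fn = 1 := rfl
@[simp] theorem fn_add (f g : SuperFun q V) : (f + g).fn = f.fn + g.fn := rfl
@[simp] theorem fn_sub (f g : SuperFun q V) : (f - g).fn = f.fn - g.fn := rfl
@[simp] theorem fn_neg (f : SuperFun q V) : (-f).fn = -f.fn := rfl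
@[simp] theorem fn_mul (f g : SuperFun q V) : (f * g).fn = f.fn * g.fn := rfl
@[simp] theorem fn_smul (r : ℝ) (f : SuperFun q V) : (r • f).fn = r • f.fn := rfl

end SuperFun

/-- Restriction of superfunctions to a smaller open set. -/
def SuperFun.res {p q : ℕ} {V V' : Opens (Fin p → ℝ)} (h : V' ≤ V) :
    SuperFun q V →ₐ[ℝ] SuperFun q V' where
  toFun f := .mk (fun y => f.fn ⟨y.1, h y.2⟩) fun I => ((f.contDiffOn I).mono h).congr fun y hy => by
    have hy' : y ∈ V' := hy
    simp [coeffAt, zeroExt, dif_pos hy', dif_pos (h hy')]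
  map_one' := rfl
  map_mul' _ _ := rfl
  map_zero' := rfl
  map_add' _ _ := rfl
  commutes' _ := rfl

/-- The index set of the coordinates `x^1, …, x^p, ξ^1, …, ξ^q`. -/
abbrev CoordIdx (p q : ℕ) : Type := Fin p ⊕ Fin q

/-- The parity `ã` of the coordinate with index `a`. -/
def par {p q : ℕ} : CoordIdx p q → ZMod 2 := Sum.elim (fun _ => 0) (fun _ => 1)

/-- The coordinate functions. -/
def coordFun {p q : ℕ} (V : Opens (Fin p → ℝ)) : CoordIdx p q → SuperFun q V
  | Sum.inl k => .mk (fun y => algebraMap ℝ (Gr q) (y.1 k)) fun I => by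
      refine ((contDiff_apply ℝ ℝ k).mul contDiff_const).contDiffOn.congr
        (f := fun y => y k * (grBasis q).repr 1 I) fun y hy => ?_
      have hy' : y ∈ V := hy
      simp [coeffAt, zeroExt, dif_pos hy', Algebra.algebraMap_eq_smul_one]
  | Sum.inr m => .mk (fun _ => xi m) fun I => by
      refine (contDiffOn_const (c := (grBasis q).repr (xi m) I)).congr fun y hy => ?_
      have hy' : y ∈ V := hy
      simp [coeffAt, zeroExt, dif_pos hy']

/-- The (left) partial derivatives `∂_a`: with respect to an even coordinate the coefficients are
differentiated, with respect to an odd one `∂_m` is the contraction with the `m`-th dual basis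
vector, i.e. the odd derivation with `∂_m ξ^n = δ_m^n`. -/
def pd {p q : ℕ} {V : Opens (Fin p → ℝ)} (a : CoordIdx p q) (f : V → Gr q) : V → Gr q :=
  match a with
  | Sum.inl k => fun y => ∑ I, fderiv ℝ (coeffAt f I) y.1 (Pi.single k 1) • grBasis q I
  | Sum.inr m => fun y => CliffordAlgebra.contractLeft (LinearMap.proj m) (f y)

/-- A superfunction is of parity `ε`. -/
def HasParity {p q : ℕ} {V : Opens (Fin p → ℝ)} (ε : ZMod 2) (f : V → Gr q) : Prop :=
  ∀ y, f y ∈ grPart q ε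

/-- The Berezin integral over `V`: the integral of the coefficient of `ξ^1 ⋯ ξ^q`. -/
def berezinIntegral {p q : ℕ} {V : Opens (Fin p → ℝ)} (f : V → Gr q) : ℝ :=
  ∫ y in (V : Set (Fin p → ℝ)), coeffAt f Finset.univ y

/-- The Berezinian `det (A - B D⁻¹ C) / det D` of an even supermatrix with blocks `A, B, C, D`. -/
def berezinian {p q : ℕ} (J : Matrix (CoordIdx p q) (CoordIdx p q) (Gr q)) : GrEven q :=
  let D : Matrix (Fin q) (Fin q) (GrEven q) := J.toBlocks₂₂.map evenPart
  let K : Matrix (Fin p) (Fin p) (Gr q) :=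
    J.toBlocks₁₁ - J.toBlocks₁₂ * D⁻¹.map Subtype.val * J.toBlocks₂₁
  (K.map evenPart).det * Ring.inverse D.det

/-! ### Supermanifolds -/

/-- The image of an open set in a chart. -/
def chartDom {X : Type u} [TopologicalSpace X] {p : ℕ} (e : OpenPartialHomeomorph X (Fin p → ℝ))
    (W : Opens X) : Opens (Fin p → ℝ) :=
  ⟨e.target ∩ e.symm ⁻¹' W, e.isOpen_inter_preimage_symm W.2⟩

theorem chartDom_mono {X : Type u} [TopologicalSpace X] {p : ℕ}
    (e : OpenPartialHomeomorph X (Fin p → ℝ)) {W W' : Opens X} (h : W' ≤ W) :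
    chartDom e W' ≤ chartDom e W :=
  fun _ hy => ⟨hy.1, h hy.2⟩

/-- A smooth supermanifold of dimension `p|q`: a Hausdorff second countable space with a sheaf of
`ℝ`-algebras and an atlas of charts, in each of which the sheaf is identified with the sheaf
`C^∞ ⊗ Λ(ξ^1, …, ξ^q)` on an open subset of `ℝ^p`. The charts induce the same
`ℤ/2`-grading of the structure sheaf. -/
structure Supermanifold (p q : ℕ) where
  space : TopCat.{u}
  t2 : T2Space space
  secondCountable : SecondCountableTopology space
  structureSheaf : TopCat.Sheaf (AlgCat.{u} ℝ) space
  Chart : Type u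
  chart : Chart → OpenPartialHomeomorph space (Fin p → ℝ)
  exists_chart : ∀ x : space, ∃ i, x ∈ (chart i).source
  coord : ∀ (i : Chart) (W : Opens space), (W : Set space) ⊆ (chart i).source →
    (structureSheaf.presheaf.obj (op W) ≃ₐ[ℝ] SuperFun q (chartDom (chart i) W))
  coord_res : ∀ (i : Chart) (W W' : Opens space) (hW : (W : Set space) ⊆ (chart i).source)
    (h : W' ≤ W) (s : structureSheaf.presheaf.obj (op W)),
    coord i W' (fun _ hx => hW (h hx)) (structureSheaf.presheaf.map (homOfLE h).op s) =
      SuperFun.res (chartDom_mono (chart i) h) (coord i W hW s)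
  coord_parity : ∀ (i j : Chart) (W : Opens space) (hi : (W : Set space) ⊆ (chart i).source)
    (hj : (W : Set space) ⊆ (chart j).source) (ε : ZMod 2)
    (s : structureSheaf.presheaf.obj (op W)),
    HasParity ε (coord i W hi s).fn → HasParity ε (coord j W hj s).fn

namespace Supermanifold

variable {p q : ℕ} (M : Supermanifold.{u} p q)

/-- The domain of a chart, as an open subset of the underlying space. -/
def src (i : M.Chart) : Opens M.space := ⟨(M.chart i).source, (M.chart i).open_source⟩

/-- The image of a chart, an open subset of `ℝ^p`. -/
def dom (i : M.Chart) : Opens (Fin p → ℝ) := chartDom (M.chart i) (M.src i)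

/-- The image in the chart `i` of the overlap of the charts `i` and `j`. -/
def overlap (i j : M.Chart) : Opens (Fin p → ℝ) := chartDom (M.chart i) (M.src i ⊓ M.src j)

theorem overlap_le (i j : M.Chart) : M.overlap i j ≤ M.dom i :=
  chartDom_mono _ inf_le_left

/-- The transition isomorphism: it rewrites a superfunction on the overlap of the charts `i` and `j`
from the coordinates `j` into the coordinates `i`. -/
def trans (i j : M.Chart) :
    SuperFun q (chartDom (M.chart j) (M.src i ⊓ M.src j)) →ₐ[ℝ] SuperFun q (M.overlap i j) :=
  ((M.coord j (M.src i ⊓ M.src j) (fun _ hx => hx.2)).symm.trans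
    (M.coord i (M.src i ⊓ M.src j) (fun _ hx => hx.1))).toAlgHom

/-- A superfunction in the chart `j`, restricted to the overlap with the chart `i` and rewritten
in the coordinates `i`. -/
def transfer (i j : M.Chart) : SuperFun q (M.dom j) →ₐ[ℝ] SuperFun q (M.overlap i j) :=
  (M.trans i j).comp (SuperFun.res (chartDom_mono (M.chart j) inf_le_right))

/-- The Jacobi matrix `∂x_j^b / ∂x_i^a` (row `a`, column `b`) of a change of coordinates. -/
def jacobian (i j : M.Chart) (y : M.overlap i j) :
    Matrix (CoordIdx p q) (CoordIdx p q) (Gr q) :=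
  Matrix.of fun a b => pd a (M.transfer i j (coordFun (M.dom j) b)).fn y

/-- The Jacobian `J = Dx_j / Dx_i` of a change of coordinates. -/
def ber (i j : M.Chart) (y : M.overlap i j) : GrEven q := berezinian (M.jacobian i j y)

end Supermanifold

/-- A supermanifold with an atlas for which all Berezinians of the changes of coordinates are
positive, so that their real powers are defined. -/
structure PosSupermanifold (p q : ℕ) extends Supermanifold.{u} p q where
  ber_pos : ∀ i j y, 0 < body (toSupermanifold.ber i j y : Gr q)

/-! ### The algebra of densities -/

section twist

variable {R : Type*} [Ring R] {q : ℕ}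

/-- The substitution `t ↦ t J` in generating functions `∑ f_w t^w`, for a multiplicative central
family `P w = J^w`. -/
def twist (E : R →+* Gr q) (P : Multiplicative ℝ →* Gr q) (hP : ∀ w x, Commute (P w) x) :
    AddMonoidAlgebra R ℝ →+* AddMonoidAlgebra (Gr q) ℝ :=
  AddMonoidAlgebra.liftNCRingHom
    ((AddMonoidAlgebra.singleZeroRingHom : Gr q →+* AddMonoidAlgebra (Gr q) ℝ).comp E)
    { toFun := fun w => AddMonoidAlgebra.single w.toAdd (P w)
      map_one' := by simp [AddMonoidAlgebra.one_def]
      map_mul' := fun a b => by simp [AddMonoidAlgebra.single_mul_single] }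
    (fun x w => by
      simp [Commute, SemiconjBy, AddMonoidAlgebra.single_mul_single, (hP w (E x)).eq])

theorem coeff_twist (E : R →+* Gr q) (P : Multiplicative ℝ →* Gr q) (hP : ∀ w x, Commute (P w) x)
    (f : AddMonoidAlgebra R ℝ) (w : ℝ) :
    (twist E P hP f).coeff w = E (f.coeff w) * P (Multiplicative.ofAdd w) := by
  classical
  induction f using AddMonoidAlgebra.induction_linear with
  | zero => simp
  | add f g hf hg => simp [hf, hg, add_mul]
  | single a b =>
    have h1 : twist E P hP (AddMonoidAlgebra.single a b) =
        AddMonoidAlgebra.single 0 (E b) * AddMonoidAlgebra.single a (P (Multiplicative.ofAdd a)) :=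
      AddMonoidAlgebra.liftNC_single _ _ _ _
    rw [h1, AddMonoidAlgebra.single_mul_single, zero_add, AddMonoidAlgebra.coeff_single,
      AddMonoidAlgebra.coeff_single, Finsupp.single_apply, Finsupp.single_apply]
    split_ifs with h
    · rw [h]
    · rw [map_zero, zero_mul]

end twist

namespace PosSupermanifold

variable {p q : ℕ} (M : PosSupermanifold.{u} p q)

/-- `w ↦ J^w`. -/
def berPow (i j : M.Chart) (y : M.overlap i j) : Multiplicative ℝ →* Gr q where
  toFun w := grPow (M.ber i j y : Gr q) w.toAdd
  map_one' := grPow_zero _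
  map_mul' u v := grPow_add (M.ber i j y).2 (M.ber_pos i j y) u.toAdd v.toAdd

theorem berPow_commute (i j : M.Chart) (y : M.overlap i j) (w : Multiplicative ℝ) (x : Gr q) :
    Commute (M.berPow i j y w) x :=
  grPow_commute (M.ber i j y).2 (M.ber_pos i j y) _ x

/-- Evaluation of a superfunction. -/
def evalAt {V : Opens (Fin p → ℝ)} (y : V) : SuperFun q V →+* Gr q where
  toFun f := f.fn y
  map_one' := rfl
  map_mul' _ _ := rfl
  map_zero' := rfl
  map_add' _ _ := rfl

/-- The compatibility of the generating functions `∑ ψ_{i,w} t_i^w` and `∑ ψ_{j,w} t_j^w` in two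
charts: `ψ_{i,w} = ψ_{j,w} J^w` on the overlap, where `J = Dx_j / Dx_i`. -/
def Compatible (i j : M.Chart) (f : AddMonoidAlgebra (SuperFun q (M.dom i)) ℝ)
    (g : AddMonoidAlgebra (SuperFun q (M.dom j)) ℝ) : Prop :=
  ∀ (w : ℝ) (y : M.overlap i j), (f.coeff w).fn ⟨y.1, M.overlap_le i j y.2⟩ =
    (M.transfer i j (g.coeff w)).fn y * grPow (M.ber i j y : Gr q) w

theorem compatible_iff (i j : M.Chart) (f : AddMonoidAlgebra (SuperFun q (M.dom i)) ℝ)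
    (g : AddMonoidAlgebra (SuperFun q (M.dom j)) ℝ) :
    M.Compatible i j f g ↔ ∀ y : M.overlap i j,
      twist (evalAt ⟨y.1, M.overlap_le i j y.2⟩) 1 (fun _ x => Commute.one_left x) f =
        twist ((evalAt y).comp (M.transfer i j : _ →+* _)) (M.berPow i j y)
          (M.berPow_commute i j y) g := by
  rw [Compatible, forall_comm]
  refine forall_congr' fun y => ?_
  rw [← AddMonoidAlgebra.coeff_inj, DFunLike.ext_iff]
  refine forall_congr' fun w => ?_
  rw [coeff_twist, coeff_twist]
  simp only [MonoidHom.one_apply, mul_one]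
  rfl

/-- The algebra of densities `𝔙(M)`: a density is a finite formal sum `∑ ψ_w (Dx)^w`, i.e. a
generating function `∑ ψ_w(x) t^w` in each chart (a finitely supported family of superfunctions,
indexed by the weights `w ∈ ℝ`), transforming by `t_j = t_i J`, `J = Dx_j / Dx_i`. -/
def Dens : Subalgebra ℝ (∀ i : M.Chart, AddMonoidAlgebra (SuperFun q (M.dom i)) ℝ) where
  carrier := {ψ | ∀ i j, M.Compatible i j (ψ i) (ψ j)}
  mul_mem' := by
    intro ψ χ hψ hχ i j
    rw [compatible_iff]
    intro y
    rw [Pi.mul_apply, Pi.mul_apply, map_mul, map_mul, (M.compatible_iff i j _ _).1 (hψ i j) y,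
      (M.compatible_iff i j _ _).1 (hχ i j) y]
  add_mem' := by
    intro ψ χ hψ hχ i j
    rw [compatible_iff]
    intro y
    rw [Pi.add_apply, Pi.add_apply, map_add, map_add, (M.compatible_iff i j _ _).1 (hψ i j) y,
      (M.compatible_iff i j _ _).1 (hχ i j) y]
  algebraMap_mem' := by
    intro r i j w y
    have hone := grPow_zero (M.ber i j y : Gr q)
    change ((AddMonoidAlgebra.single 0 (algebraMap ℝ (SuperFun q (M.dom i)) r)).coeff w).fn _ =
      (M.transfer i j ((AddMonoidAlgebra.single 0
        (algebraMap ℝ (SuperFun q (M.dom j)) r)).coeff w)).fn y * _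
    rw [AddMonoidAlgebra.coeff_single, AddMonoidAlgebra.coeff_single, Finsupp.single_apply,
      Finsupp.single_apply]
    by_cases hw : w = 0
    · subst hw
      rw [if_pos rfl, if_pos rfl, AlgHom.commutes, hone, mul_one]
      rfl
    · rw [if_neg (Ne.symm hw), if_neg (Ne.symm hw), map_zero]
      exact (zero_mul _).symm

variable {M}

/-- The coefficient `ψ_w` of a density in the chart `i`. -/
def comp (ψ : M.Dens) (i : M.Chart) (w : ℝ) : SuperFun q (M.dom i) := (ψ.1 i).coeff w

variable (M) in
/-- The densities of weight `w`. -/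
def densW (w : ℝ) : Submodule ℝ M.Dens where
  carrier := {ψ | ∀ i u, u ≠ w → comp ψ i u = 0}
  add_mem' := by
    intro ψ χ hψ hχ i u hu
    have h : comp (ψ + χ) i u = comp ψ i u + comp χ i u := rfl
    rw [h, hψ i u hu, hχ i u hu, add_zero]
  zero_mem' := fun _ _ _ => rfl
  smul_mem' := by
    intro r ψ hψ i u hu
    have h : comp (r • ψ) i u = r • comp ψ i u := rfl
    rw [h, hψ i u hu, smul_zero]

variable (M) in
/-- The densities of parity `ε`. -/
def densP (ε : ZMod 2) : Submodule ℝ M.Dens where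
  carrier := {ψ | ∀ i w, HasParity ε (comp ψ i w).fn}
  add_mem' := fun hψ hχ i w y => add_mem (hψ i w y) (hχ i w y)
  zero_mem' := fun _ _ _ => zero_mem _
  smul_mem' := fun r _ hψ i w y => Submodule.smul_mem _ r (hψ i w y)

variable (M) in
/-- The algebra `C^∞(M)` of functions, i.e. of densities of weight zero. -/
def Fun : Subalgebra ℝ M.Dens where
  carrier := M.densW 0
  mul_mem' := by
    intro ψ χ hψ hχ i w hw
    have h : ∀ φ ∈ M.densW 0, φ.1 i = AddMonoidAlgebra.single 0 (comp φ i 0) := by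
      intro φ hφ
      ext1
      ext1 u
      by_cases hu : u = 0
      · subst hu; simp [comp]
      · rw [AddMonoidAlgebra.coeff_single, Finsupp.single_apply, if_neg (Ne.symm hu)]
        exact hφ i u hu
    change ((ψ.1 i) * (χ.1 i)).coeff w = 0
    rw [h ψ hψ, h χ hχ, AddMonoidAlgebra.single_mul_single, AddMonoidAlgebra.coeff_single,
      Finsupp.single_apply, if_neg (by simpa using hw.symm)]
  add_mem' := fun h h' => (M.densW 0).add_mem h h'
  algebraMap_mem' := by
    intro r i u hu
    change (AddMonoidAlgebra.single 0 (algebraMap ℝ (SuperFun q (M.dom i)) r)).coeff u = 0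
    rw [AddMonoidAlgebra.coeff_single, Finsupp.single_apply, if_neg (Ne.symm hu)]

/-! ### Long brackets -/

variable (M) in
/-- An odd long bracket of weight zero on `M`: an odd symmetric bi-derivation of the algebra of
densities, of weight zero, given in the coordinates `(x^a, t)` by an odd master Hamiltonian
`½ (S^{ab} p_b p_a + 2 t γ^a p_a p_t + t² θ p_t²)`. -/
structure OddLongBracket where
  bracket : M.Dens →ₗ[ℝ] M.Dens →ₗ[ℝ] M.Dens
  parity : ∀ α β, ∀ ψ ∈ M.densP α, ∀ χ ∈ M.densP β, bracket ψ χ ∈ M.densP (α + β + 1)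
  weight : ∀ u v, ∀ ψ ∈ M.densW u, ∀ χ ∈ M.densW v, bracket ψ χ ∈ M.densW (u + v)
  symm : ∀ α β, ∀ ψ ∈ M.densP α, ∀ χ ∈ M.densP β, bracket ψ χ = sgn (α * β) • bracket χ ψ
  leibniz : ∀ α β, ∀ ψ ∈ M.densP α, ∀ χ ∈ M.densP β, ∀ φ,
    bracket ψ (χ * φ) = bracket ψ χ * φ + sgn ((α + 1) * β) • (χ * bracket ψ φ)
  master_hamiltonian : ∀ i : M.Chart, ∃ (S : CoordIdx p q → CoordIdx p q → SuperFun q (M.dom i))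
    (γ : CoordIdx p q → SuperFun q (M.dom i)) (θ : SuperFun q (M.dom i)),
    (∀ a b, HasParity (par a + par b + 1) (S a b).fn) ∧ (∀ a, HasParity (par a + 1) (γ a).fn) ∧
    HasParity 1 θ.fn ∧ (∀ a b, S a b = sgn (par a * par b) • S b a) ∧
    ∀ (α : ZMod 2) (u v : ℝ), ∀ ψ ∈ M.densP α ⊓ M.densW u, ∀ χ ∈ M.densW v,
      (comp (bracket ψ χ) i (u + v)).fn =
        ∑ a, ∑ b, sgn (par a * α) •
          ((S a b).fn * pd b (comp ψ i u).fn * pd a (comp χ i v).fn)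
        + ∑ a, (γ a).fn * (v • (pd a (comp ψ i u).fn * (comp χ i v).fn)
          + (sgn (par a * α) * u) • ((comp ψ i u).fn * pd a (comp χ i v).fn))
        + (u * v) • (θ.fn * (comp ψ i u).fn * (comp χ i v).fn)

/-- The Jacobi identity for an odd symmetric bracket. -/
def OddLongBracket.Jacobi (B : OddLongBracket M) : Prop :=
  ∀ α β δ, ∀ a ∈ M.densP α, ∀ b ∈ M.densP β, ∀ c ∈ M.densP δ,
    sgn (α * δ) • B.bracket (B.bracket a b) c + sgn (δ * β) • B.bracket (B.bracket c a) b
      + sgn (β * α) • B.bracket (B.bracket b c) a = 0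

/-- The bracket of functions on `M` contained in a long bracket. -/
def OddLongBracket.onFun (B : OddLongBracket M) (f g : Fun M) : Fun M :=
  ⟨B.bracket f.1 g.1, by simpa using! B.weight 0 0 f.1 f.2 g.1 g.2⟩

/-! ### The canonical pencil -/

/-- The density `χ` has compact support, contained in the domain of the chart `i`. -/
def CompactlySupportedIn (i : M.Chart) (χ : M.Dens) : Prop :=
  ∃ K : Set M.space, IsCompact K ∧ K ⊆ (M.chart i).source ∧
    ∀ j w (y : M.dom j), (M.chart j).symm y.1 ∉ K → (comp χ j w).fn y = 0

/-- The integral over the domain of the chart `i` of the component of weight `1` of a density. -/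
def integral (i : M.Chart) (ρ : M.Dens) : ℝ := berezinIntegral (comp ρ i 1).fn

/-- `D^* = σ D`, for an operator `D` of parity `ε` on the algebra of densities and a number
`σ = ± 1`. The (formal) adjoint is taken with respect to the scalar product
`⟨ψ, χ⟩ = ∫_M Res (t⁻² ψ χ) Dx`, i.e. the integral of the component of `ψ χ` of weight `1`, by
`⟨D ψ, χ⟩ = (-1)^{ε ψ̃} ⟨ψ, D^* χ⟩`; here `ψ` is arbitrary and `χ` has compact support in the domain
of some chart, where the integral is computed. -/
def AdjointEq (ε : ZMod 2) (σ : ℝ) (D : M.Dens →ₗ[ℝ] M.Dens) : Prop :=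
  ∀ i α, ∀ ψ ∈ M.densP α, ∀ χ, CompactlySupportedIn i χ →
    integral i (D ψ * χ) = σ * sgn (ε * α) * integral i (ψ * D χ)

/-- `Δ` is the canonical pencil of the odd long bracket `B`: the odd operator of weight zero on the
algebra of densities that generates `B` and satisfies `Δ^* = Δ` and `Δ(1) = 0`. (The operator `Δ_w`
of the pencil is the restriction of `Δ` to the densities of weight `w`.) -/
structure IsCanonicalPencil (B : OddLongBracket M) (Δ : M.Dens →ₗ[ℝ] M.Dens) : Prop where
  parity : ∀ α, ∀ ψ ∈ M.densP α, Δ ψ ∈ M.densP (α + 1)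
  weight : ∀ w, ∀ ψ ∈ M.densW w, Δ ψ ∈ M.densW w
  generates : ∀ α, ∀ ψ ∈ M.densP α, ∀ χ,
    B.bracket ψ χ = Δ (ψ * χ) - Δ ψ * χ - sgn α • (ψ * Δ χ)
  self_adjoint : AdjointEq 1 1 Δ
  map_one : Δ 1 = 0

/-! ### Vector fields and Lie derivatives -/

variable (M) in
/-- An (even) vector field on `M`: an even derivation of the algebra of functions. -/
structure EvenVectorField where
  toFun : Fun M →ₗ[ℝ] Fun M
  parity : ∀ α, ∀ f : Fun M, f.1 ∈ M.densP α → (toFun f).1 ∈ M.densP α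
  leibniz : ∀ f g, toFun (f * g) = toFun f * g + f * toFun g

/-- The vector field `X` preserves the bracket of functions. -/
def EvenVectorField.IsPoisson (X : EvenVectorField M) (B : OddLongBracket M) : Prop :=
  ∀ f g, X.toFun (B.onFun f g) = B.onFun (X.toFun f) g + B.onFun f (X.toFun g)

/-- `L` is the Lie derivative along the even vector field `X` on densities of all weights: if
`X = X^a ∂_a` in a chart, then
`L (ψ (Dx)^w) = (X^a ∂_a ψ + w (∑_a (-1)^ã ∂_a X^a) ψ) (Dx)^w`. -/
def EvenVectorField.IsLieDerivative (X : EvenVectorField M) (L : M.Dens →ₗ[ℝ] M.Dens) : Prop :=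
  ∀ i : M.Chart, ∃ c : CoordIdx p q → SuperFun q (M.dom i),
    (∀ a, HasParity (par a) (c a).fn) ∧
    (∀ f : Fun M, (comp (X.toFun f).1 i 0).fn = ∑ a, (c a).fn * pd a (comp f.1 i 0).fn) ∧
    ∀ (ψ : M.Dens) (w : ℝ), (comp (L ψ) i w).fn =
      ∑ a, (c a).fn * pd a (comp ψ i w).fn
        + w • ((∑ a, sgn (par a) • pd a (c a).fn) * (comp ψ i w).fn)

end PosSupermanifold

end SuperGeom

end

noncomputable section

namespace SuperGeom

/-! ### Grassmann algebras -/

section Grassmann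

variable {q : ℕ}

/-! Write D = Δ² and Φ(a,b) = D(ab) − (Da)b − a(Db). The heart of the proof is that Φ = 0. Since Δ
is odd and generates the bracket, Φ(a,b) = Δ{a,b} + {Δa,b} + (−1)^ã {a,Δb} (`leibnizDefect_sq`), and
the Jacobi identity makes Φ(a,·) a derivation (`leibnizDefect_mul`): D has order at most two, with
polarized symbol Φ. On the other hand, Δ* = Δ with Δ odd gives D* = −D (`adjointEq_sq`), and D1 = 0.
Hence ∫Dχ = 0 for compactly supported χ, and so ∫Φ(ψ,χ) = 0. Integrate Φ(a,bc) = Φ(a,b)c ± bΦ(a,c):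
after moving D off c, the last term has the same integral as Φ(a,b)c. Thus 2∫Φ(a,b)c = 0 for all
test densities c, and Φ = 0 because the pairing is nondegenerate (`leibnizDefect_eq_zero_of_mem`).
In short, skew-adjointness kills a symbol of even order. The derivation D commutes with Δ, hence is
also a derivation of the bracket (`sq_bracket`), and X is its restriction to functions.

It remains to identify D with a Lie derivative in a chart. Let D_w be the action on coefficients of
weight w. By Hadamard's lemma D_0 = X^a ∂_a (`derivation_eq_sum`), and the Leibniz rule gives D_w f
= D_0 f + D_w(1) f. The Leibniz rule also makes D_w(1) additive in w, but additivity alone does not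
give linearity over real weights. So μ_w = Δ_w(1) is computed: μ_{u+v} = μ_u + μ_v + uvθ together
with self-adjointness makes it quadratic in w (`exists_quadratic`). Then D_w(1) = Δ_w(μ_w) is cubic
in w, and an additive cubic polynomial is linear (`locOp_sq_one`). Finally ∫D_1 g = 0 and
integration by parts show that D_1(1) is the divergence of X (`locSq_one_one`).

The rest is the passage between global densities and chart coefficients. Superfunctions cut off by
bump functions are extended to densities by zero, which needs the cocycle property of the real
powers of the Berezinian (`exists_jacobian_pow`), hence its multiplicativity (`berezinian_mul`). The
charts are only isomorphisms of sheaves of algebras, so the action on bodies, the chain rule and the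
compatibility with real powers are derived algebraically: a homomorphism to a Grassmann algebra is
controlled by Hadamard's lemma, each use of which gains one degree in the filtration `grFil`, which
vanishes above degree q. Locality then turns Δ and D into operators on chart coefficients (`locOp`).
-/

theorem zmod2_cases (ε : ZMod 2) : ε = 0 ∨ ε = 1 := by
  revert ε; decide

@[simp] theorem sgn_zero : sgn 0 = 1 := if_pos rfl

@[simp] theorem sgn_one : sgn 1 = -1 := if_neg (by decide)

theorem zmod2_one_add_one : (1 : ZMod 2) + 1 = 0 := by decide

theorem sgn_add (α β : ZMod 2) : sgn (α + β) = sgn α * sgn β := by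
  rcases zmod2_cases α with rfl | rfl <;> rcases zmod2_cases β with rfl | rfl <;>
    simp [zmod2_one_add_one]

theorem sgn_mul_self (α : ZMod 2) : sgn α * sgn α = 1 := by
  rcases zmod2_cases α with rfl | rfl <;> simp

theorem iota_mem_grPart (v : Fin q → ℝ) : ExteriorAlgebra.ι ℝ v ∈ grPart q 1 :=
  CliffordAlgebra.ι_mem_evenOdd_one _ v

theorem mul_mem_grPart {α β : ZMod 2} {x y : Gr q} (hx : x ∈ grPart q α) (hy : y ∈ grPart q β) :
    x * y ∈ grPart q (α + β) :=
  SetLike.mul_mem_graded hx hy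

theorem algebraMap_mem_grPart (r : ℝ) : algebraMap ℝ (Gr q) r ∈ grPart q 0 :=
  (GrEven q).algebraMap_mem r

theorem one_mem_grPart : (1 : Gr q) ∈ grPart q 0 := (GrEven q).one_mem

theorem exists_grPart_add (x : Gr q) : ∃ a ∈ grPart q 0, ∃ b ∈ grPart q 1, x = a + b := by
  have h : x ∈ grPart q 0 ⊔ grPart q 1 := by
    rw [(CliffordAlgebra.evenOdd_isCompl (Q := (0 : QuadraticForm ℝ (Fin q → ℝ)))).sup_eq_top]
    exact Submodule.mem_top
  obtain ⟨a, ha, b, hb, h⟩ := Submodule.mem_sup.1 h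
  exact ⟨a, ha, b, hb, h.symm⟩

theorem eq_zero_of_mem_grPart {x : Gr q} (h0 : x ∈ grPart q 0) (h1 : x ∈ grPart q 1) : x = 0 :=
  Submodule.disjoint_def.1
    (CliffordAlgebra.evenOdd_isCompl (Q := (0 : QuadraticForm ℝ (Fin q → ℝ)))).disjoint x h0 h1

theorem eq_zero_of_mem_grPart' {α : ZMod 2} {x : Gr q} (h0 : x ∈ grPart q α)
    (h1 : x ∈ grPart q (α + 1)) : x = 0 := by
  rcases zmod2_cases α with rfl | rfl
  · exact eq_zero_of_mem_grPart h0 (by simpa using h1)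
  · exact eq_zero_of_mem_grPart (by simpa [zmod2_one_add_one] using h1) h0

theorem iota_mul_iota_swap (a b : Fin q → ℝ) : ExteriorAlgebra.ι ℝ a * ExteriorAlgebra.ι ℝ b
    = - (ExteriorAlgebra.ι ℝ b * ExteriorAlgebra.ι ℝ a) :=
  eq_neg_of_add_eq_zero_left (ExteriorAlgebra.ι_add_mul_swap a b)

theorem iota_mul_odd (v : Fin q → ℝ) {x : Gr q} (hx : x ∈ grPart q 1) :
    x * ExteriorAlgebra.ι ℝ v = -(ExteriorAlgebra.ι ℝ v * x) := by
  induction x, hx using CliffordAlgebra.odd_induction with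
  | ι w => exact iota_mul_iota_swap _ _
  | add a b _ _ iha ihb => rw [add_mul, mul_add, iha, ihb, neg_add]
  | ι_mul_ι_mul m₁ m₂ a _ ih =>
    change ExteriorAlgebra.ι ℝ m₁ * ExteriorAlgebra.ι ℝ m₂ * a * _ =
      -(_ * (ExteriorAlgebra.ι ℝ m₁ * ExteriorAlgebra.ι ℝ m₂ * a))
    rw [mul_assoc, ih, mul_neg, ← mul_assoc, (iota_mul_iota_commute m₁ m₂ _).eq, mul_assoc]

theorem odd_mul_odd {x y : Gr q} (hx : x ∈ grPart q 1) (hy : y ∈ grPart q 1) :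
    x * y = -(y * x) := by
  induction y, hy using CliffordAlgebra.odd_induction with
  | ι w => exact iota_mul_odd w hx
  | add a b _ _ iha ihb => rw [add_mul, mul_add, iha, ihb, neg_add]
  | ι_mul_ι_mul m₁ m₂ a _ ih =>
    change x * (ExteriorAlgebra.ι ℝ m₁ * ExteriorAlgebra.ι ℝ m₂ * a) =
      -(ExteriorAlgebra.ι ℝ m₁ * ExteriorAlgebra.ι ℝ m₂ * a * x)
    rw [mul_assoc _ a, ← mul_neg, ← ih, ← mul_assoc, ← mul_assoc, ← mul_assoc, mul_assoc x,
      ← (iota_mul_iota_commute m₁ m₂ x).eq]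

theorem super_comm {α β : ZMod 2} {x y : Gr q} (hx : x ∈ grPart q α) (hy : y ∈ grPart q β) :
    x * y = sgn (α * β) • (y * x) := by
  rcases zmod2_cases α with rfl | rfl
  · simpa using (even_commute hx y).eq
  rcases zmod2_cases β with rfl | rfl
  · simpa using (even_commute hy x).eq.symm
  simpa using odd_mul_odd hx hy

theorem odd_mul_self {x : Gr q} (hx : x ∈ grPart q 1) : x * x = 0 := by
  have h := odd_mul_odd hx hx
  have h2 : (2 : ℝ) • (x * x) = 0 := by rw [two_smul]; nth_rewrite 1 [h]; exact neg_add_cancel _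
  exact (smul_eq_zero.1 h2).resolve_left two_ne_zero

/-! The monomial basis. -/

theorem grBasis_empty : grBasis q ∅ = 1 := by
  rw [grBasis, ExteriorAlgebra.basis_apply_ofCard (n := 0) _ (s := ∅) rfl]
  simp

theorem grBasis_singleton (m : Fin q) : grBasis q {m} = xi m := by
  rw [grBasis, ExteriorAlgebra.basis_apply_ofCard (n := 1) _ (s := {m}) (Finset.card_singleton m)]
  simp [ExteriorAlgebra.ιMulti_family, ExteriorAlgebra.ιMulti_apply, xi,
    Set.powersetCard.ofFinEmbEquiv_symm_apply, Set.powersetCard.ofCard]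

theorem grBasis_mul_of_not_disjoint {I J : Finset (Fin q)} (h : ¬Disjoint I J) :
    grBasis q I * grBasis q J = 0 :=
  ExteriorAlgebra.basis_mul_of_not_disjoint _ (Set.powersetCard.ofCard rfl : _)
    (Set.powersetCard.ofCard rfl) h

/-- The scalar is the sign of the shuffle permutation; only its invertibility is used later, and s *
s = 1 records that. -/
theorem grBasis_mul_of_disjoint {I J : Finset (Fin q)} (h : Disjoint I J) :
    ∃ s : ℝ, s * s = 1 ∧ grBasis q I * grBasis q J = s • grBasis q (I ∪ J) := by
  have := ExteriorAlgebra.basis_mul_of_disjoint (Pi.basisFun ℝ (Fin q))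
    (Set.powersetCard.ofCard (s := I) rfl) (Set.powersetCard.ofCard (s := J) rfl) h
  set σ := Equiv.Perm.sign (Set.powersetCard.permOfDisjoint (s := Set.powersetCard.ofCard (s := I) rfl)
    (t := Set.powersetCard.ofCard (s := J) rfl) h)
  refine ⟨((σ : ℤ) : ℝ), ?_, ?_⟩
  · rcases Int.units_eq_one_or σ with h | h <;> simp [h]
  · have e : I ∪ J = I.disjUnion J h := (Finset.disjUnion_eq_union I J h).symm
    rw [e]
    refine this.trans ?_
    rw [Int.cast_smul_eq_zsmul]
    rfl

theorem grBasis_mul (I J : Finset (Fin q)) :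
    ∃ s : ℝ, grBasis q I * grBasis q J = s • grBasis q (I ∪ J) := by
  by_cases h : Disjoint I J
  · obtain ⟨s, -, hs⟩ := grBasis_mul_of_disjoint h
    exact ⟨s, hs⟩
  · exact ⟨0, by rw [grBasis_mul_of_not_disjoint h, zero_smul]⟩

theorem grBasis_insert {m : Fin q} {I : Finset (Fin q)} (h : m ∉ I) :
    ∃ s : ℝ, grBasis q (insert m I) = s • (xi m * grBasis q I) := by
  obtain ⟨s, hs, e⟩ := grBasis_mul_of_disjoint (Finset.disjoint_singleton_left.2 h)
  refine ⟨s, ?_⟩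
  rw [← grBasis_singleton, e, smul_smul, hs, one_smul]
  rfl

theorem grBasis_mem_grPart (I : Finset (Fin q)) : grBasis q I ∈ grPart q I.card := by
  induction I using Finset.induction_on with
  | empty => rw [grBasis_empty]; exact_mod_cast one_mem_grPart
  | insert m I h ih =>
    obtain ⟨s, hs⟩ := grBasis_insert h
    rw [hs, Finset.card_insert_of_notMem h, Nat.cast_add, Nat.cast_one, add_comm]
    exact Submodule.smul_mem _ _ (mul_mem_grPart (iota_mem_grPart _) ih)

/-- The monomials of the wrong parity add up to an element C of parity ε + 1. Being also a
difference of two elements of parity ε, it is zero. -/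
theorem repr_eq_zero_of_mem_grPart {ε : ZMod 2} {x : Gr q} (hx : x ∈ grPart q ε)
    {I : Finset (Fin q)} (hI : (I.card : ZMod 2) ≠ ε) : (grBasis q).repr x I = 0 := by
  classical
  set A := ∑ J with (J.card : ZMod 2) = ε, (grBasis q).repr x J • grBasis q J
  set C := ∑ J with ¬ (J.card : ZMod 2) = ε, (grBasis q).repr x J • grBasis q J with hC
  have hAC : A + C = x := by
    rw [Finset.sum_filter_add_sum_filter_not]
    exact (grBasis q).sum_repr x
  have hA : A ∈ grPart q ε := sum_mem fun J hJ => Submodule.smul_mem _ _ <| by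
    rw [← (Finset.mem_filter.1 hJ).2]; exact grBasis_mem_grPart J
  have key : ∀ a b : ZMod 2, ¬ a = b → a = b + 1 := by decide
  have hC1 : C ∈ grPart q (ε + 1) := sum_mem fun J hJ => Submodule.smul_mem _ _ <| by
    rw [← key _ _ (Finset.mem_filter.1 hJ).2]; exact grBasis_mem_grPart J
  have hC0 : C ∈ grPart q ε := by
    rw [← eq_sub_iff_add_eq'] at hAC
    rw [hAC]; exact sub_mem hx hA
  have hz := eq_zero_of_mem_grPart' hC0 hC1
  have h2 := congrArg (fun z => (grBasis q).repr z I) hz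
  simp only [hC, map_sum, map_smul, Module.Basis.repr_self, Finsupp.coe_finsetSum, Finset.sum_apply,
    Finsupp.smul_apply, map_zero, Finsupp.zero_apply] at h2
  rw [Finset.sum_eq_single I] at h2
  · simpa using h2
  · intro J _ hJ
    rw [Finsupp.single_eq_of_ne hJ.symm, smul_zero]
  · intro h
    exact absurd (Finset.mem_filter.2 ⟨Finset.mem_univ I, hI⟩) h

theorem mem_grPart_iff_repr {ε : ZMod 2} {x : Gr q} :
    x ∈ grPart q ε ↔ ∀ I : Finset (Fin q), (I.card : ZMod 2) ≠ ε → (grBasis q).repr x I = 0 := by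
  refine ⟨fun h I hI => repr_eq_zero_of_mem_grPart h hI, fun h => ?_⟩
  rw [← (grBasis q).sum_repr x]
  refine sum_mem fun I _ => ?_
  by_cases hI : (I.card : ZMod 2) = ε
  · exact Submodule.smul_mem _ _ (hI ▸ grBasis_mem_grPart I)
  · rw [h I hI, zero_smul]; exact zero_mem _

/-! The filtration by degree. -/

/-- The span of the monomials of degree at least `k`. -/
def grFil (q k : ℕ) : Submodule ℝ (Gr q) := Submodule.span ℝ (grBasis q '' {I | k ≤ I.card})

theorem grBasis_mem_grFil {k : ℕ} {I : Finset (Fin q)} (h : k ≤ I.card) :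
    grBasis q I ∈ grFil q k := Submodule.subset_span ⟨I, h, rfl⟩

theorem mul_mem_grFil {j k : ℕ} {x y : Gr q} (hx : x ∈ grFil q j) (hy : y ∈ grFil q k) :
    x * y ∈ grFil q (j + k) := by
  have : grFil q j * grFil q k ≤ grFil q (j + k) := by
    rw [grFil, grFil, Submodule.span_mul_span, Submodule.span_le]
    rintro _ ⟨_, ⟨I, hI, rfl⟩, _, ⟨J, hJ, rfl⟩, rfl⟩
    change grBasis q I * grBasis q J ∈ grFil q (j + k)
    by_cases h : Disjoint I J
    · obtain ⟨s, -, hs⟩ := grBasis_mul_of_disjoint h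
      rw [hs]
      refine Submodule.smul_mem _ _ (grBasis_mem_grFil ?_)
      rw [Finset.card_union_of_disjoint h]
      exact add_le_add hI hJ
    · rw [grBasis_mul_of_not_disjoint h]; exact zero_mem _
  exact this (Submodule.mul_mem_mul hx hy)

theorem mem_grFil_zero (x : Gr q) : x ∈ grFil q 0 := by
  rw [← (grBasis q).sum_repr x]
  exact sum_mem fun I _ => Submodule.smul_mem _ _ (grBasis_mem_grFil (Nat.zero_le _))

theorem eq_zero_of_mem_grFil {x : Gr q} (hx : x ∈ grFil q (q + 1)) : x = 0 := by
  have : {I : Finset (Fin q) | q + 1 ≤ I.card} = ∅ := by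
    ext I
    have := Finset.card_le_univ I
    rw [Fintype.card_fin] at this
    refine ⟨fun h => ?_, fun h => h.elim⟩
    have h' : q + 1 ≤ I.card := h
    omega
  rwa [grFil, this, image_empty, Submodule.span_empty, Submodule.mem_bot] at hx

theorem body_iota (v : Fin q → ℝ) : body (ExteriorAlgebra.ι ℝ v : Gr q) = 0 := by
  simp [body, ExteriorAlgebra.algebraMapInv]

theorem body_algebraMap (r : ℝ) : body (algebraMap ℝ (Gr q) r) = r := by
  rw [AlgHom.commutes]; rfl

theorem body_grBasis {I : Finset (Fin q)} (h : I.Nonempty) : body (grBasis q I) = 0 := by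
  obtain ⟨m, hm⟩ := h
  obtain ⟨s, hs⟩ := grBasis_insert (Finset.notMem_erase m I)
  rw [Finset.insert_erase hm] at hs
  rw [hs, map_smul, map_mul, xi, body_iota, zero_mul, smul_zero]

theorem mem_grFil_one_iff {x : Gr q} : x ∈ grFil q 1 ↔ body x = 0 := by
  have hrep : body x = (grBasis q).repr x ∅ := by
    conv_lhs => rw [← (grBasis q).sum_repr x]
    rw [map_sum, Finset.sum_eq_single ∅]
    · rw [map_smul, grBasis_empty, map_one, smul_eq_mul, mul_one]
    · intro I _ hI
      rw [map_smul, body_grBasis (Finset.nonempty_iff_ne_empty.2 hI), smul_zero]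
    · simp
  constructor
  · intro h
    refine Submodule.span_induction (p := fun y _ => body y = 0) ?_ (map_zero _) ?_ ?_ h
    · rintro _ ⟨I, hI, rfl⟩
      exact body_grBasis (Finset.card_pos.1 hI)
    · intro a b _ _ ha hb
      rw [map_add, ha, hb, add_zero]
    · intro r a _ ha
      rw [map_smul, ha, smul_zero]
  · intro h
    rw [← (grBasis q).sum_repr x]
    refine sum_mem fun I _ => ?_
    rcases I.eq_empty_or_nonempty with rfl | hI
    · rw [← hrep, h, zero_smul]; exact zero_mem _
    · exact Submodule.smul_mem _ _ (grBasis_mem_grFil (Finset.card_pos.2 hI))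

theorem sub_body_mem (x : Gr q) : x - algebraMap ℝ (Gr q) (body x) ∈ grFil q 1 := by
  rw [mem_grFil_one_iff, map_sub, body_algebraMap, sub_self]

theorem pow_mem_grFil {x : Gr q} (hx : x ∈ grFil q 1) (n : ℕ) : x ^ n ∈ grFil q n := by
  induction n with
  | zero => exact mem_grFil_zero _
  | succ n ih => rw [pow_succ]; exact mul_mem_grFil ih hx

theorem pow_eq_zero_of_body {x : Gr q} (hx : body x = 0) : x ^ (q + 1) = 0 :=
  eq_zero_of_mem_grFil (pow_mem_grFil (mem_grFil_one_iff.2 hx) _)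

theorem body_isUnit {x : Gr q} (hx : body x ≠ 0) : IsUnit x := by
  have hn : IsNilpotent (x - algebraMap ℝ (Gr q) (body x)) :=
    ⟨q + 1, eq_zero_of_mem_grFil (pow_mem_grFil (sub_body_mem x) _)⟩
  have := hn.isUnit_add_left_of_commute ((isUnit_iff_ne_zero.2 hx).map (algebraMap ℝ (Gr q)))
    (Algebra.commutes _ _).symm
  simpa using this

theorem isUnit_iff_body {x : Gr q} : IsUnit x ↔ body x ≠ 0 :=
  ⟨fun h => (h.map (body (q := q))).ne_zero, body_isUnit⟩

/-! Contractions. -/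

/-- The contraction with a dual vector. -/
abbrev contr (d : Module.Dual ℝ (Fin q → ℝ)) : Gr q →ₗ[ℝ] Gr q :=
  CliffordAlgebra.contractLeft (Q := (0 : QuadraticForm ℝ (Fin q → ℝ))) d

theorem contr_iota_mul (d : Module.Dual ℝ (Fin q → ℝ)) (v : Fin q → ℝ) (x : Gr q) :
    contr d (ExteriorAlgebra.ι ℝ v * x) = d v • x - ExteriorAlgebra.ι ℝ v * contr d x :=
  CliffordAlgebra.contractLeft_ι_mul (Q := (0 : QuadraticForm ℝ (Fin q → ℝ))) d v x

theorem contr_algebraMap (d : Module.Dual ℝ (Fin q → ℝ)) (r : ℝ) :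
    contr d (algebraMap ℝ (Gr q) r) = 0 :=
  CliffordAlgebra.contractLeft_algebraMap (Q := (0 : QuadraticForm ℝ (Fin q → ℝ))) d r

theorem contr_iota (d : Module.Dual ℝ (Fin q → ℝ)) (v : Fin q → ℝ) :
    contr d (ExteriorAlgebra.ι ℝ v) = algebraMap ℝ (Gr q) (d v) :=
  CliffordAlgebra.contractLeft_ι (Q := (0 : QuadraticForm ℝ (Fin q → ℝ))) d v

theorem contr_mem_grPart (d : Module.Dual ℝ (Fin q → ℝ)) {ε : ZMod 2} {x : Gr q}
    (hx : x ∈ grPart q ε) : contr d x ∈ grPart q (ε + 1) := by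
  have step : ∀ (ε : ZMod 2) (m₁ m₂ : Fin q → ℝ) (a : Gr q), a ∈ grPart q ε →
      contr d a ∈ grPart q (ε + 1) →
      contr d (ExteriorAlgebra.ι ℝ m₁ * ExteriorAlgebra.ι ℝ m₂ * a) ∈ grPart q (ε + 1) := by
    intro ε m₁ m₂ a ha ih
    rw [mul_assoc, contr_iota_mul, contr_iota_mul, mul_sub]
    have h1 : ∀ m, ExteriorAlgebra.ι ℝ m * a ∈ grPart q (ε + 1) := fun m => by
      rw [add_comm]; exact mul_mem_grPart (iota_mem_grPart m) ha
    refine sub_mem (Submodule.smul_mem _ _ (h1 _)) (sub_mem ?_ ?_)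
    · rw [mul_smul_comm]; exact Submodule.smul_mem _ _ (h1 _)
    · have := mul_mem_grPart (iota_mem_grPart m₁) (mul_mem_grPart (iota_mem_grPart m₂) ih)
      rwa [← add_assoc 1 1, zmod2_one_add_one, zero_add] at this
  rcases zmod2_cases ε with rfl | rfl
  · induction x, hx using CliffordAlgebra.even_induction with
    | algebraMap r => erw [contr_algebraMap]; exact zero_mem _
    | add a b _ _ iha ihb => rw [map_add]; exact add_mem iha ihb
    | ι_mul_ι_mul m₁ m₂ a ha ih => exact step 0 m₁ m₂ a ha ih
  · induction x, hx using CliffordAlgebra.odd_induction with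
    | ι v =>
      erw [contr_iota]
      rw [zmod2_one_add_one]; exact algebraMap_mem_grPart _
    | add a b _ _ iha ihb => rw [map_add]; exact add_mem iha ihb
    | ι_mul_ι_mul m₁ m₂ a ha ih => exact step 1 m₁ m₂ a ha ih

theorem contr_mul (d : Module.Dual ℝ (Fin q → ℝ)) {ε : ZMod 2} {x : Gr q}
    (hx : x ∈ grPart q ε) (y : Gr q) :
    contr d (x * y) = contr d x * y + sgn ε • (x * contr d y) := by
  -- A pair of generators passes through the contraction without changing the sign, so the even and
  -- the odd induction share this step.
  have step : ∀ (ε : ZMod 2) (m₁ m₂ : Fin q → ℝ) (a : Gr q),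
      contr d (a * y) = contr d a * y + sgn ε • (a * contr d y) →
      contr d (ExteriorAlgebra.ι ℝ m₁ * ExteriorAlgebra.ι ℝ m₂ * a * y) =
        contr d (ExteriorAlgebra.ι ℝ m₁ * ExteriorAlgebra.ι ℝ m₂ * a) * y +
        sgn ε • (ExteriorAlgebra.ι ℝ m₁ * ExteriorAlgebra.ι ℝ m₂ * a * contr d y) := by
    intro ε m₁ m₂ a ih
    simp only [mul_assoc, contr_iota_mul, mul_sub, sub_mul, ih, mul_add, mul_smul_comm,
      smul_mul_assoc]
    abel
  rcases zmod2_cases ε with rfl | rfl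
  · induction x, hx using CliffordAlgebra.even_induction with
    | algebraMap r =>
      change contr d (algebraMap ℝ (Gr q) r * y) = contr d (algebraMap ℝ (Gr q) r) * y +
        sgn 0 • (algebraMap ℝ (Gr q) r * contr d y)
      rw [contr_algebraMap, ← Algebra.smul_def, map_smul, ← Algebra.smul_def]; simp
    | add a b _ _ iha ihb => rw [add_mul, map_add, iha, ihb, map_add, add_mul, add_mul, smul_add]; abel
    | ι_mul_ι_mul m₁ m₂ a ha ih => exact step 0 m₁ m₂ a ih
  · induction x, hx using CliffordAlgebra.odd_induction with
    | ι v =>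
      change contr d (ExteriorAlgebra.ι ℝ v * y) = contr d (ExteriorAlgebra.ι ℝ v) * y +
        sgn 1 • (ExteriorAlgebra.ι ℝ v * contr d y)
      rw [contr_iota, contr_iota_mul, ← Algebra.smul_def, sgn_one, neg_one_smul, sub_eq_add_neg]
    | add a b _ _ iha ihb => rw [add_mul, map_add, iha, ihb, map_add, add_mul, add_mul, smul_add]; abel
    | ι_mul_ι_mul m₁ m₂ a ha ih => exact step 1 m₁ m₂ a ih

/-- Contraction lowers the degree. This is why odd derivatives have no top coefficient, so that
their Berezin integral vanishes. -/
theorem contr_grBasis_mem (d : Module.Dual ℝ (Fin q → ℝ)) (I : Finset (Fin q)) :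
    contr d (grBasis q I) ∈ Submodule.span ℝ (grBasis q '' {J | J.card + 1 ≤ I.card}) := by
  induction I using Finset.induction_on with
  | empty => 
    have := contr_algebraMap d 1
    rw [map_one] at this
    rw [grBasis_empty, this]; exact zero_mem _
  | insert m I h ih =>
    obtain ⟨s, hs⟩ := grBasis_insert h
    rw [hs, map_smul, xi, contr_iota_mul, Finset.card_insert_of_notMem h]
    refine Submodule.smul_mem _ _ (sub_mem (Submodule.smul_mem _ _ ?_) ?_)
    · exact Submodule.subset_span ⟨I, le_refl (I.card + 1), rfl⟩
    · refine Submodule.span_induction (p := fun y _ => ExteriorAlgebra.ι ℝ (Pi.single m (1 : ℝ)) * y ∈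
        Submodule.span ℝ (grBasis q '' {J | J.card + 1 ≤ I.card + 1})) ?_ ?_ ?_ ?_ ih
      · rintro _ ⟨J, hJ, rfl⟩
        obtain ⟨s, hs⟩ := grBasis_mul {m} J
        rw [grBasis_singleton, xi] at hs
        rw [hs]
        refine Submodule.smul_mem _ _ (Submodule.subset_span ⟨_, ?_, rfl⟩)
        have := Finset.card_union_le {m} J
        rw [Finset.card_singleton] at this
        have hJ' : J.card + 1 ≤ I.card := hJ
        change _ + 1 ≤ _ + 1
        omega
      · rw [mul_zero]; exact zero_mem _
      · intro a b _ _ ha hb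
        rw [mul_add]; exact add_mem ha hb
      · intro r a _ ha
        rw [mul_smul_comm]; exact Submodule.smul_mem _ _ ha

theorem repr_contr_univ (d : Module.Dual ℝ (Fin q → ℝ)) (x : Gr q) :
    (grBasis q).repr (contr d x) Finset.univ = 0 := by
  have h : ∀ I, (grBasis q).repr (contr d (grBasis q I)) Finset.univ = 0 := by
    intro I
    refine Submodule.span_induction (p := fun y _ => (grBasis q).repr y Finset.univ = 0)
      ?_ ?_ ?_ ?_ (contr_grBasis_mem d I)
    · rintro _ ⟨J, hJ, rfl⟩
      rw [Module.Basis.repr_self, Finsupp.single_eq_of_ne]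
      rintro rfl
      have h1 := Finset.card_le_univ I
      have h2 : (Finset.univ : Finset (Fin q)).card + 1 ≤ I.card := hJ
      rw [Finset.card_univ] at h2
      omega
    · simp
    · intro a b _ _ ha hb; simp [ha, hb]
    · intro r a _ ha; simp [ha]
  rw [← (grBasis q).sum_repr x, map_sum, map_sum, Finsupp.coe_finsetSum, Finset.sum_apply]
  refine Finset.sum_eq_zero fun I _ => ?_
  rw [map_smul, map_smul, Finsupp.smul_apply, h, smul_zero]

/-- The pairing by the coefficient of the top monomial is nondegenerate. -/
theorem eq_zero_of_top_mul {x : Gr q}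
    (h : ∀ J, (grBasis q).repr (x * grBasis q J) Finset.univ = 0) : x = 0 := by
  classical
  have key : ∀ n : ℕ, ∀ I : Finset (Fin q), I.card = n → (grBasis q).repr x I = 0 := by
    intro n
    induction n using Nat.strong_induction_on with
    | _ n ih =>
      intro I hI
      -- Against the complementary monomial only the ξ^K with K ⊆ I reach the top degree, and those
      -- with K ≠ I have vanishing coefficients by induction on the degree.
      have h1 := h Iᶜ
      rw [← (grBasis q).sum_repr x, Finset.sum_mul, map_sum, Finsupp.coe_finsetSum,
        Finset.sum_apply, Finset.sum_eq_single I] at h1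
      · obtain ⟨s, hs, e⟩ := grBasis_mul_of_disjoint (disjoint_compl_right : Disjoint I Iᶜ)
        rw [smul_mul_assoc, e, Finset.union_compl, map_smul, map_smul, Module.Basis.repr_self] at h1
        simp only [Finsupp.smul_apply, Finsupp.single_eq_same, smul_eq_mul, mul_one] at h1
        refine (mul_eq_zero.1 h1).resolve_right ?_
        rintro rfl
        simp at hs
      · intro K _ hK
        rw [smul_mul_assoc, map_smul, Finsupp.smul_apply]
        by_cases hd : Disjoint K Iᶜ
        · have hsub : K ⊂ I := Finset.ssubset_iff_subset_ne.2 ⟨by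
            rw [← disjoint_compl_right_iff]; exact hd, hK⟩
          rw [ih K.card (hI ▸ Finset.card_lt_card hsub) K rfl, zero_smul]
        · rw [grBasis_mul_of_not_disjoint hd]; simp
      · simp
  refine (grBasis q).repr.injective (Finsupp.ext fun I => ?_)
  rw [key _ I rfl]; simp

end Grassmann

end SuperGeom

end

noncomputable section

namespace SuperGeom

/-! ### Smooth functions on open subsets of `ℝ^p` -/

section Smooth

open Filter Topology MeasureTheory

variable {E F : Type} [NormedAddCommGroup E] [NormedSpace ℝ E] [FiniteDimensional ℝ E]
  [NormedAddCommGroup F] [NormedSpace ℝ F]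

/-- A smooth function with compact support in `V` that is `1` near the compact set `K`. -/
theorem exists_bump {K V : Set E} (hK : IsCompact K) (hV : IsOpen V) (hKV : K ⊆ V) :
    ∃ b : E → ℝ, ContDiff ℝ ∞ b ∧ HasCompactSupport b ∧ tsupport b ⊆ V ∧ ∀ᶠ y in 𝓝ˢ K, b y = 1 := by
  obtain ⟨K', hK', h1, h2⟩ := exists_compact_between hK hV hKV
  obtain ⟨f, hf0, hf1, -⟩ := exists_contMDiffMap_zero_one_nhds_of_isClosed
    (n := ⊤) (modelWithCornersSelf ℝ E) (s := (interior K')ᶜ) (t := K)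
    isOpen_interior.isClosed_compl hK.isClosed (disjoint_compl_left_iff_subset.2 h1)
  have hsub : tsupport f ⊆ interior K' := by
    intro y hy
    by_contra h
    rw [eventually_nhdsSet_iff_forall] at hf0
    have := hf0 y h
    exact (notMem_tsupport_iff_eventuallyEq.2 this) hy
  refine ⟨f, f.contMDiff.contDiff, ?_, hsub.trans (interior_subset.trans h2), hf1⟩
  exact hK'.of_isClosed_subset (isClosed_tsupport _) (hsub.trans interior_subset)

omit [FiniteDimensional ℝ E] in
theorem contDiff_bump_mul {b r : E → ℝ} {V : Set E} (hV : IsOpen V) (hb : ContDiff ℝ ∞ b)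
    (hbV : tsupport b ⊆ V) (hr : ContDiffOn ℝ ∞ r V) : ContDiff ℝ ∞ fun y => b y * r y := by
  rw [contDiff_iff_contDiffAt]
  intro y
  by_cases hy : y ∈ V
  · exact hb.contDiffAt.mul ((hr y hy).contDiffAt (hV.mem_nhds hy))
  · have h0 : b =ᶠ[𝓝 y] 0 := notMem_tsupport_iff_eventuallyEq.1 fun h => hy (hbV h)
    refine (contDiffAt_const (c := (0 : ℝ))).congr_of_eventuallyEq ?_
    filter_upwards [h0] with z hz
    rw [hz, Pi.zero_apply, zero_mul]

omit [FiniteDimensional ℝ E] in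
-- The integral is the value at 0 of the convolution of the indicator of (0,1] with t ↦ b(t)
-- h(x,−t). The factor b, equal to 1 near [−1,0], supplies the compact support under which such
-- convolutions are smooth in the parameter.
theorem contDiff_integral_param {h : E → ℝ → F} (hh : ContDiff ℝ ∞ ↿h) :
    ContDiff ℝ ∞ fun x => ∫ t in (0 : ℝ)..1, h x t := by
  obtain ⟨b, hb, hbc, -, hb1⟩ := exists_bump (K := Icc (-1 : ℝ) 0) isCompact_Icc isOpen_univ
    (subset_univ _)
  let g : E → ℝ → F := fun x t => b t • h x (-t)
  have hg : ContDiff ℝ ∞ ↿g := by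
    change ContDiff ℝ ∞ fun z : E × ℝ => b z.2 • (↿h) (z.1, -z.2)
    exact (hb.comp contDiff_snd).smul (hh.comp (contDiff_fst.prodMk contDiff_snd.neg))
  have hloc : LocallyIntegrable (indicator (Ioc (0 : ℝ) 1) fun _ => (1 : ℝ)) volume :=
    ((integrable_indicator_iff measurableSet_Ioc).2
      (by simp)).locallyIntegrable
  have := contDiffOn_convolution_right_with_param_comp (n := ⊤) (μ := volume)
    (ContinuousLinearMap.lsmul ℝ ℝ : ℝ →L[ℝ] F →L[ℝ] F)
    (s := univ) (v := fun _ : E => (0 : ℝ)) contDiffOn_const (f := indicator (Ioc (0 : ℝ) 1) fun _ => 1)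
    (g := g) (k := tsupport b) isOpen_univ hbc
    (fun x t _ ht => by simp only [g]; rw [image_eq_zero_of_notMem_tsupport ht, zero_smul])
    hloc hg.contDiffOn
  have this' := contDiffOn_univ.1 this
  suffices h : (fun x => ∫ t in (0 : ℝ)..1, h x t) = _ by rw [h]; exact this'
  funext x
  rw [convolution_def, intervalIntegral.integral_of_le zero_le_one,
    ← integral_indicator measurableSet_Ioc]
  refine integral_congr_ae (Eventually.of_forall fun t => ?_)
  by_cases ht : t ∈ Ioc (0 : ℝ) 1
  · have h1 : b (-t) = 1 := by
      have := (eventually_nhdsSet_iff_forall.1 hb1) (-t) ⟨by linarith [ht.2], by linarith [ht.1]⟩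
      exact this.self_of_nhds
    simp [ht, g, h1]
  · simp [ht]

omit [FiniteDimensional ℝ E] in
/-- Hadamard's lemma. -/
theorem exists_hadamard {f : E → ℝ} (hf : ContDiff ℝ ∞ f) (x₀ : E) :
    ∃ g : E → E →L[ℝ] ℝ, ContDiff ℝ ∞ g ∧ ∀ x, f x = f x₀ + g x (x - x₀) := by
  have hd : ContDiff ℝ ∞ (fderiv ℝ f) := hf.fderiv_right (by simp)
  let h : E → ℝ → E →L[ℝ] ℝ := fun x t => fderiv ℝ f (x₀ + t • (x - x₀))
  have hh : ContDiff ℝ ∞ ↿h := by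
    change ContDiff ℝ ∞ fun z : E × ℝ => fderiv ℝ f (x₀ + z.2 • (z.1 - x₀))
    exact hd.comp (contDiff_const.add (contDiff_snd.smul (contDiff_fst.sub contDiff_const)))
  refine ⟨_, contDiff_integral_param hh, fun x => ?_⟩
  have hc : Continuous (h x) := hh.continuous.comp (Continuous.prodMk_right x)
  rw [ContinuousLinearMap.intervalIntegral_apply (hc.intervalIntegrable _ _)]
  have hder : ∀ t ∈ uIcc (0 : ℝ) 1, HasDerivAt (fun t : ℝ => f (x₀ + t • (x - x₀)))
      (h x t (x - x₀)) t := by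
    intro t _
    have h1 : HasDerivAt (fun t : ℝ => x₀ + t • (x - x₀)) (x - x₀) t := by
      simpa using ((hasDerivAt_id t).smul_const (x - x₀)).const_add x₀
    exact ((hf.differentiable (by simp)) _).hasFDerivAt.comp_hasDerivAt t h1
  rw [intervalIntegral.integral_eq_sub_of_hasDerivAt hder
    ((hc.clm_apply continuous_const).intervalIntegrable _ _)]
  simp

theorem exists_hadamard_real {f : ℝ → ℝ} (hf : ContDiff ℝ ∞ f) :
    ∃ g : ℝ → ℝ, ContDiff ℝ ∞ g ∧ ∀ t, f t = f 0 + t * g t := by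
  obtain ⟨g, hg, h⟩ := exists_hadamard hf 0
  refine ⟨fun t => g t 1, hg.clm_apply contDiff_const, fun t => ?_⟩
  rw [h t, sub_zero]
  congr 1
  conv_lhs => rw [← mul_one t, ← smul_eq_mul t 1, map_smul, smul_eq_mul]
  simp

/-- Hadamard's lemma on an open set. -/
theorem exists_hadamard_on {p : ℕ} {V : Set (Fin p → ℝ)} (hV : IsOpen V) {r : (Fin p → ℝ) → ℝ}
    (hr : ContDiffOn ℝ ∞ r V) {y₀ : Fin p → ℝ} (hy₀ : y₀ ∈ V) :
    ∃ g : Fin p → (Fin p → ℝ) → ℝ, (∀ k, ContDiffOn ℝ ∞ (g k) V) ∧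
      ∀ y ∈ V, r y = r y₀ + ∑ k, (y k - y₀ k) * g k y := by
  obtain ⟨b, hb, -, hbV, hb1⟩ := exists_bump (isCompact_singleton (x := y₀)) hV
    (singleton_subset_iff.2 hy₀)
  rw [nhdsSet_singleton] at hb1
  obtain ⟨g, hg, hgr⟩ := exists_hadamard (contDiff_bump_mul hV hb hbV hr) y₀
  -- V need not be star-shaped, so the global lemma is applied to b r only. The rest (1 − b) r
  -- vanishes near y₀ and equals ∑ (y_k − y₀_k)² (1 − b) r / ρ, with ρ the squared distance to y₀.
  let ρ : (Fin p → ℝ) → ℝ := fun y => ∑ k, (y k - y₀ k) * (y k - y₀ k)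
  have hρ : ContDiff ℝ ∞ ρ := ContDiff.sum fun k _ =>
    ((contDiff_apply ℝ ℝ k).sub contDiff_const).mul ((contDiff_apply ℝ ℝ k).sub contDiff_const)
  have hρ0 : ∀ y, y ≠ y₀ → ρ y ≠ 0 := by
    intro y hy h
    rw [Finset.sum_eq_zero_iff_of_nonneg fun _ _ => mul_self_nonneg _] at h
    exact hy (funext fun k => sub_eq_zero.1 (mul_self_eq_zero.1 (h k (Finset.mem_univ k))))
  have hb0 : b y₀ = 1 := hb1.self_of_nhds
  refine ⟨fun k y => g y (Pi.single k 1) + (y k - y₀ k) * ((1 - b y) * r y / ρ y), fun k => ?_,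
    fun y hy => ?_⟩
  · refine ((hg.clm_apply contDiff_const).contDiffOn).add ?_
    refine ((contDiff_apply ℝ ℝ k).sub contDiff_const).contDiffOn.mul ?_
    intro y hy
    by_cases h : y = y₀
    · subst h
      refine ((contDiffAt_const (c := (0 : ℝ))).congr_of_eventuallyEq ?_).contDiffWithinAt
      filter_upwards [hb1] with z hz
      simp [hz]
    · exact (((contDiff_const.sub hb).contDiffAt.contDiffWithinAt.mul (hr y hy))).div
        hρ.contDiffAt.contDiffWithinAt (hρ0 y h)
  · have h1 := hgr y
    have h2 : g y (y - y₀) = ∑ k, (y k - y₀ k) * g y (Pi.single k 1) := by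
      conv_lhs => rw [pi_eq_sum_univ' (y - y₀)]
      rw [map_sum]
      refine Finset.sum_congr rfl fun k _ => ?_
      rw [← smul_eq_mul, ← map_smul]
      congr 2
    simp only [mul_add, Finset.sum_add_distrib]
    rw [← h2]
    simp only [← mul_assoc]
    rw [← Finset.sum_mul]
    change r y = r y₀ + (g y (y - y₀) + ρ y * ((1 - b y) * r y / ρ y))
    rw [hb0, one_mul] at h1
    by_cases h : y = y₀
    · subst h; simp [hb0]
    · rw [mul_div_cancel₀ _ (hρ0 y h)]
      linarith

end Smooth

end SuperGeom

end

noncomputable section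

namespace SuperGeom

/-! ### Superfunctions -/

section SuperFunctions

open Filter Topology

variable {p q : ℕ} {V : Opens (Fin p → ℝ)}

theorem coeffAt_apply (f : V → Gr q) (I : Finset (Fin q)) (y : V) :
    coeffAt f I y.1 = (grBasis q).repr (f y) I := by
  have hy : y.1 ∈ V := y.2
  simp [coeffAt, zeroExt]

theorem coeffAt_of_notMem (f : V → Gr q) (I : Finset (Fin q)) {y : Fin p → ℝ} (hy : y ∉ V) :
    coeffAt f I y = 0 := by
  simp [coeffAt, zeroExt, dif_neg hy]

/-- The coefficients of `f` are smooth. -/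
def IsSmooth (f : V → Gr q) : Prop := ∀ I, ContDiffOn ℝ ∞ (coeffAt f I) V

theorem SuperFun.isSmooth (f : SuperFun q V) : IsSmooth f.fn := f.contDiffOn

theorem eventually_coe {P : (Fin p → ℝ) → Prop} {y : V} :
    (∀ᶠ z in 𝓝 y.1, P z) ↔ ∀ᶠ z : V in 𝓝 y, P z.1 := by
  rw [← map_nhds_subtype_coe_eq_nhds y.2 (V.isOpen.mem_nhds y.2), eventually_map]

theorem coeffAt_congr {f g : V → Gr q} {y : V} (h : f =ᶠ[𝓝 y] g) (I : Finset (Fin q)) :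
    coeffAt f I =ᶠ[𝓝 y.1] coeffAt g I := by
  refine eventually_coe.2 (h.mono fun z hz => ?_)
  rw [coeffAt_apply, coeffAt_apply, hz]

theorem isSmooth_of_locally {f : V → Gr q}
    (h : ∀ y : V, ∃ g : V → Gr q, IsSmooth g ∧ f =ᶠ[𝓝 y] g) : IsSmooth f := by
  intro I y hy
  obtain ⟨g, hg, hfg⟩ := h ⟨y, hy⟩
  exact (((hg I y hy).contDiffAt (V.isOpen.mem_nhds hy)).congr_of_eventuallyEq
    (coeffAt_congr hfg I)).contDiffWithinAt

theorem isSmooth_of_res {f : V → Gr q}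
    (h : ∀ y : V, ∃ (W : Opens (Fin p → ℝ)) (hW : W ≤ V) (g : W → Gr q), y.1 ∈ W ∧ IsSmooth g ∧
      ∀ z : W, f ⟨z.1, hW z.2⟩ = g z) : IsSmooth f := by
  intro I y hy
  obtain ⟨W, hW, g, hyW, hg, hfg⟩ := h ⟨y, hy⟩
  refine (((hg I y hyW).contDiffAt (W.isOpen.mem_nhds hyW)).congr_of_eventuallyEq
    ?_).contDiffWithinAt
  filter_upwards [W.isOpen.mem_nhds hyW] with z hz
  rw [coeffAt_apply f I ⟨z, hW hz⟩, coeffAt_apply g I ⟨z, hz⟩, hfg ⟨z, hz⟩]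

/-- A smooth real function, as a superfunction. -/
def ofReal (r : (Fin p → ℝ) → ℝ) (hr : ContDiffOn ℝ ∞ r V) : SuperFun q V :=
  .mk (fun y => algebraMap ℝ (Gr q) (r y.1)) fun I =>
    (hr.mul (contDiffOn_const (c := (grBasis q).repr 1 I))).congr fun y hy => by
      rw [coeffAt_apply _ I ⟨y, hy⟩, Algebra.algebraMap_eq_smul_one, map_smul]; rfl

@[simp] theorem fn_ofReal (r : (Fin p → ℝ) → ℝ) (hr : ContDiffOn ℝ ∞ r V) (y : V) :
    (ofReal r hr : SuperFun q V).fn y = algebraMap ℝ (Gr q) (r y.1) := rfl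

/-- A constant superfunction. -/
def constFun (V : Opens (Fin p → ℝ)) : Gr q →ₐ[ℝ] SuperFun q V where
  toFun x := .mk (fun _ => x) fun I =>
    (contDiffOn_const (c := (grBasis q).repr x I)).congr fun y hy => coeffAt_apply _ I ⟨y, hy⟩
  map_one' := rfl
  map_mul' _ _ := rfl
  map_zero' := rfl
  map_add' _ _ := rfl
  commutes' _ := rfl

@[simp] theorem fn_constFun (x : Gr q) (y : V) : (constFun V x).fn y = x := rfl

theorem SuperFun.fn_finset_sum {ι : Type*} (s : Finset ι) (f : ι → SuperFun q V) (y : V) :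
    (∑ i ∈ s, f i).fn y = ∑ i ∈ s, (f i).fn y :=
  map_sum (PosSupermanifold.evalAt y) f s

theorem SuperFun.fn_pow (f : SuperFun q V) (n : ℕ) (y : V) : (f ^ n).fn y = f.fn y ^ n :=
  map_pow (PosSupermanifold.evalAt y) f n

theorem SuperFun.eq_sum (f : SuperFun q V) :
    f = ∑ I, ofReal (coeffAt f.fn I) (f.contDiffOn I) * constFun V (grBasis q I) := by
  ext y
  rw [SuperFun.fn_finset_sum]
  conv_lhs => rw [← (grBasis q).sum_repr (f.fn y)]
  refine Finset.sum_congr rfl fun I _ => ?_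
  rw [SuperFun.fn_mul, Pi.mul_apply, fn_ofReal, fn_constFun, coeffAt_apply, Algebra.smul_def]

theorem contDiffOn_linear (L : Gr q →ₗ[ℝ] ℝ) {f : V → Gr q} (hf : IsSmooth f)
    (r : (Fin p → ℝ) → ℝ) (hr : ∀ y : V, r y.1 = L (f y)) : ContDiffOn ℝ ∞ r V := by
  have h : ContDiffOn ℝ ∞ (fun y => ∑ I, coeffAt f I y * L (grBasis q I)) (V : Set (Fin p → ℝ)) :=
    ContDiffOn.sum fun I _ => (hf I).mul contDiffOn_const
  refine h.congr fun y hy => ?_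
  rw [hr ⟨y, hy⟩]
  conv_lhs => rw [← (grBasis q).sum_repr (f ⟨y, hy⟩)]
  rw [map_sum]
  refine Finset.sum_congr rfl fun I _ => ?_
  rw [map_smul, smul_eq_mul, coeffAt_apply f I ⟨y, hy⟩]

theorem IsSmooth.linear {f : V → Gr q} (hf : IsSmooth f) (L : Gr q →ₗ[ℝ] Gr q) :
    IsSmooth fun y => L (f y) := fun I =>
  contDiffOn_linear (((Finsupp.lapply I).comp (grBasis q).repr.toLinearMap).comp L) hf _
    fun y => by rw [coeffAt_apply]; rfl

/-- The body of a superfunction, extended by zero. -/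
def bodyFun (f : V → Gr q) (y : Fin p → ℝ) : ℝ := body (zeroExt f y)

theorem bodyFun_apply (f : V → Gr q) (y : V) : bodyFun f y.1 = body (f y) := by
  have hy : y.1 ∈ V := y.2
  simp [bodyFun, zeroExt]

theorem contDiffOn_bodyFun {f : V → Gr q} (hf : IsSmooth f) : ContDiffOn ℝ ∞ (bodyFun f) V :=
  contDiffOn_linear body.toLinearMap hf _ (bodyFun_apply f)

theorem continuous_body {f : V → Gr q} (hf : IsSmooth f) : Continuous fun y : V => body (f y) := by
  have := continuousOn_iff_continuous_domRestrict.1 (contDiffOn_bodyFun hf).continuousOn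
  exact this.congr fun y => bodyFun_apply f y

/-- Evaluation of superfunctions, as a homomorphism of algebras. -/
def evalAlg (y : V) : SuperFun q V →ₐ[ℝ] Gr q :=
  { PosSupermanifold.evalAt y with commutes' := fun _ => rfl }

@[simp] theorem evalAlg_apply (y : V) (f : SuperFun q V) : evalAlg y f = f.fn y := rfl

/-! Partial derivatives. -/

theorem pd_congr (a : CoordIdx p q) {f g : V → Gr q} {y : V} (h : f =ᶠ[𝓝 y] g) :
    pd a f y = pd a g y := by
  cases a with
  | inl k =>
    refine Finset.sum_congr rfl fun I _ => ?_
    rw [(coeffAt_congr h I).fderiv_eq]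
  | inr m => exact congrArg (contr (LinearMap.proj m)) h.self_of_nhds

theorem IsSmooth.differentiableAt {f : V → Gr q} (hf : IsSmooth f) (I : Finset (Fin q)) (y : V) :
    DifferentiableAt ℝ (coeffAt f I) y.1 :=
  ((hf I).differentiableOn (by simp)).differentiableAt (V.isOpen.mem_nhds y.2)

theorem repr_pd_inl (k : Fin p) (f : V → Gr q) (y : V) (I : Finset (Fin q)) :
    (grBasis q).repr (pd (Sum.inl k) f y) I = fderiv ℝ (coeffAt f I) y.1 (Pi.single k 1) := by
  simp only [pd]
  rw [(grBasis q).repr_sum_self]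

theorem isSmooth_pd (a : CoordIdx p q) {f : V → Gr q} (hf : IsSmooth f) : IsSmooth (pd a f) := by
  cases a with
  | inl k =>
    intro I
    have : ContDiffOn ℝ ∞ (fun y => fderiv ℝ (coeffAt f I) y (Pi.single k 1)) V :=
      ((hf I).fderiv_of_isOpen V.isOpen (by simp)).clm_apply contDiffOn_const
    refine this.congr fun y hy => ?_
    rw [coeffAt_apply _ I ⟨y, hy⟩, repr_pd_inl]
  | inr m => exact hf.linear (contr (LinearMap.proj m))

theorem pd_add (a : CoordIdx p q) {f g : V → Gr q} (hf : IsSmooth f) (hg : IsSmooth g) :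
    pd a (f + g) = pd a f + pd a g := by
  funext y
  cases a with
  | inl k =>
    refine (grBasis q).repr.injective (Finsupp.ext fun I => ?_)
    rw [Pi.add_apply, map_add, Finsupp.add_apply, repr_pd_inl, repr_pd_inl, repr_pd_inl,
      ← _root_.add_apply, ← fderiv_add (hf.differentiableAt I y)
        (hg.differentiableAt I y)]
    congr 1
    refine Filter.EventuallyEq.fderiv_eq (eventually_coe.2 (.of_forall fun z => ?_))
    simp [coeffAt_apply]
  | inr m => exact map_add _ _ _

theorem pd_smul (a : CoordIdx p q) (r : ℝ) {f : V → Gr q} (hf : IsSmooth f) :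
    pd a (r • f) = r • pd a f := by
  funext y
  cases a with
  | inl k =>
    refine (grBasis q).repr.injective (Finsupp.ext fun I => ?_)
    rw [Pi.smul_apply, map_smul, Finsupp.smul_apply, repr_pd_inl, repr_pd_inl,
      ← _root_.smul_apply, ← fderiv_const_smul (hf.differentiableAt I y)]
    congr 1
    refine Filter.EventuallyEq.fderiv_eq (eventually_coe.2 (.of_forall fun z => ?_))
    simp [coeffAt_apply]
  | inr m => exact map_smul (contr (LinearMap.proj m)) r (f y)

/-- The partial derivatives of superfunctions. -/
def SuperFun.pd (a : CoordIdx p q) : SuperFun q V →ₗ[ℝ] SuperFun q V where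
  toFun f := .mk (SuperGeom.pd a f.fn) (isSmooth_pd a f.isSmooth)
  map_add' f g := SuperFun.ext fun y => congrFun (pd_add a f.isSmooth g.isSmooth) y
  map_smul' r f := SuperFun.ext fun y => congrFun (pd_smul a r f.isSmooth) y

@[simp] theorem fn_pd (a : CoordIdx p q) (f : SuperFun q V) :
    (SuperFun.pd a f).fn = SuperGeom.pd a f.fn := rfl

theorem pd_inl_mul (k : Fin p) (f g : SuperFun q V) (y : V) :
    SuperGeom.pd (Sum.inl k) (f * g).fn y =
      SuperGeom.pd (Sum.inl k) f.fn y * g.fn y + f.fn y * SuperGeom.pd (Sum.inl k) g.fn y := by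
  have hf := f.isSmooth
  have hg := g.isSmooth
  have key : ∀ I, fderiv ℝ (coeffAt (f * g).fn I) y.1 (Pi.single k 1) =
      ∑ J, ∑ K, (fderiv ℝ (coeffAt f.fn J) y.1 (Pi.single k 1) * coeffAt g.fn K y.1 +
        coeffAt f.fn J y.1 * fderiv ℝ (coeffAt g.fn K) y.1 (Pi.single k 1)) *
        (grBasis q).repr (grBasis q J * grBasis q K) I := by
    intro I
    have h : coeffAt (f * g).fn I =ᶠ[𝓝 y.1] fun z =>
        ∑ J, ∑ K, coeffAt f.fn J z * coeffAt g.fn K z *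
          (grBasis q).repr (grBasis q J * grBasis q K) I := by
      refine eventually_coe.2 (.of_forall fun z => ?_)
      simp only [coeffAt_apply, SuperFun.fn_mul, Pi.mul_apply]
      conv_lhs => rw [← (grBasis q).sum_repr (f.fn z), ← (grBasis q).sum_repr (g.fn z)]
      simp only [Finset.sum_mul_sum, map_sum, smul_mul_smul_comm, map_smul, Finsupp.coe_finsetSum,
        Finset.sum_apply, Finsupp.smul_apply, smul_eq_mul]
    have hd : HasFDerivAt (fun z => ∑ J, ∑ K, coeffAt f.fn J z * coeffAt g.fn K z *
          (grBasis q).repr (grBasis q J * grBasis q K) I) (∑ J, ∑ K,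
          (grBasis q).repr (grBasis q J * grBasis q K) I •
          (coeffAt f.fn J y.1 • fderiv ℝ (coeffAt g.fn K) y.1 +
            coeffAt g.fn K y.1 • fderiv ℝ (coeffAt f.fn J) y.1)) y.1 := by
      refine HasFDerivAt.fun_sum fun J _ => HasFDerivAt.fun_sum fun K _ => ?_
      exact ((hf.differentiableAt J y).hasFDerivAt.mul
        (hg.differentiableAt K y).hasFDerivAt).mul_const _
    rw [h.fderiv_eq, hd.fderiv]
    simp only [_root_.sum_apply, _root_.smul_apply,
      _root_.add_apply, smul_eq_mul]
    refine Finset.sum_congr rfl fun J _ => Finset.sum_congr rfl fun K _ => ?_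
    ring
  refine (grBasis q).repr.injective (Finsupp.ext fun I => ?_)
  rw [repr_pd_inl, key]
  simp only [SuperGeom.pd]
  conv_rhs => rw [← (grBasis q).sum_repr (f.fn y), ← (grBasis q).sum_repr (g.fn y)]
  simp only [Finset.sum_mul_sum, map_sum, smul_mul_smul_comm, map_smul, Finsupp.coe_finsetSum,
    Finset.sum_apply, Finsupp.smul_apply, smul_eq_mul, map_add, Finsupp.add_apply,
    ← Finset.sum_add_distrib, coeffAt_apply, add_mul]

theorem pd_mul (a : CoordIdx p q) {ε : ZMod 2} {f : SuperFun q V} (hf : HasParity ε f.fn)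
    (g : SuperFun q V) :
    SuperFun.pd a (f * g) = SuperFun.pd a f * g + sgn (par a * ε) • (f * SuperFun.pd a g) := by
  ext y
  cases a with
  | inl k =>
    change SuperGeom.pd (Sum.inl k) (f * g).fn y = _
    rw [pd_inl_mul]
    simp [par]
  | inr m =>
    refine (contr_mul (LinearMap.proj m) (hf y) (g.fn y)).trans ?_
    simp only [par, Sum.elim_inr, one_mul]
    rfl

theorem pd_const (a : CoordIdx p q) (x : Gr q) (y : V) :
    SuperGeom.pd a (constFun V x).fn y = match a with
      | Sum.inl _ => 0
      | Sum.inr m => contr (LinearMap.proj m) x := by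
  cases a with
  | inl k =>
    refine (grBasis q).repr.injective (Finsupp.ext fun I => ?_)
    rw [repr_pd_inl]
    have : coeffAt (constFun V x).fn I =ᶠ[𝓝 y.1] fun _ => (grBasis q).repr x I :=
      eventually_coe.2 (.of_forall fun z => coeffAt_apply _ I z)
    rw [this.fderiv_eq]
    simp
  | inr m => rfl

theorem pd_one (a : CoordIdx p q) : SuperFun.pd a (1 : SuperFun q V) = 0 := by
  ext y
  have := pd_const a (1 : Gr q) y
  rw [map_one] at this
  refine this.trans ?_
  cases a with
  | inl k => rfl
  | inr m => 
    have := contr_algebraMap (q := q) (LinearMap.proj m) 1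
    rwa [map_one] at this

theorem pd_inl_ofReal (k : Fin p) (r : (Fin p → ℝ) → ℝ) (hr : ContDiffOn ℝ ∞ r V) (y : V) :
    SuperGeom.pd (Sum.inl k) (ofReal r hr : SuperFun q V).fn y =
      algebraMap ℝ (Gr q) (fderiv ℝ r y.1 (Pi.single k 1)) := by
  refine (grBasis q).repr.injective (Finsupp.ext fun I => ?_)
  rw [repr_pd_inl]
  have : coeffAt (ofReal r hr : SuperFun q V).fn I =ᶠ[𝓝 y.1] fun z => r z * (grBasis q).repr 1 I :=
    eventually_coe.2 (.of_forall fun z => by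
      rw [coeffAt_apply, fn_ofReal, Algebra.algebraMap_eq_smul_one, map_smul]; rfl)
  have hd := ((hr.differentiableOn (by simp)).differentiableAt (V.isOpen.mem_nhds y.2))
  rw [this.fderiv_eq, fderiv_mul_const hd, Algebra.algebraMap_eq_smul_one, map_smul,
    Finsupp.smul_apply, _root_.smul_apply, smul_eq_mul, smul_eq_mul, mul_comm]

theorem pd_coordFun (a b : CoordIdx p q) :
    SuperFun.pd a (coordFun V b) = if a = b then 1 else 0 := by
  ext y
  cases b with
  | inl k =>
    have e : coordFun (q := q) V (Sum.inl k) = ofReal (fun y => y k)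
      (contDiff_apply ℝ ℝ k).contDiffOn := rfl
    rw [e]
    cases a with
    | inl l =>
      rw [fn_pd, pd_inl_ofReal]
      have : fderiv ℝ (fun y : Fin p → ℝ => y k) y.1 = ContinuousLinearMap.proj k :=
        (ContinuousLinearMap.proj (R := ℝ) (φ := fun _ : Fin p => ℝ) k).fderiv
      rw [this]
      by_cases h : l = k
      · subst h; simp
      · simp [h]
    | inr m => exact contr_algebraMap _ _
  | inr n =>
    have e : coordFun (q := q) V (Sum.inr n) = constFun V (xi n) := rfl
    rw [e]
    refine (pd_const a (xi n) y).trans ?_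
    cases a with
    | inl l => rfl
    | inr m =>
      refine (contr_iota _ _).trans ?_
      by_cases h : m = n
      · subst h; simp
      · simp [h]

/-! Parity. -/

theorem hasParity_ofReal (r : (Fin p → ℝ) → ℝ) (hr : ContDiffOn ℝ ∞ r V) :
    HasParity 0 (ofReal r hr : SuperFun q V).fn := fun _ => algebraMap_mem_grPart _

theorem hasParity_coordFun (a : CoordIdx p q) : HasParity (par a) (coordFun V a).fn := fun y => by
  cases a with
  | inl k => exact algebraMap_mem_grPart _
  | inr m => exact iota_mem_grPart _

theorem hasParity_pd (a : CoordIdx p q) {ε : ZMod 2} {f : V → Gr q} (hf : HasParity ε f) :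
    HasParity (ε + par a) (SuperGeom.pd a f) := fun y => by
  cases a with
  | inl k =>
    simp only [par, Sum.elim_inl, add_zero]
    refine mem_grPart_iff_repr.2 fun I hI => ?_
    rw [repr_pd_inl]
    have : coeffAt f I =ᶠ[𝓝 y.1] fun _ => 0 := eventually_coe.2 (.of_forall fun z => by
      rw [coeffAt_apply, repr_eq_zero_of_mem_grPart (hf z) hI])
    rw [this.fderiv_eq]
    simp
  | inr m => exact contr_mem_grPart _ (hf y)

theorem superFun_comm {α β : ZMod 2} {f g : SuperFun q V} (hf : HasParity α f.fn)
    (hg : HasParity β g.fn) : f * g = sgn (α * β) • (g * f) :=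
  SuperFun.ext fun y => super_comm (hf y) (hg y)

theorem ofReal_commute (r : (Fin p → ℝ) → ℝ) (hr : ContDiffOn ℝ ∞ r V) (f : SuperFun q V) :
    Commute (ofReal r hr) f := SuperFun.ext fun y => Algebra.commutes (r y.1) (f.fn y)

/-- The projection of the Grassmann algebra to the part of parity `ε`. -/
def grProj (q : ℕ) (ε : ZMod 2) : Gr q →ₗ[ℝ] Gr q :=
  (grPart q ε).subtype ∘ₗ DirectSum.component ℝ _ _ ε ∘ₗ
    (DirectSum.decomposeLinearEquiv (grPart q)).toLinearMap

theorem grProj_mem (ε : ZMod 2) (x : Gr q) : grProj q ε x ∈ grPart q ε :=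
  (DirectSum.decompose (grPart q) x ε).2

theorem grProj_of_mem {ε : ZMod 2} {x : Gr q} (hx : x ∈ grPart q ε) : grProj q ε x = x :=
  DirectSum.decompose_of_mem_same _ hx

theorem grProj_of_mem_ne {α ε : ZMod 2} {x : Gr q} (hx : x ∈ grPart q α) (h : α ≠ ε) :
    grProj q ε x = 0 :=
  DirectSum.decompose_of_mem_ne _ hx h

theorem grProj_add (x : Gr q) : grProj q 0 x + grProj q 1 x = x := by
  obtain ⟨a, ha, b, hb, rfl⟩ := exists_grPart_add x
  simp [map_add, grProj_of_mem ha, grProj_of_mem hb, grProj_of_mem_ne ha, grProj_of_mem_ne hb]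

/-- The component of parity `ε` of a superfunction. -/
def SuperFun.proj (ε : ZMod 2) (f : SuperFun q V) : SuperFun q V :=
  .mk (fun y => grProj q ε (f.fn y)) (f.isSmooth.linear _)

theorem SuperFun.proj_add (f : SuperFun q V) : f.proj 0 + f.proj 1 = f :=
  SuperFun.ext fun _ => grProj_add _

theorem SuperFun.hasParity_proj (ε : ZMod 2) (f : SuperFun q V) : HasParity ε (f.proj ε).fn :=
  fun _ => grProj_mem _ _

/-! Invertible superfunctions. -/

theorem eq_ofReal_body_add (f : SuperFun q V) : ∃ n : SuperFun q V,
    f = ofReal (bodyFun f.fn) (contDiffOn_bodyFun f.isSmooth) + n ∧ ∀ y, body (n.fn y) = 0 := by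
  refine ⟨f - ofReal (bodyFun f.fn) (contDiffOn_bodyFun f.isSmooth), by abel, fun y => ?_⟩
  rw [SuperFun.fn_sub, Pi.sub_apply, fn_ofReal, bodyFun_apply, map_sub, body_algebraMap, sub_self]

theorem pow_eq_zero_of_body_eq_zero {n : SuperFun q V} (hn : ∀ y, body (n.fn y) = 0) :
    n ^ (q + 1) = 0 := SuperFun.ext fun y => by
  rw [SuperFun.fn_pow, pow_eq_zero_of_body (hn y)]; rfl

/-- Invertible real function plus a commuting nilpotent. -/
theorem exists_superFun_inv {f : SuperFun q V} (hf : ∀ y, body (f.fn y) ≠ 0) :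
    ∃ g : SuperFun q V, f * g = 1 ∧ g * f = 1 := by
  obtain ⟨n, hn, hn0⟩ := eq_ofReal_body_add f
  have hr := contDiffOn_bodyFun f.isSmooth
  have hr0 : ∀ y ∈ V, bodyFun f.fn y ≠ 0 := fun y hy => by
    rw [bodyFun_apply f.fn ⟨y, hy⟩]; exact hf _
  have hu : IsUnit (ofReal (bodyFun f.fn) hr : SuperFun q V) :=
    ⟨⟨ofReal _ hr, ofReal _ (hr.inv hr0), SuperFun.ext fun y => by
        rw [SuperFun.fn_mul, Pi.mul_apply, fn_ofReal, fn_ofReal, ← map_mul, Pi.inv_apply,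
          mul_inv_cancel₀ (hr0 _ y.2), map_one]; rfl, SuperFun.ext fun y => by
        rw [SuperFun.fn_mul, Pi.mul_apply, fn_ofReal, fn_ofReal, ← map_mul, Pi.inv_apply,
          inv_mul_cancel₀ (hr0 _ y.2), map_one]; rfl⟩, rfl⟩
  have hN : IsNilpotent n := ⟨q + 1, pow_eq_zero_of_body_eq_zero hn0⟩
  have := hN.isUnit_add_left_of_commute hu (ofReal_commute _ hr n).symm
  have e : ofReal (bodyFun f.fn) hr + n = f := hn.symm
  rw [e] at this
  obtain ⟨u, hu⟩ := this
  exact ⟨↑u⁻¹, by rw [← hu, u.mul_inv], by rw [← hu, u.inv_mul]⟩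

/-- The even superfunctions. -/
def evenSub (q : ℕ) (V : Opens (Fin p → ℝ)) : Subalgebra ℝ (SuperFun q V) where
  carrier := {f | HasParity 0 f.fn}
  mul_mem' hf hg := fun y => (GrEven q).mul_mem (hf y) (hg y)
  add_mem' hf hg := fun y => add_mem (hf y) (hg y)
  algebraMap_mem' r := fun _ => algebraMap_mem_grPart r

instance (V : Opens (Fin p → ℝ)) : CommRing (evenSub q V) :=
  { (inferInstance : Ring (evenSub q V)) with
    mul_comm := fun a _ => Subtype.ext (SuperFun.ext fun y => even_commute (a.2 y) _) }

/-- The even part of an inverse g is already an inverse: f times the odd part of g is odd, and it is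
even because it equals 1 minus f times the even part of g. -/
theorem isUnit_evenSub {f : evenSub q V} (hf : ∀ y, body (f.1.fn y) ≠ 0) : IsUnit f := by
  obtain ⟨g, hg, -⟩ := exists_superFun_inv hf
  refine isUnit_iff_exists_inv.2 ⟨⟨g.proj 0, g.hasParity_proj 0⟩, Subtype.ext ?_⟩
  change f.1 * g.proj 0 = 1
  have h1 : f.1 * g.proj 0 + f.1 * g.proj 1 = 1 := by rw [← mul_add, g.proj_add, hg]
  have h2 : f.1 * g.proj 1 = 0 := by
    refine SuperFun.ext fun y => eq_zero_of_mem_grPart ?_ ?_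
    · rw [eq_sub_of_add_eq' h1]
      exact sub_mem one_mem_grPart (mul_mem_grPart (α := 0) (β := 0) (f.2 y) (g.hasParity_proj 0 y))
    · exact mul_mem_grPart (α := 0) (β := 1) (f.2 y) (g.hasParity_proj 1 y)
  rwa [h2, add_zero] at h1

/-- A map along which the coordinates satisfy the Leibniz rule vanishes if it vanishes on the
coordinates. -/
theorem derivation_eq_zero {y₀ : Fin p → ℝ} (hy₀ : y₀ ∈ V) (E : SuperFun q V →ₐ[ℝ] Gr q)
    (hE : ∀ k, body (E (coordFun V (Sum.inl k))) = y₀ k)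
    (D : SuperFun q V →ₗ[ℝ] Gr q) (s : ℝ)
    (hr : ∀ (r : (Fin p → ℝ) → ℝ) (hr : ContDiffOn ℝ ∞ r V) (f : SuperFun q V),
      D (ofReal r hr * f) = D (ofReal r hr) * E f + E (ofReal r hr) * D f)
    (hξ : ∀ (m : Fin q) (f : SuperFun q V), D (coordFun V (Sum.inr m) * f) =
      D (coordFun V (Sum.inr m)) * E f + s • (E (coordFun V (Sum.inr m)) * D f))
    (h0 : ∀ a, D (coordFun V a) = 0) : D = 0 := by
  have h1 : D 1 = 0 := by
    have := hr (fun _ => 1) contDiffOn_const 1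
    have e : (ofReal (fun _ => 1) contDiffOn_const : SuperFun q V) = 1 :=
      SuperFun.ext fun y => map_one _
    rw [e, mul_one, map_one E, mul_one, one_mul] at this
    exact left_eq_add.1 this
  -- By Hadamard, D(r) = ∑ E(x_k − y₀_k) D(g_k), and E(x_k − y₀_k) has body zero. Each application
  -- therefore gains one degree of the filtration, and degree q + 1 forces D(r) = 0.
  have hreal : ∀ N : ℕ, ∀ (r : (Fin p → ℝ) → ℝ) (hr : ContDiffOn ℝ ∞ r V),
      D (ofReal r hr) ∈ grFil q N := by
    intro N
    induction N with
    | zero => intro r hr; exact mem_grFil_zero _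
    | succ N ih =>
      intro r hr'
      obtain ⟨g, hg, hgr⟩ := exists_hadamard_on V.isOpen hr' hy₀
      have hx : ∀ k : Fin p, ContDiffOn ℝ ∞ (fun y : Fin p → ℝ => y k - y₀ k) V := fun k =>
        ((contDiff_apply ℝ ℝ k).sub contDiff_const).contDiffOn
      have ex : ∀ k, (ofReal _ (hx k) : SuperFun q V) =
          coordFun V (Sum.inl k) - y₀ k • 1 := fun k => SuperFun.ext fun y => by
        rw [fn_ofReal, map_sub]
        simp [coordFun, Algebra.algebraMap_eq_smul_one]
      have e : (ofReal r hr' : SuperFun q V) =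
          r y₀ • 1 + ∑ k, ofReal _ (hx k) * ofReal (g k) (hg k) := SuperFun.ext fun y => by
        rw [SuperFun.fn_add, Pi.add_apply, SuperFun.fn_finset_sum, fn_ofReal, hgr _ y.2]
        simp [Algebra.algebraMap_eq_smul_one, add_smul, Finset.sum_smul, smul_smul, mul_comm]
      have hxF : ∀ k, E (ofReal _ (hx k)) ∈ grFil q 1 := fun k => by
        rw [mem_grFil_one_iff, ex, map_sub, map_sub, hE, ← Algebra.algebraMap_eq_smul_one,
          AlgHom.commutes, body_algebraMap, sub_self]
      rw [e, map_add, map_smul, h1, smul_zero, zero_add, map_sum]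
      refine sum_mem fun k _ => ?_
      rw [hr, show D (ofReal _ (hx k)) = 0 by rw [ex, map_sub, h0, map_smul, h1]; simp, zero_mul,
        zero_add, add_comm N 1]
      exact mul_mem_grFil (hxF k) (ih _ _)
  have hconst : ∀ I, D (constFun V (grBasis q I)) = 0 := by
    intro I
    induction I using Finset.induction_on with
    | empty => rw [grBasis_empty, map_one, h1]
    | insert m I h ih =>
      obtain ⟨s, hs⟩ := grBasis_insert h
      have e : constFun V (xi m) = coordFun V (Sum.inr m) := rfl
      rw [hs, map_smul, map_smul, map_mul, e, hξ, h0, ih]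
      simp
  refine LinearMap.ext fun f => ?_
  rw [f.eq_sum, map_sum]
  refine Finset.sum_eq_zero fun I _ => ?_
  rw [hr, hconst, mul_zero, add_zero, eq_zero_of_mem_grFil (hreal _ _ _), zero_mul]

end SuperFunctions

end SuperGeom

end

noncomputable section

namespace SuperGeom

/-! ### The Berezinian -/

section Berezinian

open Matrix

variable {p q : ℕ} {l m n : Type*} [Fintype l] [Fintype m] [Fintype n]
  [DecidableEq l] [DecidableEq m] [DecidableEq n]

theorem coe_evenPart {x : Gr q} (hx : x ∈ grPart q 0) : (evenPart x : Gr q) = x :=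
  DirectSum.decompose_of_mem_same _ hx

/-- All entries of the matrix are of parity `ε`. -/
def EntryParity (ε : ZMod 2) (M : Matrix m n (Gr q)) : Prop := ∀ i j, M i j ∈ grPart q ε

omit [DecidableEq l] [DecidableEq m] [DecidableEq n] [Fintype l] [Fintype n] in
theorem EntryParity.mul {α β : ZMod 2} {M : Matrix l m (Gr q)} {N : Matrix m n (Gr q)}
    (hM : EntryParity α M) (hN : EntryParity β N) : EntryParity (α + β) (M * N) := fun i j =>
  sum_mem fun k _ => mul_mem_grPart (hM i k) (hN k j)

theorem odd_mul_odd_mem {x y : Gr q} (hx : x ∈ grPart q 1) (hy : y ∈ grPart q 1) :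
    x * y ∈ grPart q 0 := by
  have := mul_mem_grPart hx hy
  rwa [zmod2_one_add_one] at this

omit [DecidableEq l] [DecidableEq m] [DecidableEq n] [Fintype l] [Fintype n] in
theorem EntryParity.odd_mul {M : Matrix l m (Gr q)} {N : Matrix m n (Gr q)}
    (hM : EntryParity 1 M) (hN : EntryParity 1 N) : EntryParity 0 (M * N) := by
  have := hM.mul hN
  rwa [zmod2_one_add_one] at this

omit [DecidableEq l] [DecidableEq m] [DecidableEq n] [Fintype l] [Fintype n] in
theorem EntryParity.odd_mul_even {M : Matrix l m (Gr q)} {N : Matrix m n (Gr q)}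
    (hM : EntryParity 1 M) (hN : EntryParity 0 N) : EntryParity 1 (M * N) := by
  have := hM.mul hN
  rwa [add_zero] at this

omit [DecidableEq l] [DecidableEq m] [DecidableEq n] [Fintype l] [Fintype n] in
theorem EntryParity.even_mul {ε : ZMod 2} {M : Matrix l m (Gr q)} {N : Matrix m n (Gr q)}
    (hM : EntryParity 0 M) (hN : EntryParity ε N) : EntryParity ε (M * N) := by
  have := hM.mul hN
  rwa [zero_add] at this

omit [DecidableEq m] [DecidableEq n] [Fintype m] [Fintype n] in
theorem EntryParity.add {α : ZMod 2} {M N : Matrix m n (Gr q)}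
    (hM : EntryParity α M) (hN : EntryParity α N) : EntryParity α (M + N) := fun i j =>
  add_mem (hM i j) (hN i j)

omit [DecidableEq m] [DecidableEq n] [Fintype m] [Fintype n] in
theorem EntryParity.sub {α : ZMod 2} {M N : Matrix m n (Gr q)}
    (hM : EntryParity α M) (hN : EntryParity α N) : EntryParity α (M - N) := fun i j =>
  sub_mem (hM i j) (hN i j)

omit [Fintype n] in
theorem entryParity_one : EntryParity 0 (1 : Matrix n n (Gr q)) := fun i j => by
  rw [Matrix.one_apply]; split_ifs
  · exact one_mem_grPart
  · exact zero_mem _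

omit [Fintype m] [Fintype n] [DecidableEq m] [DecidableEq n] in
theorem entryParity_coe (M : Matrix m n (GrEven q)) :
    EntryParity 0 (M.map Subtype.val : Matrix m n (Gr q)) := fun i j => (M i j).2

/-- The even part of a matrix. -/
def lift (M : Matrix m n (Gr q)) : Matrix m n (GrEven q) := M.map evenPart

/-- The inclusion of the matrices with even entries. -/
def unlift (M : Matrix m n (GrEven q)) : Matrix m n (Gr q) := M.map Subtype.val

omit [Fintype m] [Fintype n] [DecidableEq m] [DecidableEq n] in
theorem unlift_lift {M : Matrix m n (Gr q)} (hM : EntryParity 0 M) : unlift (lift M) = M := by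
  ext i j; exact coe_evenPart (hM i j)

omit [Fintype m] [Fintype n] [DecidableEq m] [DecidableEq n] in
theorem unlift_injective : Function.Injective (unlift : Matrix m n (GrEven q) → _) := by
  intro M N h
  ext i j
  exact congrFun (congrFun h i) j

omit [Fintype m] [Fintype n] [DecidableEq m] [DecidableEq n] in
theorem lift_unlift (M : Matrix m n (GrEven q)) : lift (unlift M) = M := by
  ext i j; exact coe_evenPart (M i j).2

omit [DecidableEq l] [DecidableEq m] [DecidableEq n] [Fintype l] [Fintype n] in
theorem unlift_mul (M : Matrix l m (GrEven q)) (N : Matrix m n (GrEven q)) :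
    unlift (M * N) = unlift M * unlift N := by
  ext i j
  simp [unlift, Matrix.mul_apply]

omit [Fintype n] in
theorem unlift_one : unlift (1 : Matrix n n (GrEven q)) = 1 := by
  ext i j
  simp only [unlift, Matrix.map_apply, Matrix.one_apply]
  split_ifs <;> rfl

omit [DecidableEq l] [DecidableEq m] [DecidableEq n] [Fintype l] [Fintype n] in
theorem lift_mul {M : Matrix l m (Gr q)} {N : Matrix m n (Gr q)}
    (hM : EntryParity 0 M) (hN : EntryParity 0 N) : lift (M * N) = lift M * lift N := by
  apply unlift_injective
  rw [unlift_mul, unlift_lift hM, unlift_lift hN, unlift_lift (by simpa using hM.mul hN)]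

omit [Fintype n] in
theorem lift_one : lift (1 : Matrix n n (Gr q)) = 1 := by
  rw [← unlift_one, lift_unlift]

/-- The determinant of a matrix with even entries. -/
def edet (M : Matrix n n (Gr q)) : GrEven q := (lift M).det

theorem edet_mul {M N : Matrix n n (Gr q)} (hM : EntryParity 0 M) (hN : EntryParity 0 N) :
    edet (M * N) = edet M * edet N := by
  rw [edet, lift_mul hM hN, Matrix.det_mul]; rfl

theorem edet_one : edet (1 : Matrix n n (Gr q)) = 1 := by
  rw [edet, lift_one, Matrix.det_one]

theorem exists_even_inv {M : Matrix n n (Gr q)} (hM : EntryParity 0 M) (h : IsUnit (edet M)) :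
    ∃ N, EntryParity 0 N ∧ M * N = 1 ∧ N * M = 1 := by
  refine ⟨unlift (lift M)⁻¹, entryParity_coe _, ?_, ?_⟩
  · nth_rewrite 1 [← unlift_lift hM]
    rw [← unlift_mul, Matrix.mul_nonsing_inv _ h, unlift_one]
  · nth_rewrite 2 [← unlift_lift hM]
    rw [← unlift_mul, Matrix.nonsing_inv_mul _ h, unlift_one]

theorem mul_eq_one_comm_of_even {M N : Matrix n n (Gr q)} (hM : EntryParity 0 M)
    (hN : EntryParity 0 N) (h : N * M = 1) : M * N = 1 := by
  have h1 : lift N * lift M = 1 := by rw [← lift_mul hN hM, h, lift_one]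
  rw [← unlift_lift hM, ← unlift_lift hN, ← unlift_mul, mul_eq_one_comm.1 h1, unlift_one]

/-- Both matrices are rank-one perturbations of 1, with determinants 1 + εF_ji and 1 + F_ji ε = 1 −
εF_ji. Their product is 1 because (εF_ji)² = 0. -/
theorem edet_one_add_single {i : m} {j : n} {ε : Gr q} (hε : ε ∈ grPart q 1) {F : Matrix n m (Gr q)}
    (hF : EntryParity 1 F) :
    edet (1 + Matrix.single i j ε * F) * edet (1 + F * Matrix.single i j ε) = 1 := by
  have h1 : lift (1 + Matrix.single i j ε * F) =
      1 + replicateCol Unit (Pi.single i 1 : m → GrEven q) * replicateRow Unit fun k => evenPart (ε * F j k) := by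
    apply unlift_injective
    rw [unlift_lift (entryParity_one.add fun a b => by
      by_cases h : i = a
      · subst h
        rw [Matrix.single_mul_apply_same]; exact odd_mul_odd_mem hε (hF _ _)
      · rw [Matrix.single_mul_apply_of_ne (h := Ne.symm h)]; exact zero_mem _)]
    ext a b
    simp only [unlift, Matrix.map_apply, Matrix.add_apply, AddMemClass.coe_add, Matrix.one_apply,
      Matrix.mul_apply, Finset.univ_unique, Finset.sum_singleton, replicateCol_apply,
      replicateRow_apply, Subalgebra.coe_mul]
    congr 1
    · split_ifs <;> rfl
    · rw [← Matrix.mul_apply, coe_evenPart (odd_mul_odd_mem hε (hF _ _))]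
      by_cases h : i = a
      · subst h
        rw [Matrix.single_mul_apply_same, Pi.single_eq_same]; exact (one_mul _).symm
      · rw [Matrix.single_mul_apply_of_ne (h := Ne.symm h), Pi.single_eq_of_ne (Ne.symm h)]
        exact (zero_mul _).symm
  have h2 : lift (1 + F * Matrix.single i j ε) =
      1 + replicateCol Unit (fun k => evenPart (F k i * ε)) * replicateRow Unit (Pi.single j 1 : n → GrEven q) := by
    apply unlift_injective
    rw [unlift_lift (entryParity_one.add fun a b => by
      by_cases h : j = b
      · subst h
        rw [Matrix.mul_single_apply_same]; exact odd_mul_odd_mem (hF _ _) hε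
      · rw [Matrix.mul_single_apply_of_ne (hbj := Ne.symm h)]; exact zero_mem _)]
    ext a b
    simp only [unlift, Matrix.map_apply, Matrix.add_apply, AddMemClass.coe_add, Matrix.one_apply,
      Matrix.mul_apply, Finset.univ_unique, Finset.sum_singleton, replicateCol_apply,
      replicateRow_apply, Subalgebra.coe_mul]
    congr 1
    · split_ifs <;> rfl
    · rw [← Matrix.mul_apply, coe_evenPart (odd_mul_odd_mem (hF _ _) hε)]
      by_cases h : j = b
      · subst h
        rw [Matrix.mul_single_apply_same, Pi.single_eq_same]; exact (mul_one _).symm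
      · rw [Matrix.mul_single_apply_of_ne (hbj := Ne.symm h), Pi.single_eq_of_ne (Ne.symm h)]
        exact (mul_zero _).symm
  change (lift _).det * (lift _).det = 1
  rw [h1, h2, det_one_add_replicateCol_mul_replicateRow,
    det_one_add_replicateCol_mul_replicateRow, dotProduct_single_one, single_one_dotProduct]
  apply Subtype.ext
  rw [Subalgebra.coe_mul, AddMemClass.coe_add, AddMemClass.coe_add,
    coe_evenPart (odd_mul_odd_mem (hF _ _) hε),
    coe_evenPart (odd_mul_odd_mem hε (hF _ _)), odd_mul_odd (hF j i) hε]
  have h0 : ε * F j i * (ε * F j i) = 0 := by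
    rw [mul_assoc, ← mul_assoc (F j i), odd_mul_odd (hF j i) hε, neg_mul, mul_neg, mul_assoc ε,
      odd_mul_self (hF j i), mul_zero, mul_zero, neg_zero]
  change (1 + ε * F j i) * (1 + -(ε * F j i)) = 1
  rw [mul_add, add_mul, mul_neg, add_mul, h0]
  simp

/-- The odd analogue of det(1 + EF) = det(1 + FE): anticommuting entries invert one side. It holds
for E with a single nonzero entry, and the set of such E is closed under addition. -/
theorem edet_one_add_mul_edet_one_add {E : Matrix m n (Gr q)} (hE : EntryParity 1 E) :
    ∀ {F : Matrix n m (Gr q)}, EntryParity 1 F → edet (1 + E * F) * edet (1 + F * E) = 1 := by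
  let P : Matrix m n (Gr q) → Prop := fun E => EntryParity 1 E ∧
    ∀ F : Matrix n m (Gr q), EntryParity 1 F → edet (1 + E * F) * edet (1 + F * E) = 1
  have hadd : ∀ E₁ E₂, P E₁ → P E₂ → P (E₁ + E₂) := by
    rintro E₁ E₂ ⟨h₁, H₁⟩ ⟨h₂, H₂⟩
    refine ⟨h₁.add h₂, fun F hF => ?_⟩
    have e11 : EntryParity 0 (1 + E₁ * F) := entryParity_one.add (h₁.odd_mul hF)
    obtain ⟨H, hH, -, hH2⟩ := exists_even_inv e11 (.of_mul_eq_one _ (H₁ F hF))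
    have hFH : EntryParity 1 (F * H) := hF.odd_mul_even hH
    -- With H the inverse of 1 + E₁F, both determinants split into a factor for (E₁, F) and a factor
    -- for (E₂, FH).
    have i1 : 1 + (E₁ + E₂) * F = (1 + E₂ * (F * H)) * (1 + E₁ * F) := by
      rw [Matrix.add_mul 1, Matrix.mul_assoc E₂, Matrix.mul_assoc F, hH2, Matrix.mul_one,
        Matrix.one_mul, Matrix.add_mul, add_assoc]
    have i2 : 1 + F * (E₁ + E₂) = (1 + F * E₁) * (1 + F * H * E₂) := by
      have : (1 + F * E₁) * (F * H) = F := by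
        rw [← Matrix.mul_assoc, Matrix.add_mul, Matrix.one_mul, Matrix.mul_assoc F E₁ F]
        nth_rewrite 1 [← Matrix.mul_one F]
        rw [← Matrix.mul_add, Matrix.mul_assoc, mul_eq_one_comm_of_even e11 hH hH2, Matrix.mul_one]
      rw [Matrix.mul_add (1 + F * E₁) 1, ← Matrix.mul_assoc, this, Matrix.mul_one, Matrix.mul_add,
        add_assoc]
    rw [i1, i2, edet_mul (entryParity_one.add (h₂.odd_mul hFH)) e11,
      edet_mul (entryParity_one.add (hF.odd_mul h₁)) (entryParity_one.add (hFH.odd_mul h₂))]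
    calc _ = (edet (1 + E₁ * F) * edet (1 + F * E₁)) *
          (edet (1 + E₂ * (F * H)) * edet (1 + F * H * E₂)) := by ring
      _ = 1 := by rw [H₁ F hF, H₂ _ hFH, one_mul]
  have hzero : P 0 := ⟨fun _ _ => zero_mem _, fun F _ => by simp [edet_one]⟩
  have : P E := by
    rw [Matrix.matrix_eq_sum_single E]
    refine Finset.sum_induction _ P hadd hzero fun i _ => Finset.sum_induction _ P hadd hzero
      fun j _ => ⟨fun a b => ?_, fun F hF => edet_one_add_single (hE i j) hF⟩
    rw [Matrix.single_apply]
    split_ifs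
    · exact hE i j
    · exact zero_mem _
  exact fun {F} hF => this.2 F hF

/-- The matrix is even as a supermatrix. -/
def IsEvenSupermatrix (J : Matrix (CoordIdx p q) (CoordIdx p q) (Gr q)) : Prop :=
  ∀ a b, J a b ∈ grPart q (par a + par b)

/-- Allows any explicit inverse D' to stand for the nonsingular inverse and `Ring.inverse` of the
definition. -/
theorem berezinian_eq (J : Matrix (CoordIdx p q) (CoordIdx p q) (Gr q))
    {D' : Matrix (Fin q) (Fin q) (GrEven q)} (h : lift J.toBlocks₂₂ * D' = 1) :
    berezinian J = edet (J.toBlocks₁₁ - J.toBlocks₁₂ * unlift D' * J.toBlocks₂₁) * D'.det := by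
  have h1 : (lift J.toBlocks₂₂)⁻¹ = D' := Matrix.inv_eq_right_inv h
  have h2 : Ring.inverse (lift J.toBlocks₂₂).det = D'.det := by
    rw [← h1, Matrix.det_nonsing_inv]
  rw [← h2, ← h1]
  rfl

theorem toBlocks_mul (X Y : Matrix (CoordIdx p q) (CoordIdx p q) (Gr q)) :
    (X * Y).toBlocks₁₁ = X.toBlocks₁₁ * Y.toBlocks₁₁ + X.toBlocks₁₂ * Y.toBlocks₂₁ ∧
    (X * Y).toBlocks₁₂ = X.toBlocks₁₁ * Y.toBlocks₁₂ + X.toBlocks₁₂ * Y.toBlocks₂₂ ∧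
    (X * Y).toBlocks₂₁ = X.toBlocks₂₁ * Y.toBlocks₁₁ + X.toBlocks₂₂ * Y.toBlocks₂₁ ∧
    (X * Y).toBlocks₂₂ = X.toBlocks₂₁ * Y.toBlocks₁₂ + X.toBlocks₂₂ * Y.toBlocks₂₂ := by
  refine ⟨?_, ?_, ?_, ?_⟩ <;>
  · ext i j
    simp [Matrix.mul_apply, Fintype.sum_sum_type, toBlocks₁₁, toBlocks₁₂, toBlocks₂₁, toBlocks₂₂]

/-- The Schur complement of a product of block matrices. -/
theorem schur_mul {R m n : Type*} [Ring R] [Fintype m] [Fintype n] [DecidableEq m] [DecidableEq n]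
    {A A₁ : Matrix m m R} {B B₁ : Matrix m n R} {C C₁ : Matrix n m R}
    {D D₁ D' D₁' D₂' : Matrix n n R} (h1 : D * D' = 1) (h2 : D' * D = 1) (h4 : D₁' * D₁ = 1)
    (h3 : D₁ * D₁' = 1) (h5 : D₂' * (C * B₁ + D * D₁) = 1) (h6 : (C * B₁ + D * D₁) * D₂' = 1) :
    A * A₁ + B * C₁ - (A * B₁ + B * D₁) * D₂' * (C * A₁ + D * C₁) =
      (A - B * D' * C) * (1 - (B₁ * D₁') * (D₁ * D₂' * D) * (D' * C)) * (A₁ - B₁ * D₁' * C₁) := by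
  obtain ⟨K, hK⟩ : ∃ K, K = A - B * D' * C := ⟨_, rfl⟩
  obtain ⟨K₁, hK₁⟩ : ∃ K₁, K₁ = A₁ - B₁ * D₁' * C₁ := ⟨_, rfl⟩
  obtain ⟨F, hF⟩ : ∃ F, F = D' * C := ⟨_, rfl⟩
  obtain ⟨E, hE⟩ : ∃ E, E = B₁ * D₁' := ⟨_, rfl⟩
  obtain ⟨D₂, hD₂⟩ : ∃ D₂, D₂ = C * B₁ + D * D₁ := ⟨_, rfl⟩
  -- Block elimination: in terms of the Schur complements K, K₁ and of F = D⁻¹C, E = B₁D₁⁻¹, all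
  -- terms not of the form K(…)K₁ cancel.
  have eA : A = K + B * F := by rw [hK, hF, Matrix.mul_assoc, sub_add_cancel]
  have eC : C = D * F := by rw [hF, ← Matrix.mul_assoc, h1, Matrix.one_mul]
  have eB : B₁ = E * D₁ := by rw [hE, Matrix.mul_assoc, h4, Matrix.mul_one]
  have eA₁ : A₁ = K₁ + E * C₁ := by rw [hK₁, hE, sub_add_cancel]
  have eD : D' * D₂ = F * B₁ + D₁ := by
    rw [hD₂, Matrix.mul_add, ← Matrix.mul_assoc, ← Matrix.mul_assoc, h2, Matrix.one_mul, hF]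
  have eD2 : D₂ * D₁' = C * E + D := by
    rw [hD₂, Matrix.add_mul, Matrix.mul_assoc, Matrix.mul_assoc, h3, Matrix.mul_one, hE]
  have e1 : A * B₁ + B * D₁ = K * B₁ + B * D' * D₂ := by
    rw [eA, Matrix.mul_assoc B, eD, Matrix.add_mul, Matrix.mul_add, add_assoc, Matrix.mul_assoc]
  have e2 : C * A₁ + D * C₁ = C * K₁ + D₂ * D₁' * C₁ := by
    rw [eA₁, eD2, Matrix.add_mul, Matrix.mul_add, add_assoc, Matrix.mul_assoc]
  rw [← hD₂] at h5 h6
  have e3 : (A * B₁ + B * D₁) * D₂' * (C * A₁ + D * C₁) =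
      K * B₁ * D₂' * C * K₁ + K * (B₁ * D₁') * C₁ + B * D' * C * K₁ + B * (D' * D₂) * D₁' * C₁ := by
    have h7 : B * D' * D₂ * D₂' = B * D' := by rw [Matrix.mul_assoc _ D₂, h6, Matrix.mul_one]
    have h8 : K * B₁ * D₂' * (D₂ * D₁' * C₁) = K * (B₁ * D₁') * C₁ := by
      simp only [Matrix.mul_assoc]
      rw [← Matrix.mul_assoc D₂' D₂, h5, Matrix.one_mul]
    rw [e1, e2, Matrix.add_mul, h7, Matrix.mul_add, Matrix.add_mul, Matrix.add_mul, h8]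
    simp only [Matrix.mul_assoc, add_assoc]
    abel
  have e4 : A * A₁ + B * C₁ = K * K₁ + K * E * C₁ + B * F * K₁ + B * F * E * C₁ + B * C₁ := by
    rw [eA, eA₁, Matrix.add_mul, Matrix.mul_add, Matrix.mul_add]
    simp only [Matrix.mul_assoc]
    abel
  have e5 : B * (D' * D₂) * D₁' * C₁ = B * F * E * C₁ + B * C₁ := by
    rw [eD, Matrix.mul_assoc B, Matrix.add_mul, h3, Matrix.mul_assoc F, ← hE, Matrix.mul_add,
      Matrix.add_mul, Matrix.mul_one]
    simp only [Matrix.mul_assoc]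
  have e6 : E * (D₁ * D₂' * D) * F = B₁ * D₂' * C := by
    rw [eC, eB]
    simp only [Matrix.mul_assoc]
  rw [e3, e4, e5, ← hK, ← hK₁, ← hF, ← hE, e6, Matrix.mul_sub, Matrix.sub_mul, Matrix.mul_one,
    Matrix.mul_assoc B D' C, ← hF]
  simp only [Matrix.mul_assoc]
  abel

/-- Let E = B₁D₁⁻¹, F = D⁻¹C and G = (1 + FE)⁻¹. The Schur complement of the product is K(1 − EGF)K₁
with 1 − EGF = (1 + EF)⁻¹, and the inverse of its lower block is D₁⁻¹GD⁻¹. So the two sides differ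
by the factor det(1 − EGF) det G, which is 1 by the odd determinant identity. -/
theorem berezinian_mul {X Y : Matrix (CoordIdx p q) (CoordIdx p q) (Gr q)}
    (hX : IsEvenSupermatrix X) (hY : IsEvenSupermatrix Y) (uX : IsUnit (edet X.toBlocks₂₂))
    (uY : IsUnit (edet Y.toBlocks₂₂)) (uXY : IsUnit (edet (X * Y).toBlocks₂₂)) :
    berezinian (X * Y) = berezinian X * berezinian Y := by
  have x11 : EntryParity 0 X.toBlocks₁₁ := fun i j => hX (Sum.inl i) (Sum.inl j)
  have x12 : EntryParity 1 X.toBlocks₁₂ := fun i j => hX (Sum.inl i) (Sum.inr j)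
  have x21 : EntryParity 1 X.toBlocks₂₁ := fun i j => hX (Sum.inr i) (Sum.inl j)
  have x22 : EntryParity 0 X.toBlocks₂₂ := fun i j => hX (Sum.inr i) (Sum.inr j)
  have y11 : EntryParity 0 Y.toBlocks₁₁ := fun i j => hY (Sum.inl i) (Sum.inl j)
  have y12 : EntryParity 1 Y.toBlocks₁₂ := fun i j => hY (Sum.inl i) (Sum.inr j)
  have y21 : EntryParity 1 Y.toBlocks₂₁ := fun i j => hY (Sum.inr i) (Sum.inl j)
  have y22 : EntryParity 0 Y.toBlocks₂₂ := fun i j => hY (Sum.inr i) (Sum.inr j)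
  obtain ⟨h11, h12, h21, h22⟩ := toBlocks_mul X Y
  have z22 : EntryParity 0 (X * Y).toBlocks₂₂ := by
    rw [h22]; exact (x21.odd_mul y12).add (x22.even_mul y22)
  obtain ⟨D', hD', d1, d2⟩ := exists_even_inv x22 uX
  obtain ⟨D₁', hD₁', d3, d4⟩ := exists_even_inv y22 uY
  obtain ⟨D₂', hD₂', d5, d6⟩ := exists_even_inv z22 uXY
  have lift_inv : ∀ {M N : Matrix (Fin q) (Fin q) (Gr q)}, EntryParity 0 M → EntryParity 0 N →
      M * N = 1 → lift M * lift N = 1 := fun hM hN h => by rw [← lift_mul hM hN, h, lift_one]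
  rw [berezinian_eq X (lift_inv x22 hD' d1), berezinian_eq Y (lift_inv y22 hD₁' d3),
    berezinian_eq _ (lift_inv z22 hD₂' d5), unlift_lift hD', unlift_lift hD₁', unlift_lift hD₂',
    h11, h12, h21]
  rw [h22] at d5 d6
  rw [schur_mul d1 d2 d4 d3 d6 d5]
  set E := Y.toBlocks₁₂ * D₁' with hE
  set F := D' * X.toBlocks₂₁ with hF
  set G := Y.toBlocks₂₂ * D₂' * X.toBlocks₂₂ with hG
  have pE : EntryParity 1 E := y12.odd_mul_even hD₁'
  have pF : EntryParity 1 F := hD'.even_mul x21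
  have pG : EntryParity 0 G := (y22.even_mul hD₂').even_mul x22
  have pFE : EntryParity 0 (1 + F * E) := entryParity_one.add (pF.odd_mul pE)
  have hFE : 1 + F * E = D' * (X.toBlocks₂₁ * Y.toBlocks₁₂ + X.toBlocks₂₂ * Y.toBlocks₂₂) * D₁' := by
    rw [Matrix.mul_add, ← Matrix.mul_assoc D' X.toBlocks₂₂, d2, Matrix.one_mul, Matrix.add_mul, d3,
      hF, hE, add_comm]
    simp only [Matrix.mul_assoc]
  have g1 : (1 + F * E) * G = 1 := by
    rw [hFE, hG]
    calc _ = D' * (X.toBlocks₂₁ * Y.toBlocks₁₂ + X.toBlocks₂₂ * Y.toBlocks₂₂) *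
          (D₁' * Y.toBlocks₂₂) * D₂' * X.toBlocks₂₂ := by simp only [Matrix.mul_assoc]
      _ = 1 := by
        rw [d4, Matrix.mul_one, Matrix.mul_assoc D', d5, Matrix.mul_one, d2]
  have hD2 : D₂' = D₁' * G * D' := by
    rw [hG]
    calc D₂' = (D₁' * Y.toBlocks₂₂) * D₂' * (X.toBlocks₂₂ * D') := by
          rw [d4, d1, Matrix.one_mul, Matrix.mul_one]
      _ = _ := by simp only [Matrix.mul_assoc]
  have hEGF : (1 - E * G * F) * (1 + E * F) = 1 := by
    have : E * G * F * (1 + E * F) = E * F := by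
      have h : F * (1 + E * F) = (1 + F * E) * F := by
        rw [Matrix.mul_add, Matrix.add_mul, Matrix.mul_one, Matrix.one_mul, ← Matrix.mul_assoc F E F]
      have g2 := mul_eq_one_comm_of_even pG pFE g1
      calc E * G * F * (1 + E * F) = E * (G * (F * (1 + E * F))) := by simp only [Matrix.mul_assoc]
        _ = E * F := by rw [h, ← Matrix.mul_assoc G, g2, Matrix.one_mul]
    rw [Matrix.sub_mul, this, Matrix.one_mul, add_sub_cancel_right]
  have p1 : EntryParity 0 (1 - E * G * F) := entryParity_one.sub ((pE.odd_mul_even pG).odd_mul pF)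
  have pEF : EntryParity 0 (1 + E * F) := entryParity_one.add (pE.odd_mul pF)
  have k1 := edet_one_add_mul_edet_one_add pE pF
  have k2 : edet (1 - E * G * F) * edet (1 + E * F) = 1 := by rw [← edet_mul p1 pEF, hEGF, edet_one]
  have k3 : edet (1 + F * E) * edet G = 1 := by rw [← edet_mul pFE pG, g1, edet_one]
  have k4 : edet (1 - E * G * F) * edet G = 1 := by
    calc _ = edet (1 - E * G * F) * edet G * (edet (1 + E * F) * edet (1 + F * E)) := by
          rw [k1, mul_one]
      _ = (edet (1 - E * G * F) * edet (1 + E * F)) * (edet (1 + F * E) * edet G) := by ring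
      _ = 1 := by rw [k2, k3, mul_one]
  have pK : EntryParity 0 (X.toBlocks₁₁ - X.toBlocks₁₂ * D' * X.toBlocks₂₁) :=
    x11.sub ((x12.odd_mul_even hD').odd_mul x21)
  have pK₁ : EntryParity 0 (Y.toBlocks₁₁ - E * Y.toBlocks₂₁) :=
    y11.sub (pE.odd_mul y21)
  rw [edet_mul (pK.even_mul p1) pK₁, edet_mul pK p1, hD2, ← edet, ← edet, ← edet,
    edet_mul (hD₁'.even_mul pG) hD', edet_mul hD₁' pG]
  linear_combination (edet (X.toBlocks₁₁ - X.toBlocks₁₂ * D' * X.toBlocks₂₁) *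
    edet (Y.toBlocks₁₁ - E * Y.toBlocks₂₁) * edet D₁' * edet D') * k4

end Berezinian

/-! ### Real powers -/

section Powers

open Filter Topology

variable {p q : ℕ}

/-- The coefficients of `f` are polynomials. -/
def IsPoly (f : ℝ → Gr q) : Prop :=
  ∀ I, ∃ P : Polynomial ℝ, ∀ w, (grBasis q).repr (f w) I = P.eval w

theorem IsPoly.add {f g : ℝ → Gr q} (hf : IsPoly f) (hg : IsPoly g) : IsPoly fun w => f w + g w :=
  fun I => by
    obtain ⟨P, hP⟩ := hf I
    obtain ⟨Q, hQ⟩ := hg I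
    exact ⟨P + Q, fun w => by simp [hP, hQ]⟩

theorem isPoly_const (x : Gr q) : IsPoly fun _ => x := fun I =>
  ⟨Polynomial.C ((grBasis q).repr x I), fun w => by simp⟩

theorem IsPoly.sum {ι : Type*} {s : Finset ι} {f : ι → ℝ → Gr q} (hf : ∀ i ∈ s, IsPoly (f i)) :
    IsPoly fun w => ∑ i ∈ s, f i w := by
  classical
  induction s using Finset.induction_on with
  | empty => simpa using isPoly_const (0 : Gr q)
  | insert a s ha ih =>
    simp only [Finset.sum_insert ha]
    exact (hf a (by simp)).add (ih fun i hi => hf i (by simp [hi]))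

theorem IsPoly.smul {f : ℝ → Gr q} (hf : IsPoly f) (P : Polynomial ℝ) :
    IsPoly fun w => P.eval w • f w := fun I => by
  obtain ⟨Q, hQ⟩ := hf I
  exact ⟨P * Q, fun w => by simp [hQ]⟩

theorem IsPoly.linear {f : ℝ → Gr q} (hf : IsPoly f) (L : Gr q →ₗ[ℝ] Gr q) :
    IsPoly fun w => L (f w) := fun I => by
  choose P hP using hf
  refine ⟨∑ J, P J * Polynomial.C ((grBasis q).repr (L (grBasis q J)) I), fun w => ?_⟩
  change (grBasis q).repr (L (f w)) I = _
  conv_lhs => rw [← (grBasis q).sum_repr (f w)]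
  simp [map_sum, Polynomial.eval_finsetSum, hP, Finsupp.coe_finsetSum]

theorem IsPoly.mul {f g : ℝ → Gr q} (hf : IsPoly f) (hg : IsPoly g) : IsPoly fun w => f w * g w := by
  choose P hP using hf
  have : (fun w => f w * g w) = fun w => ∑ J, (P J).eval w • (LinearMap.mulLeft ℝ (grBasis q J) (g w)) := by
    funext w
    conv_lhs => rw [← (grBasis q).sum_repr (f w)]
    simp [Finset.sum_mul, hP]
  rw [this]
  exact IsPoly.sum fun J _ => (hg.linear _).smul _

theorem IsPoly.eq_zero {f : ℝ → Gr q} (hf : IsPoly f) (h : ∀ n : ℕ, f n = 0) (w : ℝ) : f w = 0 := by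
  refine (grBasis q).repr.injective (Finsupp.ext fun I => ?_)
  obtain ⟨P, hP⟩ := hf I
  have : P = 0 := by
    refine P.eq_zero_of_infinite_isRoot (Set.Infinite.mono ?_
      (Set.infinite_range_of_injective (Nat.cast_injective (R := ℝ))))
    rintro _ ⟨n, rfl⟩
    change P.eval (n : ℝ) = 0
    rw [← hP, h]; simp
  rw [hP, this]; simp

theorem IsPoly.eq {f g : ℝ → Gr q} (hf : IsPoly f) (hg : IsPoly g) (h : ∀ n : ℕ, f n = g n) (w : ℝ) :
    f w = g w := by
  have h1 : IsPoly fun w => f w + (-1 : ℝ) • g w :=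
    hf.add (by simpa using hg.smul (Polynomial.C (-1)))
  have := h1.eq_zero (fun n => by rw [h, neg_one_smul, add_neg_cancel]) w
  rwa [neg_one_smul, ← sub_eq_add_neg, sub_eq_zero] at this

theorem exists_poly_choose (k : ℕ) : ∃ P : Polynomial ℝ, ∀ w : ℝ, Ring.choose w k = P.eval w := by
  refine ⟨Polynomial.C ((k.factorial : ℝ)⁻¹) * (descPochhammer ℤ k).map (Int.castRingHom ℝ), fun w => ?_⟩
  have h := Ring.descPochhammer_eq_factorial_smul_choose w k
  rw [Polynomial.eval_mul, Polynomial.eval_C, Polynomial.eval_map, eq_inv_mul_iff_mul_eq₀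
    (Nat.cast_ne_zero.2 k.factorial_ne_zero), ← nsmul_eq_mul, ← h,
    ← Polynomial.eval₂_smulOneHom_eq_smeval]
  congr 1
  exact RingHom.ext_int _ _

theorem isPoly_choose_smul (k : ℕ) (x : Gr q) : IsPoly fun w => Ring.choose w k • x := by
  obtain ⟨P, hP⟩ := exists_poly_choose k
  simp only [hP]
  exact (isPoly_const x).smul P

theorem body_normalized {a : Gr q} (hb : body a ≠ 0) : body ((body a)⁻¹ • a - 1) = 0 := by
  rw [map_sub, map_smul, map_one, smul_eq_mul, inv_mul_cancel₀ hb, sub_self]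

/-- The range q + 2 is one longer than nilpotency requires, so that the terms k = 0 and k = 1 are
present even for q = 0; `grPow_one` splits them off. -/
theorem grPow_eq {a : Gr q} (hb : body a ≠ 0) (w : ℝ) : grPow a w =
    body a ^ w • ∑ k ∈ Finset.range (q + 2), Ring.choose w k • ((body a)⁻¹ • a - 1) ^ k := by
  rw [grPow, finsum_choose_eq (N := q + 2)]
  rw [pow_succ, pow_eq_zero_of_body (body_normalized hb), zero_mul]

theorem isPoly_choose_sum (n : Gr q) (N : ℕ) :
    IsPoly fun w => ∑ k ∈ Finset.range N, Ring.choose w k • n ^ k :=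
  IsPoly.sum fun k _ => isPoly_choose_smul k _

theorem grPow_one {a : Gr q} (hb : body a ≠ 0) : grPow a 1 = a := by
  rw [grPow_eq hb, Finset.sum_range_succ', Finset.sum_range_succ', Finset.sum_eq_zero]
  · rw [Real.rpow_one]
    simp only [Ring.choose_zero_right, zero_add, Ring.choose_one_right, pow_one, pow_zero, one_smul,
      sub_add_cancel, smul_smul, mul_inv_cancel₀ hb]
  · intro k _
    have : Ring.choose (1 : ℝ) (k + 1 + 1) = 0 := by
      have h := Ring.choose_natCast (R := ℝ) 1 (k + 1 + 1)
      rw [Nat.cast_one, Nat.choose_eq_zero_of_lt (by omega), Nat.cast_zero] at h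
      exact h
    rw [this, zero_smul]

theorem grPow_natCast {a : Gr q} (ha : a ∈ grPart q 0) (hb : 0 < body a) (n : ℕ) :
    grPow a n = a ^ n := by
  induction n with
  | zero => rw [Nat.cast_zero, grPow_zero, pow_zero]
  | succ n ih => rw [Nat.cast_succ, grPow_add ha hb, ih, grPow_one hb.ne', pow_succ]

/-- The characterization of the real powers. -/
theorem eq_grPow {a : Gr q} (ha : a ∈ grPart q 0) (hb : 0 < body a) {P f : ℝ → Gr q}
    (hf : IsPoly f) (hP : ∀ w, P w = body a ^ w • f w) (hn : ∀ n : ℕ, P n = a ^ n) (w : ℝ) :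
    P w = grPow a w := by
  rw [hP, grPow_eq hb.ne']
  congr 1
  -- Once body a ^ w is removed, both sides are polynomial in w, so agreement at the natural numbers
  -- suffices.
  refine hf.eq (isPoly_choose_sum _ _) (fun n => ?_) w
  have h1 := grPow_natCast ha hb n
  rw [← hn, hP, grPow_eq hb.ne'] at h1
  have hpos : body a ^ (n : ℝ) ≠ 0 := (Real.rpow_pos_of_pos hb _).ne'
  exact (smul_right_injective _ hpos h1).symm

/-- The right-hand side is body(ab)^w times a polynomial in w, and it is (ab)^n at natural n; this
characterizes the power. -/
theorem grPow_mul {a b : Gr q} (ha : a ∈ grPart q 0) (hb : b ∈ grPart q 0) (ha0 : 0 < body a)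
    (hb0 : 0 < body b) (w : ℝ) : grPow (a * b) w = grPow a w * grPow b w := by
  have hab : a * b ∈ grPart q 0 := (GrEven q).mul_mem ha hb
  have h0 : 0 < body (a * b) := by rw [map_mul]; exact mul_pos ha0 hb0
  refine (eq_grPow (P := fun w => grPow a w * grPow b w) hab h0
    ((isPoly_choose_sum ((body a)⁻¹ • a - 1) (q + 2)).mul
      (isPoly_choose_sum ((body b)⁻¹ • b - 1) (q + 2))) (fun w => ?_) (fun n => ?_) w).symm
  · rw [grPow_eq ha0.ne', grPow_eq hb0.ne', smul_mul_smul_comm, map_mul,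
      Real.mul_rpow ha0.le hb0.le]
  · rw [grPow_natCast ha ha0, grPow_natCast hb hb0, (even_commute ha b).mul_pow]

theorem grPow_mem {a : Gr q} (ha : a ∈ grPart q 0) (hb : body a ≠ 0) (w : ℝ) :
    grPow a w ∈ grPart q 0 := by
  rw [grPow_eq hb]
  refine Submodule.smul_mem _ _ (sum_mem fun k _ => Submodule.smul_mem _ _ ?_)
  exact (GrEven q).pow_mem (sub_mem (Submodule.smul_mem _ _ ha) one_mem_grPart) k

variable {V : Opens (Fin p → ℝ)}

/-- The real powers of a superfunction with positive body. -/
def SuperFun.rpow (F : SuperFun q V) (hF : ∀ y, 0 < body (F.fn y)) (w : ℝ) : SuperFun q V :=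
  .mk (fun y => grPow (F.fn y) w) <| by
    have h1 : ContDiffOn ℝ ∞ (fun y => bodyFun F.fn y ^ w) (V : Set (Fin p → ℝ)) :=
      (contDiffOn_bodyFun F.isSmooth).rpow_const_of_ne fun y hy => by
        rw [bodyFun_apply F.fn ⟨y, hy⟩]; exact (hF _).ne'
    have h2 : ContDiffOn ℝ ∞ (bodyFun F.fn)⁻¹ (V : Set (Fin p → ℝ)) :=
      (contDiffOn_bodyFun F.isSmooth).inv fun y hy => by
        rw [bodyFun_apply F.fn ⟨y, hy⟩]; exact (hF _).ne'
    let G : SuperFun q V := ofReal _ h1 *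
      ∑ k ∈ Finset.range (q + 2), Ring.choose w k • (ofReal _ h2 * F - 1) ^ k
    have : G.fn = fun y => grPow (F.fn y) w := by
      funext y
      rw [grPow_eq (hF y).ne', SuperFun.fn_mul, Pi.mul_apply, SuperFun.fn_finset_sum, fn_ofReal,
        ← Algebra.smul_def, bodyFun_apply]
      congr 1
      refine Finset.sum_congr rfl fun k _ => ?_
      rw [SuperFun.fn_smul, Pi.smul_apply, SuperFun.fn_pow, SuperFun.fn_sub, Pi.sub_apply,
        SuperFun.fn_mul, Pi.mul_apply, fn_ofReal, ← Algebra.smul_def, Pi.inv_apply, bodyFun_apply]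
      rfl
    rw [← this]
    exact G.isSmooth

@[simp] theorem fn_rpow (F : SuperFun q V) (hF : ∀ y, 0 < body (F.fn y)) (w : ℝ) (y : V) :
    (F.rpow hF w).fn y = grPow (F.fn y) w := rfl

/-- Writing h(t) = h(0) + t g(t), the image of h(wℓ) is h(0) + w E(ℓ) E(g(wℓ)), where E(ℓ) has body
zero. Iterating gives a polynomial in w modulo any degree of the filtration. -/
theorem exists_isPoly_smooth {y₀ : Fin p → ℝ} (hy₀ : y₀ ∈ V) (E : SuperFun q V →ₐ[ℝ] Gr q)
    (hE : ∀ f, body (E f) = body (f.fn ⟨y₀, hy₀⟩)) {ℓ : (Fin p → ℝ) → ℝ} (hℓ : ContDiffOn ℝ ∞ ℓ V)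
    (h0 : ℓ y₀ = 0) (N : ℕ) : ∀ {h : ℝ → ℝ} (hh : ContDiff ℝ ∞ h), ∃ f : ℝ → Gr q, IsPoly f ∧
      ∀ w, E (ofReal (fun y => h (w * ℓ y)) (hh.comp_contDiffOn (contDiffOn_const.mul hℓ))) - f w
        ∈ grFil q N := by
  induction N with
  | zero => exact fun _ => ⟨_, isPoly_const 0, fun w => mem_grFil_zero _⟩
  | succ N ih =>
    intro h hh
    obtain ⟨g, hg, hgh⟩ := exists_hadamard_real hh
    obtain ⟨f, hf, hfE⟩ := ih hg
    refine ⟨fun w => h 0 • 1 + (Polynomial.X : Polynomial ℝ).eval w • (E (ofReal ℓ hℓ) * f w),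
      (isPoly_const _).add (((isPoly_const _).mul hf).smul _), fun w => ?_⟩
    have e : (ofReal (fun y => h (w * ℓ y)) (hh.comp_contDiffOn (contDiffOn_const.mul hℓ)) :
        SuperFun q V) = h 0 • 1 + w • (ofReal ℓ hℓ * ofReal (fun y => g (w * ℓ y))
          (hg.comp_contDiffOn (contDiffOn_const.mul hℓ))) := SuperFun.ext fun y => by
      rw [fn_ofReal, hgh]
      simp [Algebra.algebraMap_eq_smul_one, add_smul, smul_smul, mul_comm, mul_assoc]
    have hℓF : E (ofReal ℓ hℓ) ∈ grFil q 1 := by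
      rw [mem_grFil_one_iff, hE, fn_ofReal, body_algebraMap, h0]
    beta_reduce
    rw [e, map_add, map_smul, map_smul, map_mul, map_one, Polynomial.eval_X, add_sub_add_left_eq_sub,
      ← smul_sub, ← mul_sub, add_comm N 1]
    exact Submodule.smul_mem _ _ (mul_mem_grFil hℓF (hfE w))

/-- Homomorphisms are compatible with real powers. -/
theorem map_rpow {y₀ : Fin p → ℝ} (hy₀ : y₀ ∈ V) (E : SuperFun q V →ₐ[ℝ] Gr q)
    (hE : ∀ f, body (E f) = body (f.fn ⟨y₀, hy₀⟩)) (F : SuperFun q V)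
    (hF : ∀ y, 0 < body (F.fn y)) (hF0 : HasParity 0 F.fn) (hEF : E F ∈ grPart q 0) (w : ℝ) :
    E (F.rpow hF w) = grPow (E F) w := by
  have hpos : ∀ y ∈ V, bodyFun F.fn y ≠ 0 := fun y hy => by
    rw [bodyFun_apply F.fn ⟨y, hy⟩]; exact (hF _).ne'
  have hbody := contDiffOn_bodyFun F.isSmooth
  have h2 : ContDiffOn ℝ ∞ (bodyFun F.fn)⁻¹ (V : Set (Fin p → ℝ)) := hbody.inv hpos
  set b₀ := body (F.fn ⟨y₀, hy₀⟩) with hb₀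
  have hb₀pos : 0 < b₀ := hF _
  -- The real factor of F^w is written b₀^w exp(wℓ) with ℓ = log(body F) − log b₀. Dividing out b₀
  -- makes ℓ vanish at y₀, so the image of exp(wℓ) is polynomial in w.
  have hℓ : ContDiffOn ℝ ∞ (fun y => Real.log (bodyFun F.fn y) - Real.log b₀)
    (V : Set (Fin p → ℝ)) := (hbody.log hpos).sub contDiffOn_const
  have hℓ0 : Real.log (bodyFun F.fn y₀) - Real.log b₀ = 0 := by
    rw [bodyFun_apply F.fn ⟨y₀, hy₀⟩, sub_self]
  obtain ⟨f, hf, hfE⟩ := exists_isPoly_smooth hy₀ E hE hℓ hℓ0 (q + 1) Real.contDiff_exp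
  have hbE : body (E F) = b₀ := hE F
  refine eq_grPow (a := E F) hEF (by rw [hbE]; exact hb₀pos) (P := fun w => E (F.rpow hF w))
    (hf.mul (isPoly_choose_sum (E (ofReal _ h2 * F - 1)) (q + 2))) (fun w => ?_) (fun n => ?_) w
  · have e : F.rpow hF w = b₀ ^ w • (ofReal _ (Real.contDiff_exp.comp_contDiffOn
        (contDiffOn_const (c := w).mul hℓ)) *
          ∑ k ∈ Finset.range (q + 2), Ring.choose w k • (ofReal _ h2 * F - 1) ^ k) := by
      ext y
      rw [fn_rpow, grPow_eq (hF y).ne', SuperFun.fn_smul, Pi.smul_apply, SuperFun.fn_mul,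
        Pi.mul_apply, SuperFun.fn_finset_sum, fn_ofReal, ← Algebra.smul_def, smul_smul]
      simp only [Function.comp_apply]
      rw [bodyFun_apply]
      congr 1
      · rw [Real.rpow_def_of_pos (hF y), Real.rpow_def_of_pos hb₀pos, ← Real.exp_add]
        congr 1; ring
      · refine Finset.sum_congr rfl fun k _ => ?_
        rw [SuperFun.fn_smul, Pi.smul_apply, SuperFun.fn_pow, SuperFun.fn_sub, Pi.sub_apply,
          SuperFun.fn_mul, Pi.mul_apply, fn_ofReal, ← Algebra.smul_def, Pi.inv_apply, bodyFun_apply]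
        rfl
    have hE' : E (ofReal (Real.exp ∘ fun y => w * (Real.log (bodyFun F.fn y) - Real.log b₀))
      (Real.contDiff_exp.comp_contDiffOn (contDiffOn_const.mul hℓ))) = f w :=
      sub_eq_zero.1 (eq_zero_of_mem_grFil (hfE w))
    rw [e, map_smul, map_mul, hbE, hE', map_sum]
    simp only [map_smul, map_pow]
  · have e : F.rpow hF n = F ^ n := SuperFun.ext fun y => by
      rw [fn_rpow, grPow_natCast (hF0 y) (hF y), SuperFun.fn_pow]
    rw [e, map_pow]

end Powers

end SuperGeom

end

noncomputable section

namespace SuperGeom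

/-! ### The Berezinian as a superfunction -/

section BerezinianFunction

open Matrix

variable {p q : ℕ} {V : Opens (Fin p → ℝ)}

/-- The map of even parts induced by a parity preserving homomorphism. -/
def evenHom (E : SuperFun q V →ₐ[ℝ] Gr q) (hE : ∀ f, HasParity 0 f.fn → E f ∈ grPart q 0) :
    evenSub q V →+* GrEven q where
  toFun f := ⟨E f.1, hE f.1 f.2⟩
  map_one' := Subtype.ext (map_one E)
  map_mul' f g := Subtype.ext (map_mul E f.1 g.1)
  map_zero' := Subtype.ext (map_zero E)
  map_add' f g := Subtype.ext (map_add E f.1 g.1)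

/-- The Berezinian of a supermatrix of superfunctions is a superfunction, naturally. -/
theorem exists_superFun_berezinian {J : Matrix (CoordIdx p q) (CoordIdx p q) (SuperFun q V)}
    (hJ : ∀ a b, HasParity (par a + par b) (J a b).fn)
    (hu : ∀ y, IsUnit (edet (J.map fun f => f.fn y).toBlocks₂₂)) :
    ∃ G : SuperFun q V, HasParity 0 G.fn ∧ ∀ (E : SuperFun q V →ₐ[ℝ] Gr q),
      (∀ f, HasParity 0 f.fn → E f ∈ grPart q 0) →
        IsUnit (edet (J.map E).toBlocks₂₂) ∧ E G = berezinian (J.map E) := by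
  -- The odd-odd block is inverted over the commutative ring of even superfunctions. The Berezinian
  -- is then an algebraic expression there, which every parity-preserving homomorphism respects.
  let D₀ : Matrix (Fin q) (Fin q) (evenSub q V) :=
    Matrix.of fun m n => ⟨J (Sum.inr m) (Sum.inr n), hJ (Sum.inr m) (Sum.inr n)⟩
  have hD : ∀ (E : SuperFun q V →ₐ[ℝ] Gr q) (hE : ∀ f, HasParity 0 f.fn → E f ∈ grPart q 0),
      lift (J.map E).toBlocks₂₂ = D₀.map (evenHom E hE) := by
    intro E hE
    apply unlift_injective
    have := unlift_lift (M := (J.map E).toBlocks₂₂)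
      (fun m n => by simpa using! hE _ (hJ (Sum.inr m) (Sum.inr n)))
    rw [this]
    rfl
  have hdet : ∀ (E : SuperFun q V →ₐ[ℝ] Gr q) (hE : ∀ f, HasParity 0 f.fn → E f ∈ grPart q 0),
      edet (J.map E).toBlocks₂₂ = evenHom E hE D₀.det := by
    intro E hE
    rw [edet, hD E hE, RingHom.map_det]; rfl
  have hunit : IsUnit D₀.det := by
    refine isUnit_evenSub fun y => ?_
    have h := hdet (evalAlg y) (fun f hf => hf y)
    have h2 : IsUnit (evenHom (evalAlg y) (fun f hf => hf y) D₀.det) := h ▸ hu y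
    exact isUnit_iff_body.1 (h2.map (GrEven q).val)
  have hinv : D₀ * D₀⁻¹ = 1 := Matrix.mul_nonsing_inv _ hunit
  let K : Matrix (Fin p) (Fin p) (SuperFun q V) :=
    J.toBlocks₁₁ - J.toBlocks₁₂ * D₀⁻¹.map Subtype.val * J.toBlocks₂₁
  have hK : ∀ (E : SuperFun q V →ₐ[ℝ] Gr q) (hE : ∀ f, HasParity 0 f.fn → E f ∈ grPart q 0),
      (J.map E).toBlocks₁₁ - (J.map E).toBlocks₁₂ * unlift (D₀⁻¹.map (evenHom E hE)) *
        (J.map E).toBlocks₂₁ = K.map E := by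
    intro E hE
    ext i j
    simp only [K, Matrix.sub_apply, Matrix.map_apply, Matrix.mul_apply, map_sub, map_sum, map_mul,
      toBlocks₁₁, toBlocks₁₂, toBlocks₂₁, Matrix.of_apply, unlift]
    rfl
  have hKpar : ∀ i j, HasParity 0 (K i j).fn := by
    intro i j y
    have e : (K i j).fn y = (K.map (evalAlg y)) i j := rfl
    rw [e, ← hK (evalAlg y) (fun f hf => hf y)]
    have a1 : EntryParity 0 (J.map (evalAlg y)).toBlocks₁₁ := fun i j =>
      hJ (Sum.inl i) (Sum.inl j) y
    have a2 : EntryParity 1 (J.map (evalAlg y)).toBlocks₁₂ := fun i j =>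
      hJ (Sum.inl i) (Sum.inr j) y
    have a3 : EntryParity 1 (J.map (evalAlg y)).toBlocks₂₁ := fun i j =>
      hJ (Sum.inr i) (Sum.inl j) y
    exact a1.sub ((a2.odd_mul_even (entryParity_coe _)).odd_mul a3) i j
  let K₀ : Matrix (Fin p) (Fin p) (evenSub q V) := Matrix.of fun i j => ⟨K i j, hKpar i j⟩
  let G : evenSub q V := K₀.det * D₀⁻¹.det
  refine ⟨G.1, G.2, fun E hE => ⟨?_, ?_⟩⟩
  · rw [hdet E hE]; exact hunit.map _
  · have h1 : lift (J.map E).toBlocks₂₂ * D₀⁻¹.map (evenHom E hE) = 1 := by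
      rw [hD E hE, ← Matrix.map_mul, hinv, Matrix.map_one _ (map_zero _) (map_one _)]
    rw [berezinian_eq _ h1, hK E hE]
    have h2 : edet (K.map E) = evenHom E hE K₀.det := by
      have : lift (K.map E) = K₀.map (evenHom E hE) := by
        apply unlift_injective
        have := unlift_lift (M := K.map E) (fun i j => hE _ (hKpar i j))
        rw [this]
        rfl
      rw [edet, this, RingHom.map_det]; rfl
    have h3 : (D₀⁻¹.map (evenHom E hE)).det = evenHom E hE D₀⁻¹.det := by
      rw [RingHom.map_det]; rfl
    rw [h2, h3, ← map_mul]
    rfl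

/-- `Ring.inverse` is zero on non-units, so a Berezinian with nonzero body already certifies that
the odd-odd block is invertible. -/
theorem isUnit_edet_of_body {J : Matrix (CoordIdx p q) (CoordIdx p q) (Gr q)}
    (h : body (berezinian J : Gr q) ≠ 0) : IsUnit (edet J.toBlocks₂₂) := by
  by_contra hc
  apply h
  have : berezinian J = 0 := by
    rw [berezinian]
    change _ * Ring.inverse (edet J.toBlocks₂₂) = 0
    rw [Ring.inverse_non_unit _ hc, mul_zero]
  rw [this]; exact map_zero _

end BerezinianFunction

/-! ### Changes of coordinates -/

namespace Supermanifold

open Filter Topology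

variable {p q : ℕ} (M : Supermanifold.{u} p q)

variable {M} {W W' : Opens M.space} {i j k : M.Chart}

/-- The change of coordinates over an open set in the domains of two charts. -/
def tr (hi : W ≤ M.src i) (hj : W ≤ M.src j) :
    SuperFun q (chartDom (M.chart j) W) ≃ₐ[ℝ] SuperFun q (chartDom (M.chart i) W) :=
  (M.coord j W hj).symm.trans (M.coord i W hi)

theorem tr_tr (hi : W ≤ M.src i) (hj : W ≤ M.src j) (hk : W ≤ M.src k)
    (f : SuperFun q (chartDom (M.chart k) W)) : tr hi hj (tr hj hk f) = tr hi hk f := by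
  simp [tr]

theorem tr_res (hi : W ≤ M.src i) (hj : W ≤ M.src j) (h : W' ≤ W)
    (f : SuperFun q (chartDom (M.chart j) W)) :
    tr (h.trans hi) (h.trans hj) (SuperFun.res (chartDom_mono (M.chart j) h) f) =
      SuperFun.res (chartDom_mono (M.chart i) h) (tr hi hj f) := by
  obtain ⟨s, rfl⟩ := (M.coord j W hj).surjective f
  rw [tr, tr, ← M.coord_res j W W' hj h s]
  simp only [AlgEquiv.trans_apply, AlgEquiv.symm_apply_apply]
  rw [← M.coord_res i W W' hi h s]

theorem tr_parity (hi : W ≤ M.src i) (hj : W ≤ M.src j) {ε : ZMod 2}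
    {f : SuperFun q (chartDom (M.chart j) W)} (hf : HasParity ε f.fn) :
    HasParity ε (tr hi hj f).fn := by
  obtain ⟨s, rfl⟩ := (M.coord j W hj).surjective f
  have := M.coord_parity j i W hj hi ε s hf
  simpa [tr] using! this

/-- The change of coordinates on points. -/
def pt (_hi : W ≤ M.src i) (hj : W ≤ M.src j) (y : chartDom (M.chart i) W) :
    chartDom (M.chart j) W :=
  ⟨M.chart j ((M.chart i).symm y.1), (M.chart j).map_source (hj y.2.2), by
    rw [mem_preimage, (M.chart j).left_inv (hj y.2.2)]; exact y.2.2⟩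

theorem symm_pt (hi : W ≤ M.src i) (hj : W ≤ M.src j) (y : chartDom (M.chart i) W) :
    (M.chart j).symm (pt hi hj y).1 = (M.chart i).symm y.1 :=
  (M.chart j).left_inv (hj y.2.2)

theorem res_fn {V V' : Opens (Fin p → ℝ)} (h : V' ≤ V) (f : SuperFun q V) (y : V') :
    (SuperFun.res h f).fn y = f.fn ⟨y.1, h y.2⟩ := rfl

/-- Shrinking a neighbourhood, through a chart. -/
theorem exists_opens_of_eventually (hj : W ≤ M.src j) {y : chartDom (M.chart j) W}
    {P : chartDom (M.chart j) W → Prop} (h : ∀ᶠ z in 𝓝 y, P z) :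
    ∃ (W' : Opens M.space) (hW : W' ≤ W), (M.chart j).symm y.1 ∈ W' ∧
      ∀ z : chartDom (M.chart j) W', P ⟨z.1, chartDom_mono _ hW z.2⟩ := by
  obtain ⟨U, hU, hUo, hyU⟩ := eventually_nhds_iff.1 h
  obtain ⟨U', hU'o, rfl⟩ := isOpen_induced_iff.1 hUo
  refine ⟨⟨(M.chart j).source ∩ M.chart j ⁻¹' U', (M.chart j).isOpen_inter_preimage hU'o⟩ ⊓ W,
    inf_le_right, ⟨⟨hj y.2.2, ?_⟩, y.2.2⟩, fun z => hU _ ?_⟩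
  · rw [mem_preimage, (M.chart j).right_inv y.2.1]; exact hyU
  · have := z.2.2.1.2
    rw [mem_preimage, (M.chart j).right_inv z.2.1] at this
    exact this

theorem chartDom_mem_nhds {y : chartDom (M.chart i) W} (h : W' ≤ W)
    (hy : (M.chart i).symm y.1 ∈ W') {P : chartDom (M.chart i) W → Prop}
    (hP : ∀ z : chartDom (M.chart i) W', P ⟨z.1, chartDom_mono _ h z.2⟩) : ∀ᶠ z in 𝓝 y, P z := by
  have : ∀ᶠ z : chartDom (M.chart i) W in 𝓝 y, z.1 ∈ chartDom (M.chart i) W' :=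
    continuous_subtype_val.continuousAt.preimage_mem_nhds
      ((chartDom (M.chart i) W').isOpen.mem_nhds ⟨y.2.1, hy⟩)
  exact this.mono fun z hz => hP ⟨z.1, hz⟩

/-- The body of a superfunction is transformed by the change of coordinates on points. -/
theorem body_tr (hi : W ≤ M.src i) (hj : W ≤ M.src j) (y : chartDom (M.chart i) W)
    (f : SuperFun q (chartDom (M.chart j) W)) :
    body ((tr hi hj f).fn y) = body (f.fn (pt hi hj y)) := by
  by_contra hne
  set c := body ((tr hi hj f).fn y) with hc
  -- If the bodies differed, f − c would be invertible near the image point. An isomorphism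
  -- preserves invertibility, but the transform of f − c has body zero at y.
  have h1 : ∀ᶠ z in 𝓝 (pt hi hj y), body (f.fn z) - c ≠ 0 :=
    ((continuous_body f.isSmooth).sub continuous_const).continuousAt.eventually_ne
      (sub_ne_zero.2 (Ne.symm hne))
  obtain ⟨W', hW, hy, hP⟩ := exists_opens_of_eventually hj h1
  rw [symm_pt] at hy
  obtain ⟨g, hg, -⟩ := exists_superFun_inv (f := SuperFun.res (chartDom_mono (M.chart j) hW)
    (f - algebraMap ℝ _ c)) (fun z => by
      rw [res_fn, SuperFun.fn_sub, Pi.sub_apply, map_sub]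
      change _ - body (algebraMap ℝ (Gr q) c) ≠ 0
      rw [body_algebraMap]; exact hP z)
  have h2 := congrArg (tr (hW.trans hi) (hW.trans hj)) hg
  rw [map_mul, map_one, tr_res hi hj hW, map_sub, AlgEquiv.commutes] at h2
  have h3 := congrArg (fun F => body (F.fn ⟨y.1, y.2.1, hy⟩)) h2
  simp only [SuperFun.fn_mul, Pi.mul_apply, map_mul, SuperFun.fn_one, Pi.one_apply, map_one] at h3
  have h4 : body ((SuperFun.res (chartDom_mono (M.chart i) hW)
      (tr hi hj f - algebraMap ℝ _ c)).fn ⟨y.1, y.2.1, hy⟩) = 0 := by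
    rw [res_fn, SuperFun.fn_sub, Pi.sub_apply, map_sub]
    change c - body (algebraMap ℝ (Gr q) c) = 0
    rw [body_algebraMap, sub_self]
  rw [h4, zero_mul] at h3
  exact zero_ne_one h3

/-- The evaluation at a point of the chart `i` of superfunctions in the chart `j`. -/
def evTr (hi : W ≤ M.src i) (hj : W ≤ M.src j) (y : chartDom (M.chart i) W) :
    SuperFun q (chartDom (M.chart j) W) →ₐ[ℝ] Gr q :=
  (evalAlg y).comp (tr hi hj).toAlgHom

theorem body_evTr (hi : W ≤ M.src i) (hj : W ≤ M.src j) (y : chartDom (M.chart i) W)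
    (f : SuperFun q (chartDom (M.chart j) W)) :
    body (evTr hi hj y f) = body (f.fn (pt hi hj y)) := body_tr hi hj y f

/-- The Jacobi matrix over an open set. -/
def jac (hi : W ≤ M.src i) (hj : W ≤ M.src j) :
    Matrix (CoordIdx p q) (CoordIdx p q) (SuperFun q (chartDom (M.chart i) W)) :=
  Matrix.of fun a b => SuperFun.pd a (tr hi hj (coordFun _ b))

theorem jac_parity (hi : W ≤ M.src i) (hj : W ≤ M.src j) (a b : CoordIdx p q) :
    HasParity (par a + par b) (jac hi hj a b).fn := by
  rw [add_comm]
  exact hasParity_pd a (tr_parity hi hj (hasParity_coordFun b))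

/-- The difference of the two sides satisfies a Leibniz rule twisted by the homomorphism `evTr` and
vanishes on the coordinates, so `derivation_eq_zero` applies. Nothing about the change of
coordinates is used beyond its action on parities and bodies. -/
theorem chain_rule (hi : W ≤ M.src i) (hj : W ≤ M.src j) (a : CoordIdx p q)
    (f : SuperFun q (chartDom (M.chart j) W)) :
    SuperFun.pd a (tr hi hj f) = ∑ b, jac hi hj a b * tr hi hj (SuperFun.pd b f) := by
  ext y
  let D : SuperFun q (chartDom (M.chart j) W) →ₗ[ℝ] Gr q :=
    (evalAlg y).toLinearMap ∘ₗ (SuperFun.pd a ∘ₗ (tr hi hj).toLinearMap - ∑ b,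
      LinearMap.mulLeft ℝ (jac hi hj a b) ∘ₗ (tr hi hj).toLinearMap ∘ₗ SuperFun.pd b)
  have hD : ∀ f, D f = (SuperFun.pd a (tr hi hj f) -
      ∑ b, jac hi hj a b * tr hi hj (SuperFun.pd b f)).fn y := by
    intro f
    simp [D]
  have leib : ∀ (ε : ZMod 2) (r f : SuperFun q (chartDom (M.chart j) W)), HasParity ε r.fn →
      SuperFun.pd a (tr hi hj (r * f)) - ∑ b, jac hi hj a b * tr hi hj (SuperFun.pd b (r * f)) =
      (SuperFun.pd a (tr hi hj r) - ∑ b, jac hi hj a b * tr hi hj (SuperFun.pd b r)) * tr hi hj f +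
      sgn (par a * ε) • (tr hi hj r * (SuperFun.pd a (tr hi hj f) -
        ∑ b, jac hi hj a b * tr hi hj (SuperFun.pd b f))) := by
    intro ε r f hr
    have h1 : ∀ b, jac hi hj a b * tr hi hj (SuperFun.pd b (r * f)) =
        jac hi hj a b * tr hi hj (SuperFun.pd b r) * tr hi hj f +
        sgn (par a * ε) • (tr hi hj r * (jac hi hj a b * tr hi hj (SuperFun.pd b f))) := by
      intro b
      rw [pd_mul b hr, map_add, map_smul, map_mul, map_mul, mul_add, mul_smul_comm, ← mul_assoc,
        ← mul_assoc (jac hi hj a b) (tr hi hj r), superFun_comm (jac_parity hi hj a b)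
          (tr_parity hi hj hr), smul_mul_assoc, smul_smul, ← sgn_add, mul_assoc (tr hi hj r)]
      congr 3
      -- The sign of ∂_b passing r and the sign of the Jacobi entry passing r combine to the sign of
      -- ∂_a passing r.
      have : ∀ u v w : ZMod 2, u * w + (v + u) * w = v * w := by decide
      exact this _ _ _
    rw [map_mul, pd_mul a (tr_parity hi hj hr), Finset.sum_congr rfl fun b _ => h1 b,
      Finset.sum_add_distrib, ← Finset.sum_mul, ← Finset.smul_sum, ← Finset.mul_sum]
    rw [sub_mul, mul_sub, smul_sub]
    abel
  have key : D = 0 := by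
    refine derivation_eq_zero (pt hi hj y).2 (evTr hi hj y) (fun k => ?_) D (sgn (par a * 1))
      (fun r hr f => ?_) (fun m f => ?_) (fun b => ?_)
    · rw [body_evTr]
      exact body_algebraMap _
    · rw [hD, hD, hD, leib 0 _ f (hasParity_ofReal r hr), mul_zero, sgn_zero, one_smul]
      rfl
    · rw [hD, hD, hD, leib 1 _ f (hasParity_coordFun (Sum.inr m))]
      rfl
    · rw [hD, Finset.sum_eq_single b]
      · rw [pd_coordFun, if_pos rfl, map_one, mul_one]
        change (SuperFun.pd a _ - SuperFun.pd a _).fn y = 0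
        rw [sub_self]; rfl
      · intro c _ hc
        rw [pd_coordFun, if_neg hc, map_zero, mul_zero]
      · simp
  have h := LinearMap.congr_fun key f
  rw [hD, SuperFun.fn_sub, Pi.sub_apply, LinearMap.zero_apply, sub_eq_zero] at h
  exact h

theorem jac_trans (hi : W ≤ M.src i) (hj : W ≤ M.src j) (hk : W ≤ M.src k)
    (y : chartDom (M.chart i) W) : (jac hi hk).map (evalAlg y) =
      (jac hi hj).map (evalAlg y) * (jac hj hk).map (evTr hi hj y) := by
  ext a c
  simp only [Matrix.map_apply, Matrix.mul_apply]
  have : jac hi hk a c = ∑ b, jac hi hj a b * tr hi hj (jac hj hk b c) := by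
    change SuperFun.pd a _ = _
    rw [← tr_tr hi hj hk, chain_rule hi hj]
    rfl
  rw [this, map_sum]
  simp only [map_mul]
  rfl

theorem res_coordFun {V V' : Opens (Fin p → ℝ)} (h : V' ≤ V) (a : CoordIdx p q) :
    SuperFun.res h (coordFun V a) = coordFun V' a := by
  cases a <;> rfl

theorem pd_res {V V' : Opens (Fin p → ℝ)} (h : V' ≤ V) (a : CoordIdx p q) (f : SuperFun q V) :
    SuperFun.pd a (SuperFun.res h f) = SuperFun.res h (SuperFun.pd a f) := by
  ext y
  cases a with
  | inl k =>
    refine (grBasis q).repr.injective (Finsupp.ext fun I => ?_)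
    rw [res_fn, fn_pd, fn_pd, repr_pd_inl, repr_pd_inl]
    congr 1
    refine Filter.EventuallyEq.fderiv_eq (eventually_coe.2 (.of_forall fun z => ?_))
    rw [coeffAt_apply, coeffAt_apply (V := V) _ I ⟨z.1, h z.2⟩, res_fn]
  | inr m => rfl

theorem le_overlap (hi : W ≤ M.src i) (hj : W ≤ M.src j) :
    chartDom (M.chart i) W ≤ M.overlap i j := chartDom_mono _ (le_inf hi hj)

theorem le_dom (hi : W ≤ M.src i) : chartDom (M.chart i) W ≤ M.dom i := chartDom_mono _ hi

/-- Passes from `transfer`, which lives on the full overlap of two charts, to `tr` over a smaller W;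
triple overlaps and complements of compact sets require the latter. -/
theorem transfer_fn (hi : W ≤ M.src i) (hj : W ≤ M.src j) (f : SuperFun q (M.dom j))
    (y : chartDom (M.chart i) W) :
    (M.transfer i j f).fn ⟨y.1, le_overlap hi hj y.2⟩ =
      (tr hi hj (SuperFun.res (le_dom hj) f)).fn y := by
  have h := tr_res (inf_le_left : M.src i ⊓ M.src j ≤ _) (inf_le_right : M.src i ⊓ M.src j ≤ _)
    (le_inf hi hj) (SuperFun.res (chartDom_mono (M.chart j) inf_le_right) f)
  exact (congrArg (fun F => F.fn y) h).symm

theorem jacobian_eq (hi : W ≤ M.src i) (hj : W ≤ M.src j) (y : chartDom (M.chart i) W) :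
    M.jacobian i j ⟨y.1, le_overlap hi hj y.2⟩ = (jac hi hj).map (evalAlg y) := by
  ext a b
  have h1 : SuperFun.res (le_overlap hi hj) (M.transfer i j (coordFun (M.dom j) b)) =
      tr hi hj (coordFun _ b) := by
    ext z
    rw [res_fn, transfer_fn hi hj, res_coordFun]
  change (SuperFun.res (le_overlap hi hj)
    (SuperFun.pd a (M.transfer i j (coordFun (M.dom j) b)))).fn y = _
  rw [← pd_res, h1]
  rfl

end Supermanifold

end SuperGeom

end

noncomputable section

namespace SuperGeom

theorem berezinian_one {p q : ℕ} :
    berezinian (1 : Matrix (CoordIdx p q) (CoordIdx p q) (Gr q)) = 1 := by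
  have h22 : (1 : Matrix (CoordIdx p q) (CoordIdx p q) (Gr q)).toBlocks₂₂ = 1 := by
    rw [← Matrix.fromBlocks_one, Matrix.toBlocks_fromBlocks₂₂]
  have h11 : (1 : Matrix (CoordIdx p q) (CoordIdx p q) (Gr q)).toBlocks₁₁ = 1 := by
    rw [← Matrix.fromBlocks_one, Matrix.toBlocks_fromBlocks₁₁]
  have h12 : (1 : Matrix (CoordIdx p q) (CoordIdx p q) (Gr q)).toBlocks₁₂ = 0 := by
    rw [← Matrix.fromBlocks_one, Matrix.toBlocks_fromBlocks₁₂]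
  rw [berezinian_eq _ (D' := 1) (by rw [h22, lift_one, one_mul]), h11, h12, Matrix.zero_mul,
    Matrix.zero_mul, sub_zero, edet_one, Matrix.det_one, one_mul]

namespace PosSupermanifold

open Supermanifold Filter Topology

variable {p q : ℕ} {M : PosSupermanifold.{u} p q} {W W' : Opens M.space} {i j k : M.Chart}

/-! ### Powers of the Jacobian -/

theorem ber_eq (hi : W ≤ M.src i) (hj : W ≤ M.src j) (y : chartDom (M.chart i) W) :
    M.ber i j ⟨y.1, le_overlap hi hj y.2⟩ = berezinian ((jac hi hj).map (evalAlg y)) := by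
  rw [← jacobian_eq hi hj y]
  rfl

theorem isUnit_edet_jac (hi : W ≤ M.src i) (hj : W ≤ M.src j) (y : chartDom (M.chart i) W) :
    IsUnit (edet ((jac hi hj).map (evalAlg y)).toBlocks₂₂) := by
  refine isUnit_edet_of_body ?_
  rw [← ber_eq hi hj y]
  exact (M.ber_pos i j _).ne'

/-- The powers of the Jacobian are superfunctions and satisfy the cocycle condition. -/
theorem exists_jacobian_pow (hj : W ≤ M.src j) (hk : W ≤ M.src k) (w : ℝ) :
    ∃ P : SuperFun q (chartDom (M.chart j) W), HasParity 0 P.fn ∧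
      (∀ y, P.fn y = grPow (M.ber j k ⟨y.1, le_overlap hj hk y.2⟩ : Gr q) w) ∧
      ∀ (i : M.Chart) (hi : W ≤ M.src i) (y : chartDom (M.chart i) W),
        grPow (M.ber i k ⟨y.1, le_overlap hi hk y.2⟩ : Gr q) w =
          grPow (M.ber i j ⟨y.1, le_overlap hi hj y.2⟩ : Gr q) w * (tr hi hj P).fn y := by
  obtain ⟨G, hG0, hG⟩ := exists_superFun_berezinian (jac_parity hj hk) (isUnit_edet_jac hj hk)
  have hGfn : ∀ y, G.fn y = (M.ber j k ⟨y.1, le_overlap hj hk y.2⟩ : Gr q) := fun y => by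
    have := (hG (evalAlg y) (fun f hf => hf y)).2
    rw [ber_eq hj hk y, ← this]; rfl
  have hpos : ∀ y, 0 < body (G.fn y) := fun y => by rw [hGfn]; exact M.ber_pos j k _
  refine ⟨G.rpow hpos w, fun y => grPow_mem (hG0 y) (hpos y).ne' w, fun y => ?_, fun i hi y => ?_⟩
  · rw [fn_rpow, hGfn]
  · have hE : ∀ f, HasParity 0 f.fn → evTr hi hj y f ∈ grPart q 0 := fun f hf =>
      tr_parity hi hj hf y
    obtain ⟨h1, h2⟩ := hG (evTr hi hj y) hE
    -- The chain rule factors the Jacobi matrix, so J_ik = J_ij · J_jk with J_jk rewritten in the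
    -- coordinates i; `map_rpow` then carries this to real powers.
    have h3 := berezinian_mul (X := (jac hi hj).map (evalAlg y))
      (Y := (jac hj hk).map (evTr hi hj y)) (fun a b => jac_parity hi hj a b y)
      (fun a b => tr_parity hi hj (jac_parity hj hk a b) y) (isUnit_edet_jac hi hj y) h1
      (by rw [← jac_trans hi hj hk]; exact isUnit_edet_jac hi hk y)
    rw [← jac_trans hi hj hk, ← ber_eq hi hj, ← ber_eq hi hk] at h3
    have h4 : (M.ber i k ⟨y.1, le_overlap hi hk y.2⟩ : Gr q) =
        (M.ber i j ⟨y.1, le_overlap hi hj y.2⟩ : Gr q) * evTr hi hj y G := by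
      rw [h3, h2]; rfl
    have h5 : (tr hi hj (G.rpow hpos w)).fn y = grPow (evTr hi hj y G) w :=
      map_rpow (pt hi hj y).2 (evTr hi hj y) (body_evTr hi hj y) G hpos hG0 (hE G hG0) w
    rw [h4, h5, grPow_mul (M.ber i j _).2 (hE G hG0) (M.ber_pos i j _)]
    rw [body_evTr]; exact hpos _

theorem grPow_one_left (w : ℝ) : grPow (1 : Gr q) w = 1 := by
  rw [grPow, finsum_eq_single _ 0]
  · simp
  · intro k hk
    simp [hk]

theorem ber_self (y : M.overlap i i) : M.ber i i y = 1 := by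
  have hi : M.src i ⊓ M.src i ≤ M.src i := inf_le_left
  let y : chartDom (M.chart i) (M.src i ⊓ M.src i) := y
  have h := ber_eq hi hi y
  have : (jac hi hi).map (evalAlg y) = 1 := by
    ext a b
    have e : jac hi hi a b = SuperFun.pd a (coordFun _ b) := by
      change SuperFun.pd a (tr hi hi _) = _
      simp [tr]
    rw [Matrix.map_apply, e, pd_coordFun, Matrix.one_apply]
    split_ifs <;> simp
  rw [this, berezinian_one] at h
  exact h

theorem transfer_self (f : SuperFun q (M.dom i)) (y : M.overlap i i) :
    (M.transfer i i f).fn y = f.fn ⟨y.1, M.overlap_le i i y.2⟩ := by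
  have hi : M.src i ⊓ M.src i ≤ M.src i := inf_le_left
  refine (transfer_fn hi hi f y).trans ?_
  simp [tr]
  rfl

/-! ### Extension by zero of densities given in a chart -/

/-- The superfunction `f` in the chart `i` vanishes outside of `K`. -/
def VanishesOff (i : M.Chart) (K : Set M.space) (f : SuperFun q (M.dom i)) : Prop :=
  ∀ y : M.dom i, (M.chart i).symm y.1 ∉ K → f.fn y = 0

theorem mem_dom_iff {y : Fin p → ℝ} : y ∈ M.dom i ↔ y ∈ (M.chart i).target :=
  ⟨fun h => h.1, fun h => ⟨h, (M.chart i).map_target h⟩⟩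

open Classical in
/-- The coefficient in the chart `j` of the extension of `f (Dx_i)^w`. -/
def extFun (i : M.Chart) (w : ℝ) (f : SuperFun q (M.dom i)) (j : M.Chart) (y : M.dom j) : Gr q :=
  if h : y.1 ∈ M.overlap j i then
    (M.transfer j i f).fn ⟨y.1, h⟩ * grPow (M.ber j i ⟨y.1, h⟩ : Gr q) w
  else 0

theorem extFun_of_mem (w : ℝ) (f : SuperFun q (M.dom i)) {y : M.dom j}
    (h : (M.chart j).symm y.1 ∈ M.src i) : extFun i w f j y =
    (M.transfer j i f).fn ⟨y.1, y.2.1, y.2.2, h⟩ *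
      grPow (M.ber j i ⟨y.1, y.2.1, y.2.2, h⟩ : Gr q) w := by
  have hy : y.1 ∈ M.overlap j i := ⟨y.2.1, y.2.2, h⟩
  rw [extFun, dif_pos hy]

theorem extFun_of_notMem (w : ℝ) (f : SuperFun q (M.dom i)) {y : M.dom j}
    (h : (M.chart j).symm y.1 ∉ M.src i) : extFun i w f j y = 0 := by
  rw [extFun, dif_neg]
  exact fun hy => h hy.2.2

theorem isClosed_of_isCompact {K : Set M.space} (hK : IsCompact K) : IsClosed K :=
  haveI := M.t2
  hK.isClosed

theorem extFun_eq_zero {w : ℝ} {f : SuperFun q (M.dom i)} {K : Set M.space} (hK : IsCompact K)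
    (hf : VanishesOff i K f) {y : M.dom j} (hy : (M.chart j).symm y.1 ∉ K) :
    extFun i w f j y = 0 := by
  by_cases h : (M.chart j).symm y.1 ∈ M.src i
  · rw [extFun_of_mem w f h]
    let W : Opens M.space := ⟨Kᶜ, (isClosed_of_isCompact hK).isOpen_compl⟩ ⊓ (M.src j ⊓ M.src i)
    have hj : W ≤ M.src j := inf_le_right.trans inf_le_left
    have hi : W ≤ M.src i := inf_le_right.trans inf_le_right
    have hz : SuperFun.res (le_dom hi) f = 0 := SuperFun.ext fun z => hf _ z.2.2.1
    have := transfer_fn hj hi f ⟨y.1, y.2.1, hy, y.2.2, h⟩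
    rw [hz, map_zero] at this
    rw [this]
    exact zero_mul _
  · exact extFun_of_notMem w f h

/-- The chart j is covered by its overlap with the chart i, where the formula is smooth, and by the
complement of K, where the extension is zero. The complement is open because the space is Hausdorff.
-/
theorem isSmooth_extFun {w : ℝ} {f : SuperFun q (M.dom i)} {K : Set M.space} (hK : IsCompact K)
    (hKi : K ⊆ (M.chart i).source) (hf : VanishesOff i K f) (j : M.Chart) :
    IsSmooth (extFun i w f j) := by
  refine isSmooth_of_res fun y => ?_
  by_cases h : (M.chart j).symm y.1 ∈ M.src i
  · obtain ⟨P, -, hP, -⟩ := exists_jacobian_pow (W := M.src j ⊓ M.src i) (j := j) (k := i)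
      inf_le_left inf_le_right w
    let P' : SuperFun q (M.overlap j i) := P
    refine ⟨M.overlap j i, M.overlap_le j i, _, ⟨y.2.1, y.2.2, h⟩,
      (M.transfer j i f * P').isSmooth, fun z => ?_⟩
    rw [extFun_of_mem w f (y := ⟨z.1, M.overlap_le j i z.2⟩) z.2.2.2]
    exact congrArg _ (hP z).symm
  · let W : Opens M.space := ⟨Kᶜ, (isClosed_of_isCompact hK).isOpen_compl⟩ ⊓ M.src j
    exact ⟨chartDom (M.chart j) W, chartDom_mono _ inf_le_right, _,
      ⟨y.2.1, fun hy => h (hKi hy), y.2.2⟩, (0 : SuperFun q _).isSmooth, fun z =>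
      extFun_eq_zero hK hf z.2.2.1⟩

/-- The extension of `f (Dx_i)^w` as a superfunction in the chart `j`. -/
def extComp {w : ℝ} {f : SuperFun q (M.dom i)} {K : Set M.space} (hK : IsCompact K)
    (hKi : K ⊆ (M.chart i).source) (hf : VanishesOff i K f) (j : M.Chart) : SuperFun q (M.dom j) :=
  .mk (extFun i w f j) (isSmooth_extFun hK hKi hf j)

/-- On the triple overlap this is the cocycle condition for the powers of the Jacobian; at points
outside the chart i both sides vanish. -/
theorem extComp_compatible {w : ℝ} {f : SuperFun q (M.dom i)} {K : Set M.space} (hK : IsCompact K)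
    (hKi : K ⊆ (M.chart i).source) (hf : VanishesOff i K f) (j k : M.Chart) (y : M.overlap j k) :
    extFun i w f j ⟨y.1, M.overlap_le j k y.2⟩ =
      (M.transfer j k (extComp (w := w) hK hKi hf k)).fn y * grPow (M.ber j k y : Gr q) w := by
  by_cases h : (M.chart j).symm y.1 ∈ M.src i
  · let W : Opens M.space := M.src i ⊓ (M.src j ⊓ M.src k)
    have hi : W ≤ M.src i := inf_le_left
    have hj : W ≤ M.src j := inf_le_right.trans inf_le_left
    have hk : W ≤ M.src k := inf_le_right.trans inf_le_right
    let y' : chartDom (M.chart j) W := ⟨y.1, y.2.1, h, y.2.2⟩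
    obtain ⟨P, hP0, hP, hPc⟩ := exists_jacobian_pow (W := W) hk hi w
    have e1 : SuperFun.res (le_dom hk) (extComp (w := w) hK hKi hf k) =
        tr hk hi (SuperFun.res (le_dom hi) f) * P := by
      ext z
      rw [res_fn, SuperFun.fn_mul, Pi.mul_apply, ← transfer_fn hk hi, hP]
      exact extFun_of_mem w f z.2.2.1
    have e2 := transfer_fn hj hk (extComp (w := w) hK hKi hf k) y'
    rw [e1, map_mul, tr_tr, SuperFun.fn_mul, Pi.mul_apply, ← transfer_fn hj hi] at e2
    change _ = (M.transfer j k (extComp (w := w) hK hKi hf k)).fn ⟨y'.1, le_overlap hj hk y'.2⟩ *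
      grPow (M.ber j k ⟨y'.1, le_overlap hj hk y'.2⟩ : Gr q) w
    rw [extFun_of_mem w f (y := ⟨y.1, M.overlap_le j k y.2⟩) h, e2, mul_assoc,
      (even_commute (tr_parity hj hk hP0 y') _).eq, ← hPc j hj y']
  · rw [extFun_of_notMem w f h]
    let W : Opens M.space := ⟨Kᶜ, (isClosed_of_isCompact hK).isOpen_compl⟩ ⊓ (M.src j ⊓ M.src k)
    have hj : W ≤ M.src j := inf_le_right.trans inf_le_left
    have hk : W ≤ M.src k := inf_le_right.trans inf_le_right
    have hz : SuperFun.res (le_dom hk) (extComp (w := w) hK hKi hf k) = 0 :=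
      SuperFun.ext fun z => extFun_eq_zero hK hf z.2.2.1
    have := transfer_fn hj hk (extComp (w := w) hK hKi hf k)
      ⟨y.1, y.2.1, fun hy => h (hKi hy), y.2.2⟩
    rw [hz, map_zero] at this
    rw [this]
    exact (zero_mul _).symm

/-- The density of weight `w` which is `f (Dx_i)^w` in the chart `i` and zero outside of `K`. -/
def extDens (w : ℝ) {f : SuperFun q (M.dom i)} {K : Set M.space} (hK : IsCompact K)
    (hKi : K ⊆ (M.chart i).source) (hf : VanishesOff i K f) : M.Dens :=
  ⟨fun j => AddMonoidAlgebra.single w (extComp (w := w) hK hKi hf j), fun j k u y => by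
    rw [AddMonoidAlgebra.coeff_single, AddMonoidAlgebra.coeff_single, Finsupp.single_apply,
      Finsupp.single_apply]
    by_cases h : w = u
    · subst h
      rw [if_pos rfl, if_pos rfl]
      exact extComp_compatible hK hKi hf j k y
    · rw [if_neg h, if_neg h, map_zero]
      exact (zero_mul _).symm⟩

section

variable (w : ℝ) {f : SuperFun q (M.dom i)} {K : Set M.space} (hK : IsCompact K)
    (hKi : K ⊆ (M.chart i).source) (hf : VanishesOff i K f)

theorem comp_extDens (j : M.Chart) :
    comp (extDens w hK hKi hf) j w = extComp (w := w) hK hKi hf j := by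
  simp [comp, extDens]

theorem comp_extDens_of_ne (j : M.Chart) {u : ℝ} (h : u ≠ w) :
    comp (extDens w hK hKi hf) j u = 0 := by
  simp [comp, extDens, h.symm]

theorem extDens_mem_densW : extDens w hK hKi hf ∈ M.densW w :=
  fun j _ hu => comp_extDens_of_ne w hK hKi hf j hu

theorem comp_extDens_self : comp (extDens w hK hKi hf) i w = f := by
  rw [comp_extDens]
  ext y
  have h : (M.chart i).symm y.1 ∈ M.src i := y.2.2
  refine (extFun_of_mem w f h).trans ?_
  rw [ber_self, transfer_self]
  exact (congrArg _ (grPow_one_left w)).trans (mul_one _)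

theorem extDens_eq_zero {j : M.Chart} {y : M.dom j} (hy : (M.chart j).symm y.1 ∉ K) (u : ℝ) :
    (comp (extDens w hK hKi hf) j u).fn y = 0 := by
  by_cases h : u = w
  · subst h
    rw [comp_extDens]
    exact extFun_eq_zero hK hf hy
  · rw [comp_extDens_of_ne w hK hKi hf j h]; rfl

theorem extDens_mem_densP {ε : ZMod 2} (hε : HasParity ε f.fn) : extDens w hK hKi hf ∈ M.densP ε := by
  intro j u
  by_cases h : u = w
  · subst h
    rw [comp_extDens]
    intro y
    by_cases hy : (M.chart j).symm y.1 ∈ M.src i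
    · have hj : M.src j ⊓ M.src i ≤ M.src j := inf_le_left
      have hi : M.src j ⊓ M.src i ≤ M.src i := inf_le_right
      change extFun i u f j y ∈ _
      rw [extFun_of_mem u f hy]
      have h1 : (M.transfer j i f).fn ⟨y.1, y.2.1, y.2.2, hy⟩ ∈ grPart q ε := by
        have := transfer_fn hj hi f ⟨y.1, y.2.1, y.2.2, hy⟩
        rw [this]
        exact tr_parity hj hi (fun z => hε _) _
      have h2 := mul_mem_grPart h1 (grPow_mem (M.ber j i ⟨y.1, y.2.1, y.2.2, hy⟩).2
        (M.ber_pos j i _).ne' u)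
      rwa [add_zero] at h2
    · change extFun i u f j y ∈ _
      rw [extFun_of_notMem u f hy]
      exact zero_mem _
  · rw [comp_extDens_of_ne w hK hKi hf j h]
    exact fun y => zero_mem _

end

/-- A density with support in the domain of a chart is determined by its coefficients there. -/
theorem dens_ext_of_vanish {ψ χ : M.Dens} {K : Set M.space} (hKi : K ⊆ (M.chart i).source)
    (hψ : ∀ j w (y : M.dom j), (M.chart j).symm y.1 ∉ K → (comp ψ j w).fn y = 0)
    (hχ : ∀ j w (y : M.dom j), (M.chart j).symm y.1 ∉ K → (comp χ j w).fn y = 0)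
    (h : ∀ w, comp ψ i w = comp χ i w) : ψ = χ := by
  refine Subtype.ext (funext fun j => AddMonoidAlgebra.coeff_inj.1 (Finsupp.ext fun w =>
    SuperFun.ext fun y => ?_))
  by_cases hy : (M.chart j).symm y.1 ∈ M.src i
  · have h1 := ψ.2 j i w ⟨y.1, y.2.1, y.2.2, hy⟩
    have h2 := χ.2 j i w ⟨y.1, y.2.1, y.2.2, hy⟩
    have h3 : (ψ.1 i).coeff w = (χ.1 i).coeff w := h w
    rw [h3, ← h2] at h1
    exact h1
  · exact (hψ j w y fun hK => hy (hKi hK)).trans (hχ j w y fun hK => hy (hKi hK)).symm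

end PosSupermanifold

end SuperGeom

end

noncomputable section

namespace SuperGeom

namespace PosSupermanifold

open Supermanifold Filter Topology

variable {p q : ℕ} {M : PosSupermanifold.{u} p q} {i j k : M.Chart}

/-! ### The algebra of densities -/

@[ext] theorem dens_ext {ψ χ : M.Dens} (h : ∀ i w y, (comp ψ i w).fn y = (comp χ i w).fn y) :
    ψ = χ :=
  Subtype.ext (funext fun i => AddMonoidAlgebra.coeff_inj.1 (Finsupp.ext fun w =>
    SuperFun.ext (h i w)))

/-- The coefficients, as linear maps. -/
def compL (i : M.Chart) (w : ℝ) : M.Dens →ₗ[ℝ] SuperFun q (M.dom i) where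
  toFun ψ := comp ψ i w
  map_add' _ _ := rfl
  map_smul' _ _ := rfl

@[simp] theorem comp_zero (i : M.Chart) (w : ℝ) : comp (0 : M.Dens) i w = 0 := rfl
@[simp] theorem comp_add (ψ χ : M.Dens) (i : M.Chart) (w : ℝ) :
    comp (ψ + χ) i w = comp ψ i w + comp χ i w := rfl
@[simp] theorem comp_sub (ψ χ : M.Dens) (i : M.Chart) (w : ℝ) :
    comp (ψ - χ) i w = comp ψ i w - comp χ i w := rfl
@[simp] theorem comp_smul (r : ℝ) (ψ : M.Dens) (i : M.Chart) (w : ℝ) :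
    comp (r • ψ) i w = r • comp ψ i w := rfl

theorem comp_sum {ι : Type*} (s : Finset ι) (f : ι → M.Dens) (i : M.Chart) (w : ℝ) :
    comp (∑ a ∈ s, f a) i w = ∑ a ∈ s, comp (f a) i w := map_sum (compL i w) f s

theorem comp_mul_left (ψ χ : M.Dens) (i : M.Chart) (w : ℝ) :
    comp (ψ * χ) i w = ∑ u ∈ (ψ.1 i).coeff.support, comp ψ i u * comp χ i (-u + w) :=
  AddMonoidAlgebra.coeff_mul_apply_left (ψ.1 i) (χ.1 i) w

theorem comp_mul_right (ψ χ : M.Dens) (i : M.Chart) (w : ℝ) :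
    comp (ψ * χ) i w = ∑ v ∈ (χ.1 i).coeff.support, comp ψ i (w - v) * comp χ i v := by
  refine (AddMonoidAlgebra.coeff_mul_apply_right (ψ.1 i) (χ.1 i) w).trans ?_
  simp only [sub_eq_add_neg]
  rfl

theorem comp_eq_zero_of_notMem {ψ : M.Dens} {u : ℝ} (h : u ∉ (ψ.1 i).coeff.support) :
    comp ψ i u = 0 := Finsupp.notMem_support_iff.1 h

theorem comp_mul_of_mem_left {u : ℝ} {ψ : M.Dens} (hψ : ψ ∈ M.densW u) (χ : M.Dens) (i : M.Chart)
    (w : ℝ) : comp (ψ * χ) i w = comp ψ i u * comp χ i (w - u) := by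
  rw [comp_mul_left]
  refine (Finset.sum_eq_single u (fun v _ hv => ?_) fun h => ?_).trans (by rw [neg_add_eq_sub])
  · rw [hψ i v hv, zero_mul]
  · rw [comp_eq_zero_of_notMem h, zero_mul]

theorem comp_mul_of_mem_right {v : ℝ} (ψ : M.Dens) {χ : M.Dens} (hχ : χ ∈ M.densW v) (i : M.Chart)
    (w : ℝ) : comp (ψ * χ) i w = comp ψ i (w - v) * comp χ i v := by
  rw [comp_mul_right]
  refine Finset.sum_eq_single v (fun u _ hu => ?_) fun h => ?_
  · rw [hχ i u hu, mul_zero]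
  · rw [comp_eq_zero_of_notMem h, mul_zero]

theorem mul_mem_densW {u v : ℝ} {ψ χ : M.Dens} (hψ : ψ ∈ M.densW u) (hχ : χ ∈ M.densW v) :
    ψ * χ ∈ M.densW (u + v) := by
  intro i w hw
  rw [comp_mul_of_mem_left hψ, hχ i _ (fun h => hw (by linarith)), mul_zero]

theorem comp_one (i : M.Chart) : comp (1 : M.Dens) i 0 = 1 := by
  change (1 : AddMonoidAlgebra (SuperFun q (M.dom i)) ℝ).coeff 0 = 1
  rw [AddMonoidAlgebra.one_def, AddMonoidAlgebra.coeff_single, Finsupp.single_eq_same]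

theorem dens_comm {α β : ZMod 2} {ψ χ : M.Dens} (hψ : ψ ∈ M.densP α) (hχ : χ ∈ M.densP β) :
    ψ * χ = sgn (α * β) • (χ * ψ) := by
  refine Subtype.ext (funext fun i => AddMonoidAlgebra.coeff_inj.1 (Finsupp.ext fun w => ?_))
  change comp (ψ * χ) i w = sgn (α * β) • comp (χ * ψ) i w
  rw [comp_mul_left, comp_mul_right, Finset.smul_sum]
  refine Finset.sum_congr rfl fun u _ => ?_
  rw [neg_add_eq_sub]
  exact superFun_comm (hψ i u) (hχ i _)

/-- The component of parity `ε` of a density. -/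
theorem exists_densP_add (ψ : M.Dens) :
    ∃ ψ₀ ∈ M.densP 0, ∃ ψ₁ ∈ M.densP 1, ψ = ψ₀ + ψ₁ := by
  let P (ε : ZMod 2) (i : M.Chart) : SuperFun q (M.dom i) →+ SuperFun q (M.dom i) :=
    { toFun := fun f => f.proj ε
      map_zero' := SuperFun.ext fun _ => map_zero (grProj q ε)
      map_add' := fun _ _ => SuperFun.ext fun _ => map_add (grProj q ε) _ _ }
  -- Taking parity components respects the gluing: changes of coordinates preserve parity and the
  -- factors J^w are even.
  have hP : ∀ ε i j, M.Compatible i j (AddMonoidAlgebra.map (P ε i) (ψ.1 i))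
      (AddMonoidAlgebra.map (P ε j) (ψ.1 j)) := by
    intro ε i j w y
    have h := ψ.2 i j w y
    change grProj q ε ((comp ψ i w).fn _) = (M.transfer i j ((comp ψ j w).proj ε)).fn y * _
    set F := comp ψ j w
    change (comp ψ i w).fn _ = (M.transfer i j F).fn y * _ at h
    have hpar : ∀ ε, (M.transfer i j (F.proj ε)).fn y ∈ grPart q ε := by
      intro ε
      have hi : M.src i ⊓ M.src j ≤ M.src i := inf_le_left
      have hj : M.src i ⊓ M.src j ≤ M.src j := inf_le_right
      have := transfer_fn hi hj (F.proj ε) ⟨y.1, y.2⟩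
      rw [this]
      exact tr_parity hi hj (fun z => F.hasParity_proj ε _) _
    have hpow := grPow_mem (M.ber i j y).2 (M.ber_pos i j y).ne' w
    have hmem : ∀ ε, (M.transfer i j (F.proj ε)).fn y * grPow (M.ber i j y : Gr q) w ∈
        grPart q ε := fun ε => by
      have := mul_mem_grPart (hpar ε) hpow
      rwa [add_zero] at this
    have hF : (M.transfer i j F).fn y =
        (M.transfer i j (F.proj 0)).fn y + (M.transfer i j (F.proj 1)).fn y := by
      conv_lhs => rw [← F.proj_add, map_add]
      rfl
    rw [h, hF, add_mul, map_add]
    rcases zmod2_cases ε with rfl | rfl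
    · rw [grProj_of_mem (hmem 0), grProj_of_mem_ne (hmem 1) one_ne_zero, add_zero]
    · rw [grProj_of_mem (hmem 1), grProj_of_mem_ne (hmem 0) zero_ne_one, zero_add]
  refine ⟨⟨_, hP 0⟩, fun i w => (comp ψ i w).hasParity_proj 0, ⟨_, hP 1⟩,
    fun i w => (comp ψ i w).hasParity_proj 1, ?_⟩
  ext i w y
  exact congrArg (fun F : SuperFun q (M.dom i) => F.fn y) (comp ψ i w).proj_add.symm

theorem induction_densP {P : M.Dens → Prop} (ψ : M.Dens) (hadd : ∀ a b, P a → P b → P (a + b))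
    (h : ∀ ε, ∀ a ∈ M.densP ε, P a) : P ψ := by
  obtain ⟨a, ha, b, hb, rfl⟩ := exists_densP_add ψ
  exact hadd _ _ (h 0 a ha) (h 1 b hb)

/-! ### Supports -/

/-- The density `ψ` vanishes on `U`. -/
def VanishesOn (U : Set M.space) (ψ : M.Dens) : Prop :=
  ∀ j w (y : M.dom j), (M.chart j).symm y.1 ∈ U → (comp ψ j w).fn y = 0

theorem VanishesOn.mono {U V : Set M.space} {ψ : M.Dens} (h : VanishesOn V ψ) (hU : U ⊆ V) :
    VanishesOn U ψ := fun j w y hy => h j w y (hU hy)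

theorem VanishesOn.mul_left {U : Set M.space} {ψ : M.Dens} (h : VanishesOn U ψ) (χ : M.Dens) :
    VanishesOn U (χ * ψ) := fun j w y hy => by
  rw [comp_mul_left, SuperFun.fn_finset_sum]
  exact Finset.sum_eq_zero fun u _ => by
    rw [SuperFun.fn_mul, Pi.mul_apply, h j _ y hy, mul_zero]

theorem VanishesOn.mul_right {U : Set M.space} {ψ : M.Dens} (h : VanishesOn U ψ) (χ : M.Dens) :
    VanishesOn U (ψ * χ) := fun j w y hy => by
  rw [comp_mul_left, SuperFun.fn_finset_sum]
  exact Finset.sum_eq_zero fun u _ => by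
    rw [SuperFun.fn_mul, Pi.mul_apply, h j _ y hy, zero_mul]

theorem VanishesOn.add {U : Set M.space} {ψ χ : M.Dens} (h : VanishesOn U ψ)
    (h' : VanishesOn U χ) : VanishesOn U (ψ + χ) := fun j w y hy => by
  rw [comp_add, SuperFun.fn_add, Pi.add_apply, h j w y hy, h' j w y hy, add_zero]

theorem vanishesOn_of_chart {U : Opens M.space} (hU : U ≤ M.src i) {ψ : M.Dens}
    (h : ∀ w (y : M.dom i), (M.chart i).symm y.1 ∈ U → (comp ψ i w).fn y = 0) :
    VanishesOn U ψ := fun j w y hy => by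
  have hj : U ⊓ M.src j ≤ M.src j := inf_le_right
  have hi : U ⊓ M.src j ≤ M.src i := inf_le_left.trans hU
  let y' : chartDom (M.chart j) (U ⊓ M.src j) := ⟨y.1, y.2.1, hy, y.2.2⟩
  have h1 := ψ.2 j i w ⟨y.1, le_overlap hj hi y'.2⟩
  have h2 : SuperFun.res (le_dom hi) (comp ψ i w) = 0 := SuperFun.ext fun z => h w _ z.2.2.1
  have h3 := transfer_fn hj hi (comp ψ i w) y'
  rw [h2, map_zero] at h3
  exact h1.trans ((congrArg (· * _) h3).trans (zero_mul _))

/-! ### Bump functions -/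

/-- Smooth functions with compact support in an open subset of `ℝ^p`. -/
structure Bump (V : Opens (Fin p → ℝ)) where
  toFun : (Fin p → ℝ) → ℝ
  contDiff : ContDiff ℝ ∞ toFun
  hasCompactSupport : HasCompactSupport toFun
  tsupport_subset : tsupport toFun ⊆ V

/-- The bump function as a superfunction. -/
def Bump.superFun {V : Opens (Fin p → ℝ)} (q : ℕ) (b : Bump V) : SuperFun q V :=
  ofReal b.toFun b.contDiff.contDiffOn

/-- The support on the manifold of a bump function in a chart. -/
def Bump.carrier (b : Bump (M.dom i)) : Set M.space := (M.chart i).symm '' tsupport b.toFun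

theorem Bump.isCompact_carrier (b : Bump (M.dom i)) : IsCompact b.carrier :=
  b.hasCompactSupport.isCompact.image_of_continuousOn
    ((M.chart i).continuousOn_symm.mono fun _ hy => (b.tsupport_subset hy).1)

theorem Bump.carrier_subset (b : Bump (M.dom i)) : b.carrier ⊆ (M.chart i).source := by
  rintro _ ⟨y, hy, rfl⟩
  exact (M.chart i).map_target (b.tsupport_subset hy).1

theorem Bump.eq_zero (b : Bump (M.dom i)) {y : M.dom i} (hy : (M.chart i).symm y.1 ∉ b.carrier) :
    b.toFun y.1 = 0 := by
  by_contra h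
  exact hy ⟨y.1, subset_tsupport _ h, rfl⟩

theorem Bump.vanishesOff (b : Bump (M.dom i)) (f : SuperFun q (M.dom i)) :
    VanishesOff i b.carrier (b.superFun q * f) := fun y hy => by
  rw [SuperFun.fn_mul, Pi.mul_apply, Bump.superFun, fn_ofReal, b.eq_zero hy, map_zero, zero_mul]

theorem Bump.exists_near {K O : Set M.space} (hK : IsCompact K) (hO : IsOpen O) (hKO : K ⊆ O)
    (hKi : K ⊆ (M.chart i).source) : ∃ b : Bump (M.dom i), b.carrier ⊆ O ∧
      ∃ U : Opens M.space, K ⊆ U ∧ U ≤ M.src i ∧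
        ∀ y : M.dom i, (M.chart i).symm y.1 ∈ U → b.toFun y.1 = 1 := by
  let W : Opens M.space := ⟨O, hO⟩ ⊓ M.src i
  have hW : (M.chart i) '' K ⊆ chartDom (M.chart i) W := by
    rintro _ ⟨x, hx, rfl⟩
    refine ⟨(M.chart i).map_source (hKi hx), ?_⟩
    rw [mem_preimage, (M.chart i).left_inv (hKi hx)]
    exact ⟨hKO hx, hKi hx⟩
  obtain ⟨b, hb, hc, hs, h1⟩ := exists_bump
    (hK.image_of_continuousOn ((M.chart i).continuousOn.mono hKi)) (chartDom (M.chart i) W).isOpen hW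
  refine ⟨⟨b, hb, hc, hs.trans (chartDom_mono _ inf_le_right)⟩, ?_, ?_⟩
  · rintro _ ⟨y, hy, rfl⟩
    exact (hs hy).2.1
  · rw [eventually_nhdsSet_iff_exists] at h1
    obtain ⟨V, hVo, hKV, hV⟩ := h1
    refine ⟨⟨(M.chart i).source ∩ M.chart i ⁻¹' V, (M.chart i).isOpen_inter_preimage hVo⟩,
      fun x hx => ⟨hKi hx, hKV ⟨x, hx, rfl⟩⟩, fun x hx => hx.1, fun y hy => hV _ ?_⟩
    have := hy.2
    rwa [mem_preimage, (M.chart i).right_inv y.2.1] at this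

/-- The density `b f (Dx_i)^w`, for a bump function `b`. -/
def bumpExt (b : Bump (M.dom i)) (w : ℝ) : SuperFun q (M.dom i) →ₗ[ℝ] M.Dens where
  toFun f := extDens w b.isCompact_carrier b.carrier_subset (b.vanishesOff f)
  map_add' f g := by
    refine dens_ext_of_vanish b.carrier_subset (fun j u y hy => extDens_eq_zero _ _ _ _ hy u)
      (fun j u y hy => ?_) fun u => ?_
    · rw [comp_add, SuperFun.fn_add, Pi.add_apply, extDens_eq_zero _ _ _ _ hy,
        extDens_eq_zero _ _ _ _ hy, add_zero]
    · by_cases h : u = w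
      · subst h
        rw [comp_add, comp_extDens_self, comp_extDens_self, comp_extDens_self, mul_add]
      · rw [comp_add, comp_extDens_of_ne _ _ _ _ _ h, comp_extDens_of_ne _ _ _ _ _ h,
          comp_extDens_of_ne _ _ _ _ _ h, add_zero]
  map_smul' r f := by
    refine dens_ext_of_vanish b.carrier_subset (fun j u y hy => extDens_eq_zero _ _ _ _ hy u)
      (fun j u y hy => ?_) fun u => ?_
    · rw [comp_smul, SuperFun.fn_smul, Pi.smul_apply, extDens_eq_zero _ _ _ _ hy, smul_zero]
    · by_cases h : u = w
      · subst h
        rw [comp_smul, comp_extDens_self, comp_extDens_self, mul_smul_comm]; rfl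
      · rw [comp_smul, comp_extDens_of_ne _ _ _ _ _ h, comp_extDens_of_ne _ _ _ _ _ h, smul_zero]

section

variable (b : Bump (M.dom i)) (w : ℝ) (f : SuperFun q (M.dom i))

theorem bumpExt_mem_densW : bumpExt b w f ∈ M.densW w := extDens_mem_densW _ _ _ _

theorem bumpExt_mem_densP {ε : ZMod 2} {f : SuperFun q (M.dom i)} (hf : HasParity ε f.fn) :
    bumpExt b w f ∈ M.densP ε := extDens_mem_densP _ _ _ _ fun y => by
  have := mul_mem_grPart (hasParity_ofReal b.toFun b.contDiff.contDiffOn y) (hf y)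
  rwa [zero_add] at this

theorem comp_bumpExt : comp (bumpExt b w f) i w = b.superFun q * f := comp_extDens_self _ _ _ _

theorem comp_bumpExt_fn (y : M.dom i) : (comp (bumpExt b w f) i w).fn y = b.toFun y.1 • f.fn y := by
  rw [comp_bumpExt, SuperFun.fn_mul, Pi.mul_apply, Bump.superFun, fn_ofReal, Algebra.smul_def]

theorem vanishesOn_bumpExt : VanishesOn b.carrierᶜ (bumpExt b w f) :=
  fun _ u _ hy => extDens_eq_zero _ _ _ _ hy u

/-- The bump function as a function on the supermanifold. -/
def Bump.dens (b : Bump (M.dom i)) : M.Dens := bumpExt b 0 1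

theorem Bump.dens_mem_densW : b.dens ∈ M.densW 0 := bumpExt_mem_densW _ _ _

theorem Bump.dens_mem_densP : b.dens ∈ M.densP 0 := bumpExt_mem_densP _ _ fun _ => one_mem_grPart

theorem comp_bump_mul (ψ : M.Dens) : comp (b.dens * ψ) i w = b.superFun q * comp ψ i w := by
  rw [comp_mul_of_mem_left b.dens_mem_densW, Bump.dens, comp_bumpExt, mul_one, sub_zero]

theorem comp_bump_mul_fn (ψ : M.Dens) (y : M.dom i) :
    (comp (b.dens * ψ) i w).fn y = b.toFun y.1 • (comp ψ i w).fn y := by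
  rw [comp_bump_mul, SuperFun.fn_mul, Pi.mul_apply, Bump.superFun, fn_ofReal, Algebra.smul_def]

theorem bump_mul_eq_zero {U : Set M.space} {ψ : M.Dens} (hψ : VanishesOn U ψ) (hb : b.carrier ⊆ U) :
    b.dens * ψ = 0 := by
  ext j w y
  by_cases hy : (M.chart j).symm y.1 ∈ U
  · exact hψ.mul_left _ j w y hy
  · exact (vanishesOn_bumpExt b 0 1).mul_right ψ j w y fun h => hy (hb h)

/-- Cutting off a density by a bump function. -/
theorem bump_mul_eq_sum (ψ : M.Dens) :
    b.dens * ψ = ∑ w ∈ (ψ.1 i).coeff.support, bumpExt b w (comp ψ i w) := by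
  refine dens_ext_of_vanish b.carrier_subset ((vanishesOn_bumpExt b 0 1).mul_right ψ)
    (fun j u y hy => ?_) fun u => ?_
  · rw [comp_sum, SuperFun.fn_finset_sum]
    exact Finset.sum_eq_zero fun w _ => vanishesOn_bumpExt b w _ j u y hy
  · rw [comp_bump_mul, comp_sum, Finset.sum_eq_single u, comp_bumpExt]
    · exact fun v _ hv => bumpExt_mem_densW b v _ i u hv.symm
    · intro h
      rw [comp_bumpExt, comp_eq_zero_of_notMem h, mul_zero]

end

end PosSupermanifold

end SuperGeom

end

noncomputable section

namespace SuperGeom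

namespace PosSupermanifold

open Supermanifold Filter Topology

variable {p q : ℕ} {M : PosSupermanifold.{u} p q} {i j k : M.Chart}

/-! ### Local operators -/

theorem Bump.exists_at {O : Set M.space} (hO : IsOpen O) (y : M.dom i)
    (hy : (M.chart i).symm y.1 ∈ O) : ∃ b : Bump (M.dom i), b.carrier ⊆ O ∧
      ∃ U : Opens M.space, (M.chart i).symm y.1 ∈ U ∧ U ≤ M.src i ∧
        ∀ z : M.dom i, (M.chart i).symm z.1 ∈ U → b.toFun z.1 = 1 := by
  obtain ⟨b, hb, U, hU, h⟩ := Bump.exists_near (i := i) isCompact_singleton hO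
    (singleton_subset_iff.2 hy) (singleton_subset_iff.2 y.2.2)
  exact ⟨b, hb, U, singleton_subset_iff.1 hU, h⟩

/-- For a bump function b supported in U and equal to 1 near the point, bχ = 0, hence 0 = {φ,b}χ +
b{φ,χ}; at the point this reads {φ,χ} = 0. -/
theorem OddLongBracket.vanishesOn (B : OddLongBracket M) {α : ZMod 2} {φ χ : M.Dens}
    (hφ : φ ∈ M.densP α) {U : Opens M.space} (hχ : VanishesOn U χ) :
    VanishesOn U (B.bracket φ χ) := fun j w y hy => by
  obtain ⟨b, hb, V, hyV, -, hV⟩ := Bump.exists_at (i := j) U.isOpen y hy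
  have h := B.leibniz α 0 φ hφ b.dens b.dens_mem_densP χ
  rw [bump_mul_eq_zero b hχ hb, map_zero, mul_zero, sgn_zero, one_smul] at h
  have h1 := congrArg (fun ψ => (comp ψ j w).fn y) h
  simp only [comp_add, SuperFun.fn_add, Pi.add_apply, comp_bump_mul_fn, hV y hyV, one_smul] at h1
  rw [hχ.mul_left _ j w y hy, zero_add] at h1
  exact h1.symm

/-- The operator `L` does not increase supports and preserves the weights. -/
structure IsLocalOp (L : M.Dens →ₗ[ℝ] M.Dens) : Prop where
  vanishesOn : ∀ (U : Opens M.space) (ψ : M.Dens), VanishesOn U ψ → VanishesOn U (L ψ)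
  weight : ∀ w, ∀ ψ ∈ M.densW w, L ψ ∈ M.densW w

/-- The same cut-off argument, applied to {b,χ} = Δ(bχ) − (Δb)χ − bΔχ: every term except bΔχ is
known to vanish at the point. -/
theorem IsCanonicalPencil.isLocalOp {B : OddLongBracket M} {Δ : M.Dens →ₗ[ℝ] M.Dens}
    (hΔ : IsCanonicalPencil B Δ) : IsLocalOp Δ where
  vanishesOn U χ hχ j w y hy := by
    obtain ⟨b, hb, V, hyV, -, hV⟩ := Bump.exists_at (i := j) U.isOpen y hy
    have h := hΔ.generates 0 b.dens b.dens_mem_densP χ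
    rw [bump_mul_eq_zero b hχ hb, map_zero, sgn_zero, one_smul] at h
    have h1 := congrArg (fun ψ => (comp ψ j w).fn y) h
    simp only [comp_sub, SuperFun.fn_sub, Pi.sub_apply, comp_bump_mul_fn, hV y hyV, one_smul] at h1
    rw [hχ.mul_left _ j w y hy, B.vanishesOn b.dens_mem_densP hχ j w y hy, comp_zero] at h1
    have h2 : (0 : Gr q) = 0 - 0 - (comp (Δ χ) j w).fn y := h1
    rw [sub_zero, zero_sub] at h2
    exact neg_eq_zero.1 h2.symm
  weight := hΔ.weight

theorem IsLocalOp.compose {L L' : M.Dens →ₗ[ℝ] M.Dens} (h : IsLocalOp L) (h' : IsLocalOp L') :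
    IsLocalOp (L ∘ₗ L') where
  vanishesOn U ψ hψ := h.vanishesOn U _ (h'.vanishesOn U ψ hψ)
  weight w ψ hψ := h.weight w _ (h'.weight w ψ hψ)

theorem IsLocalOp.compactlySupportedIn {L : M.Dens →ₗ[ℝ] M.Dens} (h : IsLocalOp L) {χ : M.Dens}
    (hχ : CompactlySupportedIn i χ) : CompactlySupportedIn i (L χ) := by
  obtain ⟨K, hK, hKi, hv⟩ := hχ
  exact ⟨K, hK, hKi, h.vanishesOn ⟨Kᶜ, (isClosed_of_isCompact hK).isOpen_compl⟩ χ hv⟩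

theorem IsLocalOp.congr {L : M.Dens →ₗ[ℝ] M.Dens} (h : IsLocalOp L) {U : Opens M.space} {ψ χ : M.Dens}
    (hU : U ≤ M.src i)
    (hψ : ∀ u (y : M.dom i), (M.chart i).symm y.1 ∈ U → (comp ψ i u).fn y = (comp χ i u).fn y)
    (w : ℝ) (y : M.dom i) (hy : (M.chart i).symm y.1 ∈ U) :
    (comp (L ψ) i w).fn y = (comp (L χ) i w).fn y := by
  have := h.vanishesOn U (ψ - χ) (vanishesOn_of_chart hU fun u z hz => by
    rw [comp_sub, SuperFun.fn_sub, Pi.sub_apply, hψ u z hz, sub_self]) i w y hy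
  rw [map_sub, comp_sub, SuperFun.fn_sub, Pi.sub_apply, sub_eq_zero] at this
  exact this

theorem eventually_of_opens {U : Opens M.space} {y : M.dom i} (hy : (M.chart i).symm y.1 ∈ U)
    {P : M.dom i → Prop} (h : ∀ z : M.dom i, (M.chart i).symm z.1 ∈ U → P z) :
    ∀ᶠ z in 𝓝 y, P z :=
  chartDom_mem_nhds (W' := U ⊓ M.src i) (W := M.src i) inf_le_right ⟨hy, y.2.2⟩ fun z =>
    h _ z.2.2.1

theorem exists_opens {y : M.dom i} {P : M.dom i → Prop} (h : ∀ᶠ z in 𝓝 y, P z) :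
    ∃ U : Opens M.space, U ≤ M.src i ∧ (M.chart i).symm y.1 ∈ U ∧
      ∀ z : M.dom i, (M.chart i).symm z.1 ∈ U → P z := by
  obtain ⟨U, hU, hy, h'⟩ := exists_opens_of_eventually (W := M.src i) le_rfl h
  exact ⟨U, hU, hy, fun z hz => h' ⟨z.1, z.2.1, hz⟩⟩

/-- A bump function equal to `1` near a point. -/
def bumpAt (y : M.dom i) : Bump (M.dom i) :=
  (Bump.exists_at (i := i) isOpen_univ y (mem_univ _)).choose

theorem bumpAt_spec (y : M.dom i) : ∃ U : Opens M.space, (M.chart i).symm y.1 ∈ U ∧ U ≤ M.src i ∧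
    ∀ z : M.dom i, (M.chart i).symm z.1 ∈ U → (bumpAt y).toFun z.1 = 1 :=
  (Bump.exists_at (i := i) isOpen_univ y (mem_univ _)).choose_spec.2

theorem comp_bumpAt (y : M.dom i) (w : ℝ) (f : SuperFun q (M.dom i)) :
    (comp (bumpExt (bumpAt y) w f) i w).fn =ᶠ[𝓝 y] f.fn := by
  obtain ⟨U, hy, -, h⟩ := bumpAt_spec y
  exact eventually_of_opens hy fun z hz => by rw [comp_bumpExt_fn, h z hz, one_smul]

theorem IsLocalOp.eventuallyEq {L : M.Dens →ₗ[ℝ] M.Dens} (h : IsLocalOp L) {w : ℝ} {ψ χ : M.Dens}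
    (hψ : ψ ∈ M.densW w) (hχ : χ ∈ M.densW w) {y : M.dom i}
    (hy : (comp ψ i w).fn =ᶠ[𝓝 y] (comp χ i w).fn) :
    (comp (L ψ) i w).fn =ᶠ[𝓝 y] (comp (L χ) i w).fn := by
  obtain ⟨U, hU, hyU, hP⟩ := exists_opens hy
  refine eventually_of_opens hyU fun z hz => h.congr hU (fun u z hz => ?_) w z hz
  by_cases hu : u = w
  · subst hu; exact hP z hz
  · rw [hψ i u hu, hχ i u hu]

theorem fn_mk_apply {V : Opens (Fin p → ℝ)} (f : V → Gr q) (hf : IsSmooth f) (y : V) :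
    (SuperFun.mk f hf).fn y = f y := rfl

/-- The bump function varies with the point, but by locality the value depends only on the germ of
f. So near y the single density built at y computes all the values. -/
theorem isSmooth_locFun {L : M.Dens →ₗ[ℝ] M.Dens} (hL : IsLocalOp L) (i : M.Chart) (w : ℝ)
    (f : SuperFun q (M.dom i)) :
    IsSmooth fun y => (comp (L (bumpExt (bumpAt y) w f)) i w).fn y :=
  isSmooth_of_locally fun y => by
    refine ⟨_, (comp (L (bumpExt (bumpAt y) w f)) i w).isSmooth, ?_⟩
    have h := (comp_bumpAt y w f).eventuallyEq_nhds
    exact h.mono fun z hz => (hL.eventuallyEq (bumpExt_mem_densW _ _ _)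
      (bumpExt_mem_densW _ _ _) ((comp_bumpAt z w f).trans hz.symm)).eq_of_nhds

/-- The value on a superfunction in the chart `i` of a local operator on the densities of
weight `w`. -/
def locFun {L : M.Dens →ₗ[ℝ] M.Dens} (hL : IsLocalOp L) (i : M.Chart) (w : ℝ)
    (f : SuperFun q (M.dom i)) : SuperFun q (M.dom i) :=
  .mk (fun y => (comp (L (bumpExt (bumpAt y) w f)) i w).fn y) (isSmooth_locFun hL i w f)

theorem locFun_fn {L : M.Dens →ₗ[ℝ] M.Dens} (hL : IsLocalOp L) (i : M.Chart) (w : ℝ)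
    (f : SuperFun q (M.dom i)) (y : M.dom i) :
    (locFun hL i w f).fn y = (comp (L (bumpExt (bumpAt y) w f)) i w).fn y :=
  fn_mk_apply _ (isSmooth_locFun hL i w f) y

theorem locFun_add {L : M.Dens →ₗ[ℝ] M.Dens} (hL : IsLocalOp L) (i : M.Chart) (w : ℝ)
    (f g : SuperFun q (M.dom i)) : locFun hL i w (f + g) = locFun hL i w f + locFun hL i w g := by
  refine SuperFun.ext fun y => ?_
  rw [SuperFun.fn_add, Pi.add_apply, locFun_fn, locFun_fn, locFun_fn, map_add, map_add, comp_add,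
    SuperFun.fn_add, Pi.add_apply]

theorem locFun_smul {L : M.Dens →ₗ[ℝ] M.Dens} (hL : IsLocalOp L) (i : M.Chart) (w : ℝ)
    (r : ℝ) (f : SuperFun q (M.dom i)) : locFun hL i w (r • f) = r • locFun hL i w f := by
  refine SuperFun.ext fun y => ?_
  rw [SuperFun.fn_smul, Pi.smul_apply, locFun_fn, locFun_fn, map_smul, map_smul, comp_smul,
    SuperFun.fn_smul, Pi.smul_apply]

/-- The operator on superfunctions in the chart `i` induced by a local operator on the densities of
weight `w`. -/
def locOp {L : M.Dens →ₗ[ℝ] M.Dens} (hL : IsLocalOp L) (i : M.Chart) (w : ℝ) :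
    SuperFun q (M.dom i) →ₗ[ℝ] SuperFun q (M.dom i) where
  toFun := locFun hL i w
  map_add' := locFun_add hL i w
  map_smul' := locFun_smul hL i w

theorem locOp_fn {L : M.Dens →ₗ[ℝ] M.Dens} (hL : IsLocalOp L) (i : M.Chart) (w : ℝ)
    (f : SuperFun q (M.dom i)) (y : M.dom i) :
    (locOp hL i w f).fn y = (comp (L (bumpExt (bumpAt y) w f)) i w).fn y := locFun_fn hL i w f y

section

variable {L L' : M.Dens →ₗ[ℝ] M.Dens} (hL : IsLocalOp L) (hL' : IsLocalOp L')

theorem locOp_eq {w : ℝ} {ψ : M.Dens} (hψ : ψ ∈ M.densW w) {y : M.dom i} {f : SuperFun q (M.dom i)}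
    (h : (comp ψ i w).fn =ᶠ[𝓝 y] f.fn) : (comp (L ψ) i w).fn =ᶠ[𝓝 y] (locOp hL i w f).fn :=
  h.eventuallyEq_nhds.mono fun z hz => by
    rw [locOp_fn]
    exact (hL.eventuallyEq hψ (bumpExt_mem_densW _ _ _)
      (hz.trans (comp_bumpAt z w f).symm)).eq_of_nhds

theorem locOp_comp (i : M.Chart) (w : ℝ) (f : SuperFun q (M.dom i)) :
    locOp (hL.compose hL') i w f = locOp hL i w (locOp hL' i w f) := by
  ext y
  have hm := bumpExt_mem_densW (bumpAt y) w f
  rw [← (locOp_eq (hL.compose hL') hm (comp_bumpAt y w f)).eq_of_nhds]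
  exact (locOp_eq hL (hL'.weight w _ hm) (locOp_eq hL' hm (comp_bumpAt y w f))).eq_of_nhds

/-- A density may have several weights, whereas `locOp` is defined from pure ones. Cut off near the
point, ψ is a finite sum of pure densities, of which only that of weight w contributes. -/
theorem comp_locOp (ψ : M.Dens) (i : M.Chart) (w : ℝ) :
    comp (L ψ) i w = locOp hL i w (comp ψ i w) := by
  ext y
  obtain ⟨U, hy, hUi, hU⟩ := bumpAt_spec y
  have h1 : (comp (L ψ) i w).fn y = (comp (L ((bumpAt y).dens * ψ)) i w).fn y :=
    hL.congr hUi (fun u z hz => by rw [comp_bump_mul_fn, hU z hz, one_smul]) w y hy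
  rw [h1, bump_mul_eq_sum, map_sum, comp_sum, SuperFun.fn_finset_sum, Finset.sum_eq_single w]
  · exact (locOp_eq hL (bumpExt_mem_densW _ _ _) (comp_bumpAt y w _)).eq_of_nhds
  · intro u _ hu
    rw [hL.weight u _ (bumpExt_mem_densW _ _ _) i w hu.symm]; rfl
  · intro h
    rw [comp_eq_zero_of_notMem h, map_zero, map_zero]; rfl

theorem locOp_congr {w : ℝ} {f g : SuperFun q (M.dom i)} {y : M.dom i} (h : f.fn =ᶠ[𝓝 y] g.fn) :
    (locOp hL i w f).fn =ᶠ[𝓝 y] (locOp hL i w g).fn :=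
  (locOp_eq hL (bumpExt_mem_densW (bumpAt y) w f) (comp_bumpAt y w f)).symm.trans
    (locOp_eq hL (bumpExt_mem_densW _ _ _) ((comp_bumpAt y w f).trans h))

theorem locOp_parity {ε : ZMod 2} (h : ∀ α, ∀ ψ ∈ M.densP α, L ψ ∈ M.densP (α + ε)) {w : ℝ}
    {α : ZMod 2} {f : SuperFun q (M.dom i)} (hf : HasParity α f.fn) :
    HasParity (α + ε) (locOp hL i w f).fn := fun y => by
  rw [← (locOp_eq hL (bumpExt_mem_densW _ _ _) (comp_bumpAt y w f)).eq_of_nhds]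
  exact h α _ (bumpExt_mem_densP _ _ hf) i w y

theorem locOp_one (h : L 1 = 0) (i : M.Chart) : locOp hL i 0 1 = 0 := by
  rw [← comp_one (M := M) i, ← comp_locOp hL, h, comp_zero]

theorem VanishesOff.locOp {K : Set M.space} (hK : IsCompact K) {f : SuperFun q (M.dom i)}
    (hf : VanishesOff i K f) (w : ℝ) : VanishesOff i K (locOp hL i w f) := fun y hy => by
  have h : f.fn =ᶠ[𝓝 y] (0 : SuperFun q (M.dom i)).fn :=
    eventually_of_opens (U := ⟨Kᶜ, (isClosed_of_isCompact hK).isOpen_compl⟩) hy fun z hz => hf z hz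
  rw [(locOp_congr hL h).eq_of_nhds, map_zero]; rfl

end

/-! ### Formal adjoints in a chart -/

/-- The weight 1 − w makes the products have weight 1. The superfunction f is not compactly
supported, so it is replaced by bf with b = 1 near K, which changes neither integrand. -/
theorem AdjointEq.locOp {ε : ZMod 2} {σ : ℝ} {L : M.Dens →ₗ[ℝ] M.Dens} (h : AdjointEq ε σ L)
    (hL : IsLocalOp L) {α : ZMod 2} {w : ℝ} {f g : SuperFun q (M.dom i)} (hf : HasParity α f.fn)
    {K : Set M.space} (hK : IsCompact K) (hKi : K ⊆ (M.chart i).source) (hg : VanishesOff i K g) :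
    berezinIntegral (locOp hL i w f * g).fn =
      σ * sgn (ε * α) * berezinIntegral (f * locOp hL i (1 - w) g).fn := by
  obtain ⟨b, -, U, hKU, hUi, hU⟩ := Bump.exists_near (i := i) hK isOpen_univ (subset_univ _) hKi
  have hχ := extDens_mem_densW (1 - w) hK hKi hg
  have h1 := h i α (bumpExt b w f) (bumpExt_mem_densP b w hf) (extDens (1 - w) hK hKi hg)
    ⟨K, hK, hKi, fun j u y hy => extDens_eq_zero _ hK hKi hg hy u⟩
  rw [PosSupermanifold.integral, PosSupermanifold.integral, comp_mul_of_mem_right _ hχ,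
    comp_mul_of_mem_right _ (hL.weight _ _ hχ), sub_sub_cancel, comp_locOp hL, comp_locOp hL,
    comp_extDens_self] at h1
  have e1 : PosSupermanifold.locOp hL i w (comp (bumpExt b w f) i w) * g =
      PosSupermanifold.locOp hL i w f * g := by
    ext y
    rw [SuperFun.fn_mul, SuperFun.fn_mul, Pi.mul_apply, Pi.mul_apply]
    by_cases hy : (M.chart i).symm y.1 ∈ K
    · rw [(locOp_congr hL (eventually_of_opens (hKU hy) fun z hz => ?_)).eq_of_nhds]
      rw [comp_bumpExt_fn, hU z hz, one_smul]
    · rw [hg y hy, mul_zero, mul_zero]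
  have e2 : comp (bumpExt b w f) i w * PosSupermanifold.locOp hL i (1 - w) g =
      f * PosSupermanifold.locOp hL i (1 - w) g := by
    ext y
    rw [SuperFun.fn_mul, SuperFun.fn_mul, Pi.mul_apply, Pi.mul_apply]
    by_cases hy : (M.chart i).symm y.1 ∈ K
    · rw [comp_bumpExt_fn, hU y (hKU hy), one_smul]
    · rw [hg.locOp hL hK _ y hy, mul_zero, mul_zero]
  rwa [e1, e2] at h1

end PosSupermanifold

end SuperGeom

end

noncomputable section

namespace SuperGeom

namespace PosSupermanifold

open Supermanifold Filter Topology MeasureTheory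

variable {p q : ℕ} {M : PosSupermanifold.{u} p q} {i j k : M.Chart}

/-! ### Berezin integrals of superfunctions with compact support -/

theorem VanishesOff.mul_left {K : Set M.space} {f : SuperFun q (M.dom i)} (hf : VanishesOff i K f)
    (g : SuperFun q (M.dom i)) : VanishesOff i K (g * f) := fun y hy => by
  rw [SuperFun.fn_mul, Pi.mul_apply, hf y hy, mul_zero]

theorem VanishesOff.pd {K : Set M.space} (hK : IsCompact K) {f : SuperFun q (M.dom i)}
    (hf : VanishesOff i K f) (a : CoordIdx p q) : VanishesOff i K (SuperFun.pd a f) := fun y hy => by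
  have h : f.fn =ᶠ[𝓝 y] (0 : SuperFun q (M.dom i)).fn :=
    eventually_of_opens (U := ⟨Kᶜ, (isClosed_of_isCompact hK).isOpen_compl⟩) hy fun z hz => hf z hz
  rw [fn_pd, pd_congr a h, ← fn_pd, map_zero]; rfl

section

variable {K : Set M.space} {f g : SuperFun q (M.dom i)}

theorem tsupport_coeffAt_subset (hK : IsCompact K) (hKi : K ⊆ (M.chart i).source)
    (hf : VanishesOff i K f) (I : Finset (Fin q)) :
    tsupport (coeffAt f.fn I) ⊆ (M.chart i) '' K := by
  refine closure_minimal (fun y hy => ?_)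
    (hK.image_of_continuousOn ((M.chart i).continuousOn.mono hKi)).isClosed
  by_contra hc
  refine hy ?_
  by_cases hyd : y ∈ M.dom i
  · rw [coeffAt_apply _ I ⟨y, hyd⟩, hf ⟨y, hyd⟩ fun hm => hc ⟨_, hm, (M.chart i).right_inv hyd.1⟩,
      map_zero]; rfl
  · exact coeffAt_of_notMem _ _ hyd

theorem hasCompactSupport_coeffAt (hK : IsCompact K) (hKi : K ⊆ (M.chart i).source)
    (hf : VanishesOff i K f) (I : Finset (Fin q)) : HasCompactSupport (coeffAt f.fn I) :=
  (hK.image_of_continuousOn ((M.chart i).continuousOn.mono hKi)).of_isClosed_subset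
    (isClosed_tsupport _) (tsupport_coeffAt_subset hK hKi hf I)

theorem contDiff_coeffAt (hK : IsCompact K) (hKi : K ⊆ (M.chart i).source)
    (hf : VanishesOff i K f) (I : Finset (Fin q)) : ContDiff ℝ ∞ (coeffAt f.fn I) := by
  refine contDiff_iff_contDiffAt.2 fun y => ?_
  by_cases hy : y ∈ tsupport (coeffAt f.fn I)
  · obtain ⟨x, hx, rfl⟩ := tsupport_coeffAt_subset hK hKi hf I hy
    exact (f.contDiffOn I).contDiffAt ((M.dom i).isOpen.mem_nhds
      (mem_dom_iff.2 ((M.chart i).map_source (hKi hx))))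
  · exact contDiffAt_const.congr_of_eventuallyEq (notMem_tsupport_iff_eventuallyEq.1 hy)

theorem integrable_coeffAt (hK : IsCompact K) (hKi : K ⊆ (M.chart i).source)
    (hf : VanishesOff i K f) (I : Finset (Fin q)) : Integrable (coeffAt f.fn I) :=
  (contDiff_coeffAt hK hKi hf I).continuous.integrable_of_hasCompactSupport
    (hasCompactSupport_coeffAt hK hKi hf I)

theorem coeffAt_add (f g : SuperFun q (M.dom i)) (I : Finset (Fin q)) (y : Fin p → ℝ) :
    coeffAt (f + g).fn I y = coeffAt f.fn I y + coeffAt g.fn I y := by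
  by_cases hy : y ∈ M.dom i
  · rw [coeffAt_apply _ I ⟨y, hy⟩, coeffAt_apply _ I ⟨y, hy⟩, coeffAt_apply _ I ⟨y, hy⟩,
      SuperFun.fn_add, Pi.add_apply, map_add]; rfl
  · rw [coeffAt_of_notMem _ _ hy, coeffAt_of_notMem _ _ hy, coeffAt_of_notMem _ _ hy, add_zero]

theorem berezinIntegral_add (hK : IsCompact K) (hKi : K ⊆ (M.chart i).source)
    (hf : VanishesOff i K f) (hg : VanishesOff i K g) :
    berezinIntegral (f + g).fn = berezinIntegral f.fn + berezinIntegral g.fn := by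
  rw [berezinIntegral, berezinIntegral, berezinIntegral, ← integral_add
    (integrable_coeffAt hK hKi hf _).integrableOn (integrable_coeffAt hK hKi hg _).integrableOn]
  simp only [coeffAt_add]

theorem berezinIntegral_smul (r : ℝ) (f : SuperFun q (M.dom i)) :
    berezinIntegral (r • f).fn = r * berezinIntegral f.fn := by
  rw [berezinIntegral, berezinIntegral, ← integral_const_mul]
  refine setIntegral_congr_fun (M.dom i).isOpen.measurableSet fun y hy => ?_
  rw [coeffAt_apply _ _ ⟨y, hy⟩, coeffAt_apply _ _ ⟨y, hy⟩, SuperFun.fn_smul, Pi.smul_apply,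
    map_smul]; rfl

theorem berezinIntegral_neg (f : SuperFun q (M.dom i)) :
    berezinIntegral (-f).fn = -berezinIntegral f.fn := by
  rw [← neg_one_smul ℝ f, berezinIntegral_smul, neg_one_mul]

theorem VanishesOff.neg (hf : VanishesOff i K f) : VanishesOff i K (-f) := fun y hy => by
  rw [SuperFun.fn_neg, Pi.neg_apply, hf y hy, neg_zero]

theorem berezinIntegral_sub (hK : IsCompact K) (hKi : K ⊆ (M.chart i).source)
    (hf : VanishesOff i K f) (hg : VanishesOff i K g) :
    berezinIntegral (f - g).fn = berezinIntegral f.fn - berezinIntegral g.fn := by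
  rw [sub_eq_add_neg, berezinIntegral_add hK hKi hf hg.neg, berezinIntegral_neg, sub_eq_add_neg]

theorem VanishesOff.sum {ι : Type*} {s : Finset ι} {F : ι → SuperFun q (M.dom i)}
    (hF : ∀ a ∈ s, VanishesOff i K (F a)) : VanishesOff i K (∑ a ∈ s, F a) := fun y hy => by
  rw [SuperFun.fn_finset_sum]
  exact Finset.sum_eq_zero fun a ha => hF a ha y hy

theorem berezinIntegral_zero : berezinIntegral (0 : SuperFun q (M.dom i)).fn = 0 := by
  rw [← zero_smul ℝ (0 : SuperFun q (M.dom i)), berezinIntegral_smul, zero_mul]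

theorem berezinIntegral_sum {ι : Type*} (hK : IsCompact K) (hKi : K ⊆ (M.chart i).source)
    {s : Finset ι} {F : ι → SuperFun q (M.dom i)} (hF : ∀ a ∈ s, VanishesOff i K (F a)) :
    berezinIntegral (∑ a ∈ s, F a).fn = ∑ a ∈ s, berezinIntegral (F a).fn := by
  classical
  induction s using Finset.induction_on with
  | empty => rw [Finset.sum_empty, Finset.sum_empty, berezinIntegral_zero]
  | insert a s ha ih =>
    rw [Finset.sum_insert ha, Finset.sum_insert ha, berezinIntegral_add hK hKi
      (hF a (Finset.mem_insert_self a s))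
      (VanishesOff.sum fun b hb => hF b (Finset.mem_insert_of_mem hb)),
      ih fun b hb => hF b (Finset.mem_insert_of_mem hb)]

/-- The Berezin integral of a derivative vanishes. -/
theorem berezinIntegral_pd (hK : IsCompact K) (hKi : K ⊆ (M.chart i).source)
    (hf : VanishesOff i K f) (a : CoordIdx p q) : berezinIntegral (SuperFun.pd a f).fn = 0 := by
  cases a with
  | inl k =>
    have h1 : ∀ y ∈ (M.dom i : Set (Fin p → ℝ)), coeffAt (SuperFun.pd (Sum.inl k) f).fn Finset.univ y =
        fderiv ℝ (coeffAt f.fn Finset.univ) y (Pi.single k 1) := fun y hy => by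
      rw [coeffAt_apply _ _ ⟨y, hy⟩, fn_pd, repr_pd_inl]
    rw [berezinIntegral, setIntegral_congr_fun (M.dom i).isOpen.measurableSet h1,
      setIntegral_eq_integral_of_forall_compl_eq_zero]
    · have hc := contDiff_coeffAt hK hKi hf Finset.univ
      have hs := hasCompactSupport_coeffAt hK hKi hf Finset.univ
      have hd : Continuous fun y => fderiv ℝ (coeffAt f.fn Finset.univ) y (Pi.single k 1) :=
        (hc.continuous_fderiv (by simp)).clm_apply continuous_const
      -- Integration by parts against the constant 1, whose derivative vanishes.
      have h2 := integral_mul_fderiv_eq_neg_fderiv_mul_of_integrable (μ := (volume : Measure (Fin p → ℝ)))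
        (f := fun _ : Fin p → ℝ => (1 : ℝ)) (g := coeffAt f.fn Finset.univ) (v := Pi.single k 1)
        (by simp) (by
          simp only [one_mul]
          exact hd.integrable_of_hasCompactSupport (hs.fderiv_apply ℝ _))
        (by simpa using integrable_coeffAt hK hKi hf Finset.univ) (fun _ _ => by fun_prop)
        (fun x _ => (hc.differentiable (by simp)) x)
      simpa using h2
    · intro y hy
      have hy' : y ∉ tsupport (coeffAt f.fn Finset.univ) := fun h => hy (by
        obtain ⟨x, hx, rfl⟩ := tsupport_coeffAt_subset hK hKi hf _ h
        exact mem_dom_iff.2 ((M.chart i).map_source (hKi hx)))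
      rw [(notMem_tsupport_iff_eventuallyEq.1 hy').fderiv_eq]
      simp
  | inr m =>
    rw [berezinIntegral, setIntegral_congr_fun (g := fun _ => 0) (M.dom i).isOpen.measurableSet,
      integral_zero]
    intro y hy
    dsimp only
    rw [coeffAt_apply _ _ ⟨y, hy⟩]
    exact repr_contr_univ _ _

end

/-- The integration pairing is non-degenerate. -/
theorem eq_zero_of_berezinIntegral {h : SuperFun q (M.dom i)}
    (H : ∀ (ε : ZMod 2) (K : Set M.space) (g : SuperFun q (M.dom i)), IsCompact K →
      K ⊆ (M.chart i).source → VanishesOff i K g → HasParity ε g.fn →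
        berezinIntegral (h * g).fn = 0) : h = 0 := by
  ext y
  refine eq_zero_of_top_mul fun J => ?_
  -- Testing with g = r ξ^J for bump functions r shows that the top coefficient of h ξ^J vanishes
  -- almost everywhere, hence everywhere by continuity; `eq_zero_of_top_mul` then recovers h.
  set F := h * constFun (M.dom i) (grBasis q J) with hF
  have hcont : ContinuousOn (coeffAt F.fn Finset.univ) (M.dom i : Set (Fin p → ℝ)) :=
    (F.contDiffOn _).continuousOn
  have hae := (M.dom i).isOpen.ae_eq_zero_of_integral_contDiff_smul_eq_zero
    (μ := (volume : Measure (Fin p → ℝ))) (f := coeffAt F.fn Finset.univ)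
    (hcont.locallyIntegrableOn (M.dom i).isOpen.measurableSet) fun r hr hc hs => by
      let b : Bump (M.dom i) := ⟨r, hr, hc, hs⟩
      have h1 := H J.card b.carrier (b.superFun q * constFun (M.dom i) (grBasis q J))
        b.isCompact_carrier b.carrier_subset (b.vanishesOff _) fun z => by
          have := mul_mem_grPart (hasParity_ofReal b.toFun b.contDiff.contDiffOn z)
            (grBasis_mem_grPart J)
          rwa [zero_add] at this
      rw [berezinIntegral, setIntegral_congr_fun (g := fun z => r z • coeffAt F.fn Finset.univ z)
        (M.dom i).isOpen.measurableSet, setIntegral_eq_integral_of_forall_compl_eq_zero] at h1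
      · exact h1
      · intro z hz
        rw [coeffAt_of_notMem _ _ hz, smul_zero]
      · intro z hz
        dsimp only
        rw [coeffAt_apply _ _ ⟨z, hz⟩, coeffAt_apply _ _ ⟨z, hz⟩, hF, SuperFun.fn_mul,
          SuperFun.fn_mul, SuperFun.fn_mul, Pi.mul_apply, Pi.mul_apply, Pi.mul_apply, Bump.superFun,
          fn_ofReal, ← Algebra.smul_def, mul_smul_comm, map_smul]
        rfl
  have h2 := Measure.eqOn_open_of_ae_eq ((ae_restrict_iff' (M.dom i).isOpen.measurableSet).2 hae) (M.dom i).isOpen hcont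
    (continuousOn_const (c := (0 : ℝ)))
  have h3 := h2 y.2
  rw [coeffAt_apply] at h3
  exact h3

/-! ### Integrals of densities -/

theorem CompactlySupportedIn.mul_left {χ : M.Dens} (h : CompactlySupportedIn i χ) (ψ : M.Dens) :
    CompactlySupportedIn i (ψ * χ) := by
  obtain ⟨K, hK, hKi, hv⟩ := h
  exact ⟨K, hK, hKi, VanishesOn.mul_left (U := Kᶜ) hv ψ⟩

theorem CompactlySupportedIn.smul {χ : M.Dens} (h : CompactlySupportedIn i χ) (r : ℝ) :
    CompactlySupportedIn i (r • χ) := by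
  obtain ⟨K, hK, hKi, hv⟩ := h
  exact ⟨K, hK, hKi, fun j w y hy => by
    rw [comp_smul, SuperFun.fn_smul, Pi.smul_apply, hv j w y hy, smul_zero]⟩

theorem CompactlySupportedIn.sub {ψ χ : M.Dens} (h : CompactlySupportedIn i ψ)
    (h' : CompactlySupportedIn i χ) : CompactlySupportedIn i (ψ - χ) := by
  rw [sub_eq_add_neg, ← neg_one_smul ℝ χ]
  obtain ⟨K, hK, hKi, hv⟩ := h
  obtain ⟨K', hK', hKi', hv'⟩ := h'.smul (-1)
  exact ⟨K ∪ K', hK.union hK', union_subset hKi hKi', VanishesOn.add (U := (K ∪ K')ᶜ)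
    (VanishesOn.mono (V := Kᶜ) hv (compl_subset_compl.2 subset_union_left))
    (VanishesOn.mono (V := K'ᶜ) hv' (compl_subset_compl.2 subset_union_right))⟩

theorem integral_dens_add {ψ χ : M.Dens} (hψ : CompactlySupportedIn i ψ)
    (hχ : CompactlySupportedIn i χ) : integral i (ψ + χ) = integral i ψ + integral i χ := by
  obtain ⟨K, hK, hKi, hv⟩ := hψ
  obtain ⟨K', hK', hKi', hv'⟩ := hχ
  exact berezinIntegral_add (hK.union hK') (union_subset hKi hKi')
    (fun y hy => hv i 1 y fun h => hy (Or.inl h)) (fun y hy => hv' i 1 y fun h => hy (Or.inr h))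

theorem integral_dens_smul (r : ℝ) (ψ : M.Dens) : integral i (r • ψ) = r * integral i ψ :=
  berezinIntegral_smul r _

theorem integral_dens_sub {ψ χ : M.Dens} (hψ : CompactlySupportedIn i ψ)
    (hχ : CompactlySupportedIn i χ) : integral i (ψ - χ) = integral i ψ - integral i χ := by
  rw [sub_eq_add_neg, ← neg_one_smul ℝ χ, integral_dens_add hψ (hχ.smul _), integral_dens_smul,
    neg_one_mul, sub_eq_add_neg]

/-- The coefficient of weight w is isolated by test densities of weight 1 − w. -/
theorem dens_eq_zero_of_integral {ρ : M.Dens} (h : ∀ (i : M.Chart) (ε : ZMod 2), ∀ χ ∈ M.densP ε,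
    CompactlySupportedIn i χ → integral i (ρ * χ) = 0) : ρ = 0 := by
  ext i w y
  have : comp ρ i w = 0 := eq_zero_of_berezinIntegral fun ε K g hK hKi hg hε => by
    have h1 := h i ε (extDens (1 - w) hK hKi hg) (extDens_mem_densP _ hK hKi hg hε)
      ⟨K, hK, hKi, fun j u y hy => extDens_eq_zero _ hK hKi hg hy u⟩
    rw [PosSupermanifold.integral, comp_mul_of_mem_right _ (extDens_mem_densW (1 - w) hK hKi hg),
      sub_sub_cancel, comp_extDens_self] at h1
    exact h1
  rw [this]; rfl

end PosSupermanifold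

end SuperGeom

end

noncomputable section

namespace SuperGeom

namespace PosSupermanifold

open Supermanifold

variable {p q : ℕ} {M : PosSupermanifold.{u} p q} {i : M.Chart}

/-! ### The square of the canonical pencil is a derivation -/

/-- The deviation of an even operator from being a derivation. -/
def leibnizDefect (D : M.Dens →ₗ[ℝ] M.Dens) (ψ χ : M.Dens) : M.Dens :=
  D (ψ * χ) - D ψ * χ - ψ * D χ

section

variable {B : OddLongBracket M} {Δ : M.Dens →ₗ[ℝ] M.Dens} (hΔ : IsCanonicalPencil B Δ)
include hΔ

theorem IsCanonicalPencil.map_mul {α : ZMod 2} {ψ : M.Dens} (hψ : ψ ∈ M.densP α) (χ : M.Dens) :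
    Δ (ψ * χ) = B.bracket ψ χ + Δ ψ * χ + sgn α • (ψ * Δ χ) := by
  rw [hΔ.generates α ψ hψ χ]; abel

/-- Expanding Δ(Δ(ab)), the two cross terms ± Δa·Δb cancel because Δ is odd. -/
theorem IsCanonicalPencil.leibnizDefect_sq {α : ZMod 2} {a : M.Dens} (ha : a ∈ M.densP α)
    (b : M.Dens) : leibnizDefect (Δ ∘ₗ Δ) a b =
      Δ (B.bracket a b) + B.bracket (Δ a) b + sgn α • B.bracket a (Δ b) := by
  simp only [leibnizDefect, LinearMap.comp_apply]
  rw [hΔ.map_mul ha b, map_add, map_add, map_smul, hΔ.map_mul (hΔ.parity α a ha) b,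
    hΔ.map_mul ha (Δ b)]
  rcases zmod2_cases α with rfl | rfl
  · simp only [sgn_zero, sgn_one, zero_add, one_smul, neg_one_smul]
    abel
  · simp only [sgn_zero, sgn_one, zmod2_one_add_one, one_smul, neg_one_smul, neg_add, neg_neg]
    abel

theorem IsCanonicalPencil.sq_mem {α : ZMod 2} {a : M.Dens} (ha : a ∈ M.densP α) :
    Δ (Δ a) ∈ M.densP α := by
  have h := hΔ.parity _ _ (hΔ.parity α a ha)
  rwa [add_assoc, zmod2_one_add_one, add_zero] at h

set_option maxHeartbeats 1000000 in
-- After expansion the terms containing Δ cancel. What remains are the double brackets {{a,b},c},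
-- {b,{a,c}} and {a,{b,c}}, with the signs of the Jacobi identity.
theorem IsCanonicalPencil.leibnizDefect_mul (hB : B.Jacobi) {α β δ : ZMod 2} {a b c : M.Dens}
    (ha : a ∈ M.densP α) (hb : b ∈ M.densP β) (hc : c ∈ M.densP δ) :
    leibnizDefect (Δ ∘ₗ Δ) a (b * c) = leibnizDefect (Δ ∘ₗ Δ) a b * c +
      sgn (α * β) • (b * leibnizDefect (Δ ∘ₗ Δ) a c) := by
  have E₁ : ∀ (x y z w : M.Dens) (r : ℝ), (x + y + r • z) * w = x * w + y * w + r • (z * w) :=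
    fun x y z w r => by rw [add_mul, add_mul, smul_mul_assoc]
  have E₂ : ∀ (x y z w : M.Dens) (r : ℝ), w * (x + y + r • z) = w * x + w * y + r • (w * z) :=
    fun x y z w r => by rw [mul_add, mul_add, mul_smul_comm]
  have hab := B.parity α β a ha b hb
  have hac := B.parity α δ a ha c hc
  have hbc := B.parity β δ b hb c hc
  have J := hB α β δ a ha b hb c hc
  have J1 := B.symm _ _ _ (B.parity δ α c hc a ha) b hb
  have J2 := B.symm _ _ c hc a ha
  have J3 := B.symm _ _ _ hbc a ha
  -- Symmetry of the bracket brings the Jacobi identity to the three double brackets that the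
  -- expansion produces.
  rw [J1, J2, J3, map_smul] at J
  rw [hΔ.leibnizDefect_sq ha, hΔ.leibnizDefect_sq ha,
    hΔ.leibnizDefect_sq ha, B.leibniz α β a ha b hb c,
    B.leibniz _ β _ (hΔ.parity α a ha) b hb c, hΔ.map_mul hb c, map_add, map_add, map_add, map_smul,
    map_smul, hΔ.map_mul hab c, hΔ.map_mul hb, B.leibniz α _ a ha _ (hΔ.parity β b hb) c,
    B.leibniz α β a ha b hb (Δ c), E₁, E₂]
  clear E₁ E₂
  clear J1 J2 J3 hbc hac hab hB hΔ ha hb hc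
  generalize B.bracket a b = x₁ at *
  generalize B.bracket a c = x₂ at *
  generalize B.bracket b c = x₃ at *
  generalize B.bracket x₁ c = x₄ at *
  generalize B.bracket b x₂ = x₅ at *
  generalize B.bracket a x₃ = x₆ at *
  generalize B.bracket a (Δ b) = x₇ at *
  generalize B.bracket a (Δ c) = x₈ at *
  generalize B.bracket (Δ a) b = x₉ at *
  generalize B.bracket (Δ a) c = x₁₀ at *
  generalize Δ x₁ = x₁₁ at *
  generalize Δ x₂ = x₁₂ at *
  generalize Δ b = x₁₃ at *
  generalize Δ c = x₁₄ at *
  -- With brackets and images under Δ made opaque, each choice of parities leaves an identity that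
  -- is plus or minus the Jacobi relation.
  rcases zmod2_cases α with rfl | rfl <;> rcases zmod2_cases β with rfl | rfl <;>
  rcases zmod2_cases δ with rfl | rfl <;>
  simp only [sgn_zero, sgn_one, zero_add, add_zero, mul_zero, mul_one, zmod2_one_add_one,
    one_smul, neg_one_smul, neg_neg, smul_add, smul_neg] at J ⊢ <;>
  first
  | (rw [← sub_eq_zero, ← J]; abel1)
  | (rw [← sub_eq_zero, ← neg_eq_zero, ← J]; abel1)

end

/-! The adjoint of the square. -/

section

variable {B : OddLongBracket M} {Δ : M.Dens →ₗ[ℝ] M.Dens} (hΔ : IsCanonicalPencil B Δ)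
include hΔ

/-- Moving Δ across twice costs (−1)^(ψ̃+1) and then (−1)^ψ̃, whose product is −1. -/
theorem IsCanonicalPencil.adjointEq_sq : AdjointEq 0 (-1) (Δ ∘ₗ Δ) := by
  intro i α ψ hψ χ hχ
  have h1 := hΔ.self_adjoint i _ (Δ ψ) (hΔ.parity α ψ hψ) χ hχ
  have h2 := hΔ.self_adjoint i α ψ hψ (Δ χ) (hΔ.isLocalOp.compactlySupportedIn hχ)
  rw [LinearMap.comp_apply, LinearMap.comp_apply, h1, h2]
  rcases zmod2_cases α with rfl | rfl
  · simp only [sgn_zero, sgn_one, zero_add, one_mul, mul_zero, mul_one, neg_one_mul]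
  · simp only [sgn_zero, sgn_one, zmod2_one_add_one, one_mul, mul_one, mul_zero,
      neg_one_mul]

theorem IsCanonicalPencil.integral_sq (ψ : M.Dens) {χ : M.Dens} (hχ : CompactlySupportedIn i χ) :
    integral i (Δ (Δ ψ) * χ) = -integral i (ψ * Δ (Δ χ)) := by
  have hχ2 := hΔ.isLocalOp.compactlySupportedIn (hΔ.isLocalOp.compactlySupportedIn hχ)
  induction ψ using induction_densP with
  | hadd a b h h' =>
    rw [map_add, map_add, add_mul, add_mul, integral_dens_add (hχ.mul_left _) (hχ.mul_left _),
      integral_dens_add (hχ2.mul_left _) (hχ2.mul_left _), h, h', neg_add]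
  | h ε a ha =>
    have := hΔ.adjointEq_sq i ε a ha χ hχ
    rwa [zero_mul, sgn_zero, mul_one, neg_one_mul] at this

theorem IsCanonicalPencil.integral_sq_eq_zero {χ : M.Dens} (hχ : CompactlySupportedIn i χ) :
    integral i (Δ (Δ χ)) = 0 := by
  have h := hΔ.integral_sq 1 hχ
  rw [hΔ.map_one, map_zero, zero_mul, one_mul] at h
  have h0 : integral i (0 : M.Dens) = 0 := berezinIntegral_zero
  rw [h0] at h
  exact neg_eq_zero.1 h.symm

theorem IsCanonicalPencil.integral_leibnizDefect {χ : M.Dens} (hχ : CompactlySupportedIn i χ)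
    (ψ : M.Dens) : integral i (leibnizDefect (Δ ∘ₗ Δ) ψ χ) = 0 := by
  have hD : ∀ {χ}, CompactlySupportedIn i χ → CompactlySupportedIn i (Δ (Δ χ)) := fun h =>
    hΔ.isLocalOp.compactlySupportedIn (hΔ.isLocalOp.compactlySupportedIn h)
  have h1 := hD (hχ.mul_left ψ)
  have h2 := hχ.mul_left (Δ (Δ ψ))
  have h3 := (hD hχ).mul_left ψ
  rw [leibnizDefect]
  simp only [LinearMap.comp_apply]
  rw [integral_dens_sub (h1.sub h2) h3, integral_dens_sub h1 h2,
    hΔ.integral_sq_eq_zero (hχ.mul_left ψ), hΔ.integral_sq ψ hχ]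
  ring

/-- With Φ the defect, 0 = ∫Φ(a,bc) = ∫Φ(a,b)c ± ∫bΦ(a,c). Skew-adjointness of Δ² makes the two
terms equal, so both vanish for every test density c. -/
theorem IsCanonicalPencil.leibnizDefect_eq_zero_of_mem (hB : B.Jacobi) {α β : ZMod 2} {a b : M.Dens}
    (ha : a ∈ M.densP α) (hb : b ∈ M.densP β) : leibnizDefect (Δ ∘ₗ Δ) a b = 0 := by
  refine dens_eq_zero_of_integral fun i δ c hc hci => ?_
  have hD : ∀ {χ}, CompactlySupportedIn i χ → CompactlySupportedIn i (Δ (Δ χ)) := fun h =>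
    hΔ.isLocalOp.compactlySupportedIn (hΔ.isLocalOp.compactlySupportedIn h)
  have h1 := hΔ.integral_leibnizDefect (hci.mul_left b) a
  have hs : CompactlySupportedIn i (sgn (α * β) • (b * leibnizDefect (Δ ∘ₗ Δ) a c)) := by
    refine CompactlySupportedIn.smul (CompactlySupportedIn.mul_left ?_ b) _
    obtain ⟨K, hK, hKi, hv⟩ := hci
    have hU := (isClosed_of_isCompact hK).isOpen_compl
    have hl := hΔ.isLocalOp.compose hΔ.isLocalOp
    have h2 : VanishesOn Kᶜ ((Δ ∘ₗ Δ) (a * c)) :=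
      hl.vanishesOn ⟨Kᶜ, hU⟩ _ (VanishesOn.mul_left (U := Kᶜ) hv a)
    have h3 : VanishesOn Kᶜ ((Δ ∘ₗ Δ) a * c) := VanishesOn.mul_left (U := Kᶜ) hv _
    have h4 : VanishesOn Kᶜ (a * (Δ ∘ₗ Δ) c) := (hl.vanishesOn ⟨Kᶜ, hU⟩ _ hv).mul_left a
    exact ⟨K, hK, hKi, fun j w y hy => by
      rw [leibnizDefect, comp_sub, comp_sub, SuperFun.fn_sub, SuperFun.fn_sub, Pi.sub_apply,
        Pi.sub_apply, h2 j w y hy, h3 j w y hy, h4 j w y hy, sub_zero, sub_zero]⟩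
  rw [hΔ.leibnizDefect_mul hB ha hb hc, integral_dens_add (hci.mul_left _) hs] at h1
  -- Under the integral, the first of these terms becomes −a(Δ²b)c and the last becomes Δ²(ab)c. The
  -- total is again the integral of the defect of (a,b) times c.
  have e : sgn (α * β) • (b * leibnizDefect (Δ ∘ₗ Δ) a c) =
      sgn (α * β) • (b * Δ (Δ (a * c))) - Δ (Δ a) * (b * c) - (a * b) * Δ (Δ c) := by
    rw [← mul_assoc, dens_comm (hΔ.sq_mem ha) hb, dens_comm ha hb]
    simp only [leibnizDefect, LinearMap.comp_apply, mul_sub, smul_sub, smul_mul_assoc, mul_assoc]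
  have e1 : sgn (α * β) • (Δ (Δ b) * (a * c)) = a * Δ (Δ b) * c := by
    rw [dens_comm ha (hΔ.sq_mem hb), smul_mul_assoc, mul_assoc]
  have i1 : integral i (sgn (α * β) • (b * Δ (Δ (a * c)))) = -integral i (a * Δ (Δ b) * c) := by
    rw [integral_dens_smul, ← e1, integral_dens_smul, hΔ.integral_sq b (hci.mul_left a)]
    ring
  have c1 : CompactlySupportedIn i (sgn (α * β) • (b * Δ (Δ (a * c)))) :=
    CompactlySupportedIn.smul (CompactlySupportedIn.mul_left (hD (hci.mul_left a)) b) _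
  have c2 : CompactlySupportedIn i (Δ (Δ a) * (b * c)) := (hci.mul_left b).mul_left _
  have c3 : CompactlySupportedIn i (a * b * Δ (Δ c)) := (hD hci).mul_left _
  rw [e, integral_dens_sub (c1.sub c2) c3, integral_dens_sub c1 c2, i1] at h1
  have i3 := hΔ.integral_sq (a * b) hci
  have hΦ : integral i (leibnizDefect (Δ ∘ₗ Δ) a b * c) = integral i (Δ (Δ (a * b)) * c) -
      integral i (Δ (Δ a) * (b * c)) - integral i (a * Δ (Δ b) * c) := by
    rw [leibnizDefect, sub_mul, sub_mul, integral_dens_sub ((hci.mul_left _).sub (hci.mul_left _))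
      (hci.mul_left _), integral_dens_sub (hci.mul_left _) (hci.mul_left _), mul_assoc (_ : M.Dens) b c]
    rfl
  linarith

theorem IsCanonicalPencil.sq_mul (hB : B.Jacobi) (ψ χ : M.Dens) :
    Δ (Δ (ψ * χ)) = Δ (Δ ψ) * χ + ψ * Δ (Δ χ) := by
  induction ψ using induction_densP with
  | hadd a b h h' =>
    rw [add_mul, map_add, map_add, map_add, map_add, h, h', add_mul, add_mul]; abel
  | h α a ha =>
    induction χ using induction_densP with
    | hadd b c h h' =>
      rw [mul_add, map_add, map_add, map_add, map_add, h, h', mul_add, mul_add]; abel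
    | h β b hb =>
      have h := hΔ.leibnizDefect_eq_zero_of_mem hB ha hb
      simp only [leibnizDefect, LinearMap.comp_apply] at h
      rw [sub_sub, sub_eq_zero] at h
      exact h

/-- The bracket is expressed by Δ and products; Δ² commutes with Δ and is a derivation of products.
-/
theorem IsCanonicalPencil.sq_bracket (hB : B.Jacobi) (ψ χ : M.Dens) :
    Δ (Δ (B.bracket ψ χ)) = B.bracket (Δ (Δ ψ)) χ + B.bracket ψ (Δ (Δ χ)) := by
  induction ψ using induction_densP with
  | hadd a b h h' => simp only [map_add, LinearMap.add_apply, h, h']; abel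
  | h α a ha =>
    rw [hΔ.generates α a ha, hΔ.generates α _ (hΔ.sq_mem ha), hΔ.generates α a ha]
    simp only [map_sub, map_smul, hΔ.sq_mul hB, map_add, smul_add]
    abel

end

end PosSupermanifold

end SuperGeom

end

noncomputable section

namespace SuperGeom

namespace PosSupermanifold

open Supermanifold Filter Topology

variable {p q : ℕ} {M : PosSupermanifold.{u} p q} {i : M.Chart}

theorem superFun_odd_mul_self {V : Opens (Fin p → ℝ)} {f : SuperFun q V} (hf : HasParity 1 f.fn) :
    f * f = 0 := SuperFun.ext fun y => odd_mul_self (hf y)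

/-! ### Products in a chart -/

section

variable {L : M.Dens →ₗ[ℝ] M.Dens} (hL : IsLocalOp L) (u v : ℝ) (f g : SuperFun q (M.dom i))
  (y : M.dom i)

/-- This and the next two lemmas turn product identities between global densities into identities
between chart operators, one point y at a time. -/
theorem comp_op_mul : (comp (L (bumpExt (bumpAt y) u f * bumpExt (bumpAt y) v g)) i (u + v)).fn y =
    (locOp hL i (u + v) (f * g)).fn y := by
  have hψ := bumpExt_mem_densW (bumpAt y) u f
  refine (locOp_eq hL (mul_mem_densW hψ (bumpExt_mem_densW _ _ _)) ?_).eq_of_nhds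
  rw [comp_mul_of_mem_left hψ, add_sub_cancel_left, SuperFun.fn_mul, SuperFun.fn_mul]
  exact (comp_bumpAt y u f).mul (comp_bumpAt y v g)

theorem comp_op_mul_left : (comp (L (bumpExt (bumpAt y) u f) * bumpExt (bumpAt y) v g) i (u + v)).fn y =
    (locOp hL i u f).fn y * g.fn y := by
  have hψ := bumpExt_mem_densW (bumpAt y) u f
  rw [comp_mul_of_mem_left (hL.weight u _ hψ), add_sub_cancel_left, SuperFun.fn_mul, Pi.mul_apply,
    (comp_bumpAt y v g).eq_of_nhds, (locOp_eq hL hψ (comp_bumpAt y u f)).eq_of_nhds]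

theorem comp_op_mul_right : (comp (bumpExt (bumpAt y) u f * L (bumpExt (bumpAt y) v g)) i (u + v)).fn y =
    f.fn y * (locOp hL i v g).fn y := by
  have hχ := bumpExt_mem_densW (bumpAt y) v g
  rw [comp_mul_of_mem_right _ (hL.weight v _ hχ), add_sub_cancel_right, SuperFun.fn_mul, Pi.mul_apply,
    (comp_bumpAt y u f).eq_of_nhds, (locOp_eq hL hχ (comp_bumpAt y v g)).eq_of_nhds]

end

/-! ### The pencil in a chart and its dependence on the weight -/

section

variable {B : OddLongBracket M} {Δ : M.Dens →ₗ[ℝ] M.Dens} (hΔ : IsCanonicalPencil B Δ)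
include hΔ

theorem IsCanonicalPencil.locOp_sq_mul (hB : B.Jacobi) (u v : ℝ) (f g : SuperFun q (M.dom i)) :
    locOp (hΔ.isLocalOp.compose hΔ.isLocalOp) i (u + v) (f * g) =
      locOp (hΔ.isLocalOp.compose hΔ.isLocalOp) i u f * g +
        f * locOp (hΔ.isLocalOp.compose hΔ.isLocalOp) i v g := by
  ext y
  rw [← comp_op_mul, LinearMap.comp_apply, hΔ.sq_mul hB, comp_add, SuperFun.fn_add, Pi.add_apply,
    SuperFun.fn_add, Pi.add_apply, SuperFun.fn_mul, SuperFun.fn_mul, Pi.mul_apply, Pi.mul_apply]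
  exact congrArg₂ (· + ·) (comp_op_mul_left (hΔ.isLocalOp.compose hΔ.isLocalOp) u v f g y)
    (comp_op_mul_right (hΔ.isLocalOp.compose hΔ.isLocalOp) u v f g y)

omit hΔ in
theorem fn_master {V : Opens (Fin p → ℝ)} (S : CoordIdx p q → CoordIdx p q → SuperFun q V)
    (γ : CoordIdx p q → SuperFun q V) (θ A B f g : SuperFun q V) (ε : ZMod 2) (u v : ℝ) (y : V) :
    (A * g + sgn ε • (f * B) + (∑ a, ∑ b, sgn (par a * ε) • (S a b * SuperFun.pd b f * SuperFun.pd a g)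
            + ∑ a, γ a * (v • (SuperFun.pd a f * g) +
              (sgn (par a * ε) * u) • (f * SuperFun.pd a g))
            + (u * v) • (θ * f * g))).fn y =
      A.fn y * g.fn y + sgn ε • (f.fn y * B.fn y) +
      (∑ a, ∑ b, sgn (par a * ε) • ((S a b).fn y * pd b f.fn y * pd a g.fn y)
        + ∑ a, (γ a).fn y * (v • (pd a f.fn y * g.fn y)
          + (sgn (par a * ε) * u) • (f.fn y * pd a g.fn y))
        + (u * v) • (θ.fn y * f.fn y * g.fn y)) := by
  simp only [SuperFun.fn_add, SuperFun.fn_smul, SuperFun.fn_mul, Pi.add_apply, Pi.smul_apply,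
    Pi.mul_apply, SuperFun.fn_finset_sum, fn_pd]

theorem IsCanonicalPencil.comp_bracket_bump {ε : ZMod 2} (u v : ℝ) (f g : SuperFun q (M.dom i))
    (y : M.dom i) (hf : HasParity ε f.fn) :
    (comp (B.bracket (bumpExt (bumpAt y) u f) (bumpExt (bumpAt y) v g)) i (u + v)).fn y =
      (locOp hΔ.isLocalOp i (u + v) (f * g)).fn y - (locOp hΔ.isLocalOp i u f).fn y * g.fn y -
        sgn ε • (f.fn y * (locOp hΔ.isLocalOp i v g).fn y) := by
  rw [hΔ.generates ε _ (bumpExt_mem_densP _ _ hf), comp_sub, comp_sub, comp_smul, SuperFun.fn_sub,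
    Pi.sub_apply, SuperFun.fn_sub, Pi.sub_apply, SuperFun.fn_smul, Pi.smul_apply, comp_op_mul,
    comp_op_mul_left hΔ.isLocalOp, comp_op_mul_right hΔ.isLocalOp]

/-- The action of the pencil on products, in a chart. -/
theorem IsCanonicalPencil.exists_locOp_mul (i : M.Chart) :
    ∃ (S : CoordIdx p q → CoordIdx p q → SuperFun q (M.dom i))
      (γ : CoordIdx p q → SuperFun q (M.dom i)) (θ : SuperFun q (M.dom i)),
      ∀ (ε : ZMod 2) (u v : ℝ) (f g : SuperFun q (M.dom i)), HasParity ε f.fn →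
        locOp hΔ.isLocalOp i (u + v) (f * g) = locOp hΔ.isLocalOp i u f * g +
          sgn ε • (f * locOp hΔ.isLocalOp i v g) +
          (∑ a, ∑ b, sgn (par a * ε) • (S a b * SuperFun.pd b f * SuperFun.pd a g)
            + ∑ a, γ a * (v • (SuperFun.pd a f * g) +
              (sgn (par a * ε) * u) • (f * SuperFun.pd a g))
            + (u * v) • (θ * f * g)) := by
  obtain ⟨S, γ, θ, -, -, -, -, h⟩ := B.master_hamiltonian i
  refine ⟨S, γ, θ, fun ε u v f g hf => SuperFun.ext fun y => ?_⟩
  have h1 := congrFun (h ε u v (bumpExt (bumpAt y) u f)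
    ⟨bumpExt_mem_densP _ _ hf, bumpExt_mem_densW _ _ _⟩ (bumpExt (bumpAt y) v g)
    (bumpExt_mem_densW _ _ _)) y
  rw [hΔ.comp_bracket_bump u v f g y hf, sub_sub, sub_eq_iff_eq_add'] at h1
  have d1 : ∀ a, pd a (comp (bumpExt (bumpAt y) u f) i u).fn y = pd a f.fn y := fun a =>
    pd_congr a (comp_bumpAt y u f)
  have d2 : ∀ a, pd a (comp (bumpExt (bumpAt y) v g) i v).fn y = pd a g.fn y := fun a =>
    pd_congr a (comp_bumpAt y v g)
  have d3 : (comp (bumpExt (bumpAt y) u f) i u).fn y = f.fn y := (comp_bumpAt y u f).eq_of_nhds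
  have d4 : (comp (bumpExt (bumpAt y) v g) i v).fn y = g.fn y := (comp_bumpAt y v g).eq_of_nhds
  rw [fn_master, h1]
  simp only [Pi.add_apply, Pi.smul_apply, Pi.mul_apply, Finset.sum_apply, d1, d2, d3, d4]

/-- Here Γ = γ^a ∂_a. The additivity defect of Δ_w(1) comes from the product 1·1, and the last
formula from f·1 with f of weight 0, where all second-order terms vanish since ∂_a 1 = 0. -/
theorem IsCanonicalPencil.exists_chart_form (i : M.Chart) :
    ∃ (Γ : SuperFun q (M.dom i) →ₗ[ℝ] SuperFun q (M.dom i)) (θ : SuperFun q (M.dom i)),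
      (∀ K f, IsCompact K → VanishesOff i K f → VanishesOff i K (Γ f)) ∧
      (∀ u v, locOp hΔ.isLocalOp i (u + v) 1 =
        locOp hΔ.isLocalOp i u 1 + locOp hΔ.isLocalOp i v 1 + (u * v) • θ) ∧
      ∀ (ε : ZMod 2) (v : ℝ) (f : SuperFun q (M.dom i)), HasParity ε f.fn →
        locOp hΔ.isLocalOp i v f = locOp hΔ.isLocalOp i 0 f +
          sgn ε • (f * locOp hΔ.isLocalOp i v 1) + v • Γ f := by
  obtain ⟨S, γ, θ, h⟩ := hΔ.exists_locOp_mul i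
  refine ⟨∑ a, LinearMap.mulLeft ℝ (γ a) ∘ₗ SuperFun.pd a, θ, fun K f hK hf => ?_, fun u v => ?_,
    fun ε v f hf => ?_⟩
  · rw [LinearMap.sum_apply]
    exact VanishesOff.sum fun a _ => (hf.pd hK a).mul_left _
  · have h1 := h 0 u v 1 1 fun _ => one_mem_grPart
    simp only [pd_one, mul_one, one_mul, mul_zero, smul_zero, Finset.sum_const_zero, add_zero,
      zero_add, sgn_zero, one_smul] at h1
    exact h1
  · have h1 := h ε 0 v f 1 hf
    simp only [pd_one, mul_one, mul_zero, smul_zero, Finset.sum_const_zero, zero_mul, zero_smul,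
      add_zero, zero_add, mul_smul_comm, ← Finset.smul_sum] at h1
    rw [h1, LinearMap.sum_apply]
    rfl

theorem IsCanonicalPencil.locOp_parity {ε : ZMod 2} {f : SuperFun q (M.dom i)} (w : ℝ)
    (hf : HasParity ε f.fn) : HasParity (ε + 1) (locOp hΔ.isLocalOp i w f).fn :=
  PosSupermanifold.locOp_parity hΔ.isLocalOp hΔ.parity hf

/-- The symbol of weight `w` depends quadratically on `w`. -/
theorem IsCanonicalPencil.exists_quadratic (i : M.Chart) :
    ∃ m₁ m₂ : SuperFun q (M.dom i), ∀ w, locOp hΔ.isLocalOp i w 1 = w • m₁ + (w * w) • m₂ := by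
  obtain ⟨Γ, θ, hΓ, hadd, hform⟩ := hΔ.exists_chart_form i
  have h0 := locOp_one hΔ.isLocalOp hΔ.map_one i
  have hone : HasParity 0 (1 : SuperFun q (M.dom i)).fn := fun _ => one_mem_grPart
  have hμ : ∀ w, HasParity 1 (locOp hΔ.isLocalOp i w 1).fn := fun w => by
    have := hΔ.locOp_parity w hone
    rwa [zero_add] at this
  obtain ⟨μ, hμe⟩ : ∃ μ : ℝ → SuperFun q (M.dom i), ∀ w, locOp hΔ.isLocalOp i w 1 = μ w :=
    ⟨_, fun _ => rfl⟩
  simp only [hμe] at h0 hμ hadd hform ⊢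
  -- Self-adjointness tested on 1 and g gives ∫μ_w g = ∫Δ_0 g + ∫μ_{1−w} g + (1 − w)∫Γg. The cases w
  -- = 0 and w = 1, with μ_0 = 0, determine ∫Γg and ∫Δ_0 g in terms of ∫μ_1 g.
  have key : ∀ w, μ w - μ (1 - w) - (2 * w - 1) • μ 1 = 0 := fun w => by
    refine eq_zero_of_berezinIntegral fun ε K g hK hKi hg hε => ?_
    have E : ∀ w, berezinIntegral (μ w * g).fn = berezinIntegral (locOp hΔ.isLocalOp i 0 g).fn +
        berezinIntegral (μ (1 - w) * g).fn + (1 - w) * berezinIntegral (Γ g).fn := fun w => by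
      have h1 := hΔ.self_adjoint.locOp hΔ.isLocalOp (w := w) hone hK hKi hg
      rw [mul_zero, sgn_zero, one_mul, one_mul, one_mul, hμe, hform ε (1 - w) g hε,
        superFun_comm hε (hμ (1 - w)), smul_smul, mul_one, sgn_mul_self, one_smul,
        berezinIntegral_add hK hKi _ (fun y hy => _), berezinIntegral_add hK hKi
          (hg.locOp hΔ.isLocalOp hK 0) (hg.mul_left _), berezinIntegral_smul] at h1
      · exact h1
      · intro y hy
        rw [SuperFun.fn_add, Pi.add_apply, hg.locOp hΔ.isLocalOp hK 0 y hy,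
          (hg.mul_left (μ (1 - w))) y hy, add_zero]
      · intro y hy
        rw [SuperFun.fn_smul, Pi.smul_apply, hΓ K g hK hg y hy, smul_zero]
    have e1 := E 1
    have e0 := E 0
    have ew := E w
    have hz : berezinIntegral (μ 0 * g).fn = 0 := by rw [h0, zero_mul, berezinIntegral_zero]
    rw [sub_self, hz] at e1
    rw [sub_zero, hz] at e0
    rw [sub_mul, sub_mul, smul_mul_assoc, berezinIntegral_sub hK hKi (fun y hy => ?_) (fun y hy => ?_),
      berezinIntegral_sub hK hKi (hg.mul_left _) (hg.mul_left _), berezinIntegral_smul]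
    · linear_combination ew - (1 - w) * e0 - w * e1
    · rw [SuperFun.fn_sub, Pi.sub_apply, hg.mul_left (μ w) y hy, hg.mul_left (μ (1 - w)) y hy,
        sub_zero]
    · rw [SuperFun.fn_smul, Pi.smul_apply, hg.mul_left (μ 1) y hy, smul_zero]
  -- The difference μ_w − μ_{1−w} = (2w − 1)μ_1 and the sum μ_w + μ_{1−w} = μ_1 − w(1 − w)θ are both
  -- known; half their total is μ_w.
  refine ⟨μ 1 - (1 / 2 : ℝ) • θ, (1 / 2 : ℝ) • θ, fun w => ?_⟩
  have h1 := hadd w (1 - w)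
  rw [add_sub_cancel] at h1
  have h2 := key w
  linear_combination (norm := module) (1 / 2 : ℝ) • h2 - (1 / 2 : ℝ) • h1

/-- The square of the pencil on the coordinate volume of weight `w` depends linearly on `w`. -/
theorem IsCanonicalPencil.locOp_sq_one (hB : B.Jacobi) (i : M.Chart) (w : ℝ) :
    locOp (hΔ.isLocalOp.compose hΔ.isLocalOp) i w 1 =
      w • locOp (hΔ.isLocalOp.compose hΔ.isLocalOp) i 1 1 := by
  obtain ⟨Γ, θ, -, -, hform⟩ := hΔ.exists_chart_form i
  obtain ⟨m₁, m₂, hm⟩ := hΔ.exists_quadratic i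
  set T := locOp hΔ.isLocalOp i 0
  -- Δ_w(μ_w) = Tμ_w − μ_w μ_w + wΓμ_w, where the square vanishes because μ_w is odd and μ_w is
  -- quadratic in w without constant term.
  have hcubic : ∀ w, locOp (hΔ.isLocalOp.compose hΔ.isLocalOp) i w 1 =
      w • T m₁ + (w * w) • (T m₂ + Γ m₁) + (w * w * w) • Γ m₂ := fun w => by
    have hodd : HasParity 1 (locOp hΔ.isLocalOp i w 1).fn := by
      have := hΔ.locOp_parity w (f := (1 : SuperFun q (M.dom i))) (ε := 0) fun _ => one_mem_grPart
      rwa [zero_add] at this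
    have hsq : locOp hΔ.isLocalOp i w 1 * locOp hΔ.isLocalOp i w 1 = 0 :=
      superFun_odd_mul_self hodd
    rw [locOp_comp hΔ.isLocalOp hΔ.isLocalOp, hform 1 w _ hodd, hsq, hm w]
    simp only [map_add, map_smul, smul_add, smul_smul, smul_zero, add_zero]
    module
  have hadd : ∀ u v, locOp (hΔ.isLocalOp.compose hΔ.isLocalOp) i (u + v) 1 =
      locOp (hΔ.isLocalOp.compose hΔ.isLocalOp) i u 1 +
        locOp (hΔ.isLocalOp.compose hΔ.isLocalOp) i v 1 := fun u v => by
    have := hΔ.locOp_sq_mul hB (i := i) u v 1 1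
    rwa [mul_one, mul_one, one_mul] at this
  have h2 := hadd 1 1
  have h3 := hadd (1 + 1) 1
  simp only [hcubic] at h2 h3
  -- Additivity at 1 + 1 and 2 + 1 gives 2b + 6c = 0 and 4b + 18c = 0 for the coefficients b of w²
  -- and c of w³; the combination eliminates b.
  have hC : Γ m₂ = 0 := by
    linear_combination (norm := module) (1 / 6 : ℝ) • h3 - (1 / 3 : ℝ) • h2
  have hB' : T m₂ + Γ m₁ = 0 := by
    rw [hC] at h2
    linear_combination (norm := module) (1 / 2 : ℝ) • h2
  rw [hcubic, hcubic, hC, hB']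
  module

end

end PosSupermanifold

end SuperGeom

end

noncomputable section

namespace SuperGeom

namespace PosSupermanifold

open Supermanifold

variable {p q : ℕ} {M : PosSupermanifold.{u} p q} {i : M.Chart}

theorem superFun_even_comm {V : Opens (Fin p → ℝ)} {f : SuperFun q V} (hf : HasParity 0 f.fn)
    (g : SuperFun q V) : f * g = g * f := SuperFun.ext fun y => even_commute (hf y) (g.fn y)

/-! ### The vector field in a chart -/

/-- An even derivation of the superfunctions is a vector field. -/
theorem derivation_eq_sum {V : Opens (Fin p → ℝ)} (D : SuperFun q V →ₗ[ℝ] SuperFun q V)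
    (hD : ∀ f g, D (f * g) = D f * g + f * D g)
    (hpar : ∀ a, HasParity (par a) (D (coordFun V a)).fn) (f : SuperFun q V) :
    D f = ∑ a, D (coordFun V a) * SuperFun.pd a f := by
  let D' : SuperFun q V →ₗ[ℝ] SuperFun q V :=
    D - ∑ a, LinearMap.mulLeft ℝ (D (coordFun V a)) ∘ₗ SuperFun.pd a
  have hD' : ∀ f, D' f = D f - ∑ a, D (coordFun V a) * SuperFun.pd a f := fun f => by
    simp only [D', LinearMap.sub_apply, LinearMap.sum_apply]
    rfl
  have leib : ∀ (ε : ZMod 2) (f g : SuperFun q V), HasParity ε f.fn →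
      D' (f * g) = D' f * g + f * D' g := fun ε f g hf => by
    have h1 : ∀ a, D (coordFun V a) * SuperFun.pd a (f * g) =
        D (coordFun V a) * SuperFun.pd a f * g + f * (D (coordFun V a) * SuperFun.pd a g) := by
      intro a
      rw [pd_mul a hf, mul_add, ← mul_assoc, mul_smul_comm, ← mul_assoc, superFun_comm (hpar a) hf,
        smul_mul_assoc, smul_smul, sgn_mul_self, one_smul, mul_assoc f]
    rw [hD', hD', hD', hD, Finset.sum_congr rfl fun a _ => h1 a, Finset.sum_add_distrib,
      ← Finset.sum_mul, ← Finset.mul_sum, sub_mul, mul_sub]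
    abel
  ext y
  have hL : ∀ f g : SuperFun q V, evalAlg y (f * g) = evalAlg y f * evalAlg y g := map_mul _
  have key : (evalAlg y).toLinearMap ∘ₗ D' = 0 := by
    refine derivation_eq_zero y.2 (evalAlg y) (fun k => body_algebraMap _) _ 1
      (fun r hr f => ?_) (fun m f => ?_) fun b => ?_
    · change evalAlg y (D' _) = evalAlg y (D' _) * _ + _ * evalAlg y (D' _)
      rw [leib 0 _ f (hasParity_ofReal r hr), map_add, hL, hL]
    · change evalAlg y (D' _) = evalAlg y (D' _) * _ + (1 : ℝ) • (_ * evalAlg y (D' _))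
      rw [leib 1 _ f (hasParity_coordFun (Sum.inr m)), map_add, hL, hL, one_smul]
    · change evalAlg y (D' _) = 0
      rw [hD', Finset.sum_eq_single b]
      · rw [pd_coordFun, if_pos rfl, mul_one, sub_self, map_zero]
      · intro c _ hc
        rw [pd_coordFun, if_neg hc, mul_zero]
      · simp
  have h := LinearMap.congr_fun key f
  change evalAlg y (D' f) = 0 at h
  rw [hD', map_sub, sub_eq_zero] at h
  exact h

/-! ### The square of the pencil as a Lie derivative -/

section

variable {B : OddLongBracket M} {Δ : M.Dens →ₗ[ℝ] M.Dens} (hΔ : IsCanonicalPencil B Δ)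
include hΔ

/-- The square of the pencil on densities of weight `w` in the chart `i`. -/
abbrev IsCanonicalPencil.locSq (i : M.Chart) (w : ℝ) :
    SuperFun q (M.dom i) →ₗ[ℝ] SuperFun q (M.dom i) :=
  locOp (hΔ.isLocalOp.compose hΔ.isLocalOp) i w

theorem IsCanonicalPencil.locSq_parity {ε : ZMod 2} {f : SuperFun q (M.dom i)} (w : ℝ)
    (hf : HasParity ε f.fn) : HasParity ε (hΔ.locSq i w f).fn := by
  have := PosSupermanifold.locOp_parity (ε := 0) (hΔ.isLocalOp.compose hΔ.isLocalOp) (w := w)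
    (fun α ψ hψ => by rw [add_zero]; exact hΔ.sq_mem hψ) hf
  rwa [add_zero] at this

theorem IsCanonicalPencil.locSq_zero (hB : B.Jacobi) (f : SuperFun q (M.dom i)) :
    hΔ.locSq i 0 f = ∑ a, hΔ.locSq i 0 (coordFun _ a) * SuperFun.pd a f := by
  refine derivation_eq_sum (hΔ.locSq i 0) (fun f g => ?_)
    (fun a => hΔ.locSq_parity 0 (hasParity_coordFun a)) f
  have := hΔ.locOp_sq_mul hB (i := i) 0 0 f g
  rwa [add_zero] at this

/-- The Leibniz rule for f (Dx)^w as the product of the function f with (Dx)^w; the value on (Dx)^w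
is linear in w, and it is even, hence commutes with f. -/
theorem IsCanonicalPencil.locSq_eq (hB : B.Jacobi) (w : ℝ) (f : SuperFun q (M.dom i)) :
    hΔ.locSq i w f = hΔ.locSq i 0 f + w • (hΔ.locSq i 1 1 * f) := by
  have h := hΔ.locOp_sq_mul hB (i := i) 0 w f 1
  rw [zero_add, mul_one, mul_one, hΔ.locOp_sq_one hB i w, mul_smul_comm] at h
  have hc : f * hΔ.locSq i 1 1 = hΔ.locSq i 1 1 * f :=
    (superFun_even_comm (hΔ.locSq_parity 1
      (f := (1 : SuperFun q (M.dom i))) (fun _ => one_mem_grPart)) f).symm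
  rw [← hc]
  exact h

/-- The square of the pencil acts on the volume forms by the divergence. -/
theorem IsCanonicalPencil.locSq_one_one (hB : B.Jacobi) (i : M.Chart) :
    hΔ.locSq i 1 1 = ∑ a, sgn (par a) • SuperFun.pd a (hΔ.locSq i 0 (coordFun _ a)) := by
  set c : CoordIdx p q → SuperFun q (M.dom i) := fun a => hΔ.locSq i 0 (coordFun _ a) with hc
  have hcpar : ∀ a, HasParity (par a) (c a).fn := fun a =>
    hΔ.locSq_parity 0 (hasParity_coordFun a)
  rw [← sub_eq_zero]
  refine eq_zero_of_berezinIntegral fun ε K g hK hKi hg hε => ?_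
  have hsgn : ∀ α : ZMod 2, sgn (α * α) = sgn α := fun α => by
    rcases zmod2_cases α with rfl | rfl <;> simp
  have h1 : ∀ a, c a * SuperFun.pd a g = sgn (par a) • SuperFun.pd a (c a * g) -
      sgn (par a) • SuperFun.pd a (c a) * g := fun a => by
    rw [pd_mul a (hcpar a), hsgn, smul_add, smul_smul, sgn_mul_self, one_smul, smul_mul_assoc]
    abel
  have hl := hΔ.locSq_zero hB (i := i) g
  -- The product rule moves ∂_a off g, so testing the claimed identity against g leaves the integral
  -- of Δ² on g (Dx) and integrals of derivatives.
  have h2 : (hΔ.locSq i 1 1 - ∑ a, sgn (par a) • SuperFun.pd a (c a)) * g =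
      hΔ.locSq i 1 g - ∑ a, sgn (par a) • SuperFun.pd a (c a * g) := by
    rw [hΔ.locSq_eq hB 1 g, one_smul, hl, Finset.sum_congr rfl fun a _ => h1 a,
      Finset.sum_sub_distrib, ← Finset.sum_mul, sub_mul]
    abel
  -- Skew-adjointness paired with the function 1, on which Δ² vanishes.
  have h3 : berezinIntegral (hΔ.locSq i 1 g).fn = 0 := by
    have h := hΔ.adjointEq_sq.locOp (hΔ.isLocalOp.compose hΔ.isLocalOp) (i := i) (w := 0) (α := 0)
      (f := (1 : SuperFun q (M.dom i))) (fun _ => one_mem_grPart) hK hKi hg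
    rw [locOp_one (hΔ.isLocalOp.compose hΔ.isLocalOp)
      (by rw [LinearMap.comp_apply, hΔ.map_one, map_zero]), zero_mul, berezinIntegral_zero, one_mul,
      mul_zero, sgn_zero, mul_one, sub_zero, neg_one_mul] at h
    exact neg_eq_zero.1 h.symm
  have h4 : ∀ a ∈ Finset.univ, VanishesOff i K (sgn (par a) • SuperFun.pd a (c a * g)) :=
    fun a _ y hy => by
      rw [SuperFun.fn_smul, Pi.smul_apply, (hg.mul_left (c a)).pd hK a y hy, smul_zero]
  rw [h2, berezinIntegral_sub hK hKi (hg.locOp _ hK 1) (VanishesOff.sum h4), h3,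
    berezinIntegral_sum hK hKi h4, zero_sub, neg_eq_zero]
  refine Finset.sum_eq_zero fun a _ => ?_
  rw [berezinIntegral_smul, berezinIntegral_pd hK hKi (hg.mul_left _), mul_zero]

omit hΔ in
theorem fn_vectorField {V : Opens (Fin p → ℝ)} (c : CoordIdx p q → SuperFun q V)
    (f : SuperFun q V) : (∑ a, c a * SuperFun.pd a f).fn = ∑ a, (c a).fn * pd a f.fn := by
  funext y
  simp only [SuperFun.fn_finset_sum, Finset.sum_apply, SuperFun.fn_mul, fn_pd]

omit hΔ in
theorem fn_lieDerivative {V : Opens (Fin p → ℝ)} (c : CoordIdx p q → SuperFun q V) (w : ℝ)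
    (f : SuperFun q V) : (∑ a, c a * SuperFun.pd a f +
        w • ((∑ a, sgn (par a) • SuperFun.pd a (c a)) * f)).fn =
      ∑ a, (c a).fn * pd a f.fn + w • ((∑ a, sgn (par a) • pd a (c a).fn) * f.fn) := by
  funext y
  simp only [SuperFun.fn_add, SuperFun.fn_smul, SuperFun.fn_mul, Pi.add_apply, Pi.smul_apply,
    Pi.mul_apply, SuperFun.fn_finset_sum, Finset.sum_apply, fn_pd]

/-- The square of the pencil on functions. -/
def IsCanonicalPencil.vectorField (hB : B.Jacobi) : EvenVectorField M where
  toFun :=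
    { toFun := fun f => ⟨Δ (Δ f.1), hΔ.weight 0 _ (hΔ.weight 0 f.1 f.2)⟩
      map_add' := fun f g => Subtype.ext <| by
        change Δ (Δ (f.1 + g.1)) = Δ (Δ f.1) + Δ (Δ g.1)
        rw [map_add, map_add]
      map_smul' := fun r f => Subtype.ext <| by
        change Δ (Δ (r • f.1)) = r • Δ (Δ f.1)
        rw [map_smul, map_smul] }
  parity α f hf := hΔ.sq_mem hf
  leibniz f g := Subtype.ext (hΔ.sq_mul hB f.1 g.1)

theorem IsCanonicalPencil.isPoisson (hB : B.Jacobi) : (hΔ.vectorField hB).IsPoisson B :=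
  fun f g => Subtype.ext (hΔ.sq_bracket hB f.1 g.1)

theorem IsCanonicalPencil.isLieDerivative (hB : B.Jacobi) :
    (hΔ.vectorField hB).IsLieDerivative (Δ ∘ₗ Δ) := fun i => by
  refine ⟨fun a => hΔ.locSq i 0 (coordFun _ a),
    fun a => hΔ.locSq_parity 0 (hasParity_coordFun a), fun f => ?_, fun ψ w => ?_⟩
  · have h : comp ((Δ ∘ₗ Δ) f.1) i 0 = hΔ.locSq i 0 (comp f.1 i 0) :=
      comp_locOp (hΔ.isLocalOp.compose hΔ.isLocalOp) f.1 i 0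
    rw [hΔ.locSq_zero hB] at h
    exact (congrArg SuperFun.fn h).trans (fn_vectorField _ _)
  · have h : comp ((Δ ∘ₗ Δ) ψ) i w = hΔ.locSq i w (comp ψ i w) :=
      comp_locOp (hΔ.isLocalOp.compose hΔ.isLocalOp) ψ i w
    rw [hΔ.locSq_eq hB, hΔ.locSq_zero hB, hΔ.locSq_one_one hB] at h
    exact (congrArg SuperFun.fn h).trans (fn_lieDerivative _ _ _)

end

end PosSupermanifold

end SuperGeom

end

theorem mainTheorem5 {p q : ℕ} (M : SuperGeom.PosSupermanifold.{u} p q)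
    (B : SuperGeom.PosSupermanifold.OddLongBracket M) (hB : B.Jacobi)
    (Δ : M.Dens →ₗ[ℝ] M.Dens) (hΔ : SuperGeom.PosSupermanifold.IsCanonicalPencil B Δ) :
    ∃ X : SuperGeom.PosSupermanifold.EvenVectorField M,
      X.IsPoisson B ∧ X.IsLieDerivative (Δ ∘ₗ Δ) ∧
      (∀ ψ χ : M.Dens, Δ (Δ (ψ * χ)) = Δ (Δ ψ) * χ + ψ * Δ (Δ χ)) ∧
      SuperGeom.PosSupermanifold.AdjointEq 0 (-1) (Δ ∘ₗ Δ) :=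
  ⟨hΔ.vectorField hB, hΔ.isPoisson hB, hΔ.isLieDerivative hB, hΔ.sq_mul hB, hΔ.adjointEq_sq⟩
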